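/- Let $a,b\in\mathbb C\setminus\{0\}$, $E(z)=ae^{z}+be^{-z}$, and $F(t)=e^t-1$. A point $w$ is escaping if $|E^{\circ k}(w)|\to\infty$. Let $c=\frac12\ln\frac ba$ with $|\operatorname{Im}c|\le\pi/2$ (principal branch); the critical values are $v_1=E(c)$, $v_2=E(c+i\pi)$. Let $\mathcal A$ be the segment $[v_1,v_2]$ together with the vertical ray starting at $v_1$, going upwards if $\operatorname{Im}v_1\ge\operatorname{Im}v_2$ and downwards otherwise. The connected components of $E^{-1}(\mathbb C\setminus\mathcal A)$ can be labelled bijectively as strips $R_{(n,d)}$, $n\in\mathbb Z$, $d\in\{L,R\}$, such that $R_{(n+1,d)}=R_{(n,d)}+2\pi i$, the closure $\overline{R_{(0,R)}}$ contains some interval $[x_0,\infty)$ and $\overline{R_{(0,L)}}$ contains some interval $(-\infty,x_0]$. Fix any such labelling. An external address is a sequence $s=(s_1s_2\dots)$ with $s_k\in\mathbb Z\times\{L,R\}$; put $|(n,d)|=|n|$ and let $\sigma$ be the shift. A point $z$ has external address $s$ if for all $k\ge 0$ one has $E^{\circ k}(z)\notin\mathcal A$ and $E^{\circ k}(z)\in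 R_{s_{k+1}}$. The address $s$ is exponentially bounded if there is an $x>0$ with $|s_k|\le F^{\circ(k-1)}(x)$ for all $k\ge1$; its minimal potential is $t_s=\inf\{t>0:\lim_k |s_k|/F^{\circ(k-1)}(t)=0\}$. A ray tail at $s$ is an injective curve $g:[T,\infty)\to\mathbb C$, $T>0$, of escaping points with external address $s$ such that $\operatorname{Re}g(t)\to+\infty$ or $\operatorname{Re}g(t)\to-\infty$ as $t\to\infty$, and such that for every $t\ge T$, writing $s_{k+1}=(n_{k+1},d_{k+1})$, $E^{\circ k}(g(t))=\pm F^{\circ k}(t)+2\pi i n_{k+1}+O(1)$ as $k\to\infty$, with sign $+$ if $d_{k+1}=R$ and $-$ if $d_{k+1}=L$. The dynamic rays are the injective curves $g_s:(\tau_s,\infty)\to\mathbb C$ of escaping points, one for each exponentially bounded $s$, such that $g_s$ extends a ray tail at $s$, and for all $t>\tau_s$ one has $F(t)>\tau_{\sigma(s)}$ and $E(g_s(t))=g_{\sigma(s)}(F(t))$. Here $\tau_s=t_s$, unless there are potentials $t>t_s$ for which $g_{\sigma^n(s)}(F^{\circ n}(t))$ is defined and lies in $\{v_1,v_2\}$ for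 some $n\ge1$; in that case $\tau_s$ is the largest such $t$. We say that $g_s$ lands at $w$ with uniform escape if $\tau_s=t_s$, $w=\lim_{t\searrow t_s}g_s(t)$ is escaping, and for every $r\in\mathbb R$ there is an $N$ such that $|\operatorname{Re}E^{\circ n}(z)|>r$ for all $n\ge N$ and all $z\in g_s((t_s,\infty))\cup\{w\}$; in this case write $g_s(t_s):=w$. Call an escaping point $w$ exceptional if there are $i\in\{1,2\}$, an exponentially bounded $s$, potentials $t_s\le t'\le t$ and an $n\ge1$ such that $v_i=g_s(t)$ and $E^{\circ n}(w)=g_s(t')$. **Theorem (Escaping Points are Organized in Rays).** The family of dynamic rays exists, and for every escaping point $w$ the following holds. 1. If $w$ is not exceptional, then there are a unique exponentially bounded external address $s$ and a unique potential $t\ge t_s$ such that exactly one of the following holds: - $t>t_s$ and $w=g_s(t)$ (where $t>\tau_s$); - $t=t_s$ and the ray $g_s$ lands at $w$ with uniform escape. 2. If $w$ is exceptional, then $w$ does not lie on any dynamic ray, and it can be the landing point of a dynamic ray with uniform escape only if $E^{\circ m}(w)\in\{v_1,v_2\}$ for some $m\ge1$. -/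

import Mathlib

open Filter Topology Set

noncomputable section

namespace CosineFamily

/-- The cosine map `E_{a,b}(z) = a e^z + b e^{-z}`. -/
def E (a b z : ℂ) : ℂ := a * Complex.exp z + b * Complex.exp (-z)

/-- `z` is an escaping point: `|E^{∘ k}(z)| → ∞`. -/
def IsEscaping (a b z : ℂ) : Prop :=
  Tendsto (fun k : ℕ => ‖(E a b)^[k] z‖) atTop atTop

/-- The critical point `c = (1/2) ln (b/a)`, with `|Im c| ≤ π/2`. -/
def critPt (a b : ℂ) : ℂ := Complex.log (b / a) / 2

/-- The critical value `v₁`, the image of `c + 2πiℤ`. -/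
def v₁ (a b : ℂ) : ℂ := E a b (critPt a b)

/-- The critical value `v₂`, the image of `c + iπ + 2πiℤ`. -/
def v₂ (a b : ℂ) : ℂ := E a b (critPt a b + Real.pi * Complex.I)

/-- The slit `𝒜`: the segment between the critical values, together with the vertical ray at `v₁`
which points upwards if `Im v₁ ≥ Im v₂` and downwards otherwise. -/
def slit (a b : ℂ) : Set ℂ :=
  segment ℝ (v₁ a b) (v₂ a b) ∪
    {z | z.re = (v₁ a b).re ∧
      (((v₂ a b).im ≤ (v₁ a b).im ∧ (v₁ a b).im ≤ z.im) ∨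
        ((v₁ a b).im < (v₂ a b).im ∧ z.im ≤ (v₁ a b).im))}

/-- The two sides (left and right) of the partition. -/
inductive Side
  | left
  | right

/-- The sign attached to a side: `+1` for right, `-1` for left. -/
def Side.sign : Side → ℝ
  | Side.left => -1
  | Side.right => 1

/-- The symbols `ℤ × {L, R}`. -/
abbrev Symb : Type := ℤ × Side

/-- The preimage `E⁻¹(ℂ \ 𝒜)`, whose connected components are the strips. -/
def stripDomain (a b : ℂ) : Set ℂ := {z | E a b z ∉ slit a b}

/-- `R` labels the strips, i.e. the connected components of `E⁻¹(ℂ \ 𝒜)`, by `ℤ × {L, R}`: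
each strip gets exactly one label, translation by `2πi` raises the integer by one, the closure of
`R_{(0,R)}` contains a right end of the real axis and that of `R_{(0,L)}` a left end. -/
structure IsStripLabelling (a b : ℂ) (R : Symb → Set ℂ) : Prop where
  component : ∀ j, ∃ z ∈ stripDomain a b, R j = connectedComponentIn (stripDomain a b) z
  existsUnique_label : ∀ z ∈ stripDomain a b, ∃! j, z ∈ R j
  shift : ∀ (n : ℤ) (d : Side) (z : ℂ),
    z ∈ R (n, d) ↔ z + 2 * Real.pi * Complex.I ∈ R (n + 1, d)
  right_end : ∃ x₀ : ℝ, ∀ x : ℝ, x₀ ≤ x → (x : ℂ) ∈ closure (R (0, Side.right))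
  left_end : ∃ x₀ : ℝ, ∀ x : ℝ, x ≤ x₀ → (x : ℂ) ∈ closure (R (0, Side.left))

/-- External addresses. The entry `s k` (`k = 0, 1, 2, …`) is the entry usually written `s_{k+1}`. -/
abbrev Address : Type := ℕ → Symb

/-- The `n`-fold shift `σⁿ` of an external address. -/
def shift (n : ℕ) (s : Address) : Address := fun k => s (k + n)

/-- The orbit of `z` avoids `𝒜`, and `z` has external address `s`. -/
def HasAddress (a b : ℂ) (R : Symb → Set ℂ) (z : ℂ) (s : Address) : Prop :=
  ∀ k : ℕ, (E a b)^[k] z ∉ slit a b ∧ (E a b)^[k] z ∈ R (s k)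

/-- `F(t) = e^t - 1`. -/
def F (t : ℝ) : ℝ := Real.exp t - 1

/-- Exponentially bounded external addresses. -/
def ExpBounded (s : Address) : Prop :=
  ∃ x : ℝ, 0 < x ∧ ∀ k : ℕ, |((s k).1 : ℝ)| ≤ F^[k] x

/-- The minimal potential `t_s`. It is used only for exponentially bounded addresses; for these
the set is non-empty, so that the infimum is a finite number. -/
def minPot (s : Address) : ℝ :=
  sInf {t : ℝ | 0 < t ∧ Tendsto (fun k : ℕ => |((s k).1 : ℝ)| / F^[k] t) atTop (𝓝 0)}

/-- `g` restricted to `[T, ∞)` is a ray tail with external address `s`. -/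
structure IsRayTail (a b : ℂ) (R : Symb → Set ℂ) (s : Address) (T : ℝ) (g : ℝ → ℂ) : Prop where
  pos : 0 < T
  continuousOn : ContinuousOn g (Ici T)
  injOn : InjOn g (Ici T)
  escaping : ∀ t ∈ Ici T, IsEscaping a b (g t)
  address : ∀ t ∈ Ici T, HasAddress a b R (g t) s
  re_tendsto : Tendsto (fun t => (g t).re) atTop atTop ∨ Tendsto (fun t => (g t).re) atTop atBot
  asymptotics : ∀ t ∈ Ici T, ∃ C : ℝ, ∀ k : ℕ,
    ‖(E a b)^[k] (g t) -
      (((s k).2.sign * F^[k] t : ℝ) + 2 * Real.pi * Complex.I * ((s k).1 : ℂ))‖ ≤ C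

/-- The potentials `t > t_s` for which some `g_{σⁿ s}(Fⁿ(t))`, `n ≥ 1`, is a critical value. Here
`g_r` is the ray at address `r`, defined on `(τ r, ∞)`. -/
def critPotentials (a b : ℂ) (τ : Address → ℝ) (g : Address → ℝ → ℂ) (s : Address) : Set ℝ :=
  {t | minPot s < t ∧ ∃ n : ℕ, 1 ≤ n ∧ τ (shift n s) < F^[n] t ∧
    (g (shift n s) (F^[n] t) = v₁ a b ∨ g (shift n s) (F^[n] t) = v₂ a b)}

/-- `g` is the family of dynamic rays: for every exponentially bounded `s`, the ray `g_s` at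
external address `s` is the injective curve `g s` on `(τ s, ∞)`, consisting of escaping points,
which extends a ray tail at `s` and satisfies `E(g_s(t)) = g_{σ s}(F(t))`. It starts at the minimal
potential `t_s`, unless the pull-back meets a critical value; in this case it starts at the
largest potential `t*_s` at which this happens. These conditions determine `τ s` and the
restriction of `g s` to `(τ s, ∞)` for all exponentially bounded `s`. -/
structure IsDynamicRays (a b : ℂ) (R : Symb → Set ℂ)
    (τ : Address → ℝ) (g : Address → ℝ → ℂ) : Prop where
  continuousOn : ∀ s, ExpBounded s → ContinuousOn (g s) (Ioi (τ s))
  injOn : ∀ s, ExpBounded s → InjOn (g s) (Ioi (τ s))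
  escaping : ∀ s, ExpBounded s → ∀ t ∈ Ioi (τ s), IsEscaping a b (g s t)
  tail : ∀ s, ExpBounded s → ∃ T, τ s < T ∧ IsRayTail a b R s T (g s)
  functional : ∀ s, ExpBounded s → ∀ t ∈ Ioi (τ s),
    τ (shift 1 s) < F t ∧ E a b (g s t) = g (shift 1 s) (F t)
  start_regular : ∀ s, ExpBounded s → critPotentials a b τ g s = ∅ → τ s = minPot s
  start_exceptional : ∀ s, ExpBounded s → (critPotentials a b τ g s).Nonempty →
    IsGreatest (critPotentials a b τ g s) (τ s)

/-- `w = g_s(t)` with `t` a potential in the domain `(τ s, ∞)` of the ray (so that `t > t_s`). -/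
def OnRay (τ : Address → ℝ) (g : Address → ℝ → ℂ) (s : Address) (t : ℝ) (w : ℂ) : Prop :=
  minPot s < t ∧ τ s < t ∧ w = g s t

/-- The ray `g_s` is defined on all of `(t_s, ∞)`, it lands at the escaping point `w`, and `w` and
the ray escape uniformly. -/
def LandsUniformly (a b : ℂ) (τ : Address → ℝ) (g : Address → ℝ → ℂ) (s : Address) (w : ℂ) :
    Prop :=
  τ s = minPot s ∧ IsEscaping a b w ∧ Tendsto (g s) (𝓝[>] minPot s) (𝓝 w) ∧
    ∀ r : ℝ, ∃ N : ℕ, ∀ n ≥ N, r < |((E a b)^[n] w).re| ∧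
      ∀ t : ℝ, minPot s < t → r < |((E a b)^[n] (g s t)).re|

/-- `w = g_s(t)` for `t ≥ t_s`, where `g_s(t_s)` is the landing point of a ray that lands with
uniform escape. -/
def OnClosedRay (a b : ℂ) (τ : Address → ℝ) (g : Address → ℝ → ℂ) (s : Address) (t : ℝ) (w : ℂ) :
    Prop :=
  OnRay τ g s t w ∨ (t = minPot s ∧ LandsUniformly a b τ g s w)

/-- The exceptional points: a critical value `v` escapes, `v = g_s(t)` with `t ≥ t_s`, and a forward
iterate of `w` is `g_s(t')` with `t_s ≤ t' ≤ t`. -/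
def IsExceptional (a b : ℂ) (τ : Address → ℝ) (g : Address → ℝ → ℂ) (w : ℂ) : Prop :=
  ∃ (s : Address) (t t' : ℝ) (v : ℂ) (n : ℕ), ExpBounded s ∧ (v = v₁ a b ∨ v = v₂ a b) ∧
    OnClosedRay a b τ g s t v ∧ 1 ≤ n ∧ OnClosedRay a b τ g s t' ((E a b)^[n] w) ∧ t' ≤ t

end CosineFamily

end

open CosineFamily

noncomputable section

namespace CosineFamily

/-! ### Normal form of `E` and the preimage of the slit -/

section

/-! With `c` the critical point, `E z = v₁ cosh (z - c)` and `v₂ = -v₁`, so `E'² = E² - v₁²`. Where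
the image has large real part `E` expands, and the inverse branches into the strips contract by
`1/2`. Hence two orbits with the same address that stay far out and at bounded distance from each
other coincide (`Orbit.eq_of_bounded`). This rigidity is the main tool.

Rays. For a large potential `t` the model orbit `±F^k(t) + 2πi n_k` is pulled back through the
strips prescribed by `s`. The pull-backs converge geometrically, and the limit is the only far orbit
at address `s` at bounded distance from the model (`exists_tail_point`, `eq_of_model`). Smaller
potentials are reached by lifting the tails at `σⁿ s` through `E`; lifts exist and are unique as
long as no critical value is met (`exists_lift`, `lift_unique`). The infimum of the potentials
reached is `t_s`, or else a potential at which an image of the ray hits a critical value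
(`start_mem_critPotentials`).

Escaping points. The real parts of an escaping orbit tend to infinity in modulus, so some iterate
starts a far orbit with an address `s`, which is automatically exponentially bounded. Suppose this
orbit exceeds `F^n(t₁)` infinitely often for some `t₁ > t_s`. Then real parts eventually dominate
imaginary parts forever, they shadow an orbit of `F`, and rigidity puts an iterate on a ray
(`FarOrbit.exists_onRay`). Otherwise the orbit is slower than every potential above `t_s`. Then the
ray at `s` can be pulled back along the orbit without approaching a critical value, and it lands at
the orbit's starting point with uniform escape (`SlowOrbit.landsUniformly`).

It remains to return from the iterate to `w`. A ray with its end point is pulled back one step at a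
time (`exists_prepend_onClosedRay`); the only obstruction is a critical value on the ray at or above
the current potential, which is precisely exceptionality. Uniqueness follows from unique lifting and
injectivity of tails (`ray_injective`), and for landing points from local injectivity of iterates
(`eq_of_lands`). Ray points and landing points are never confused, since iterates of the latter are
eventually slow (`exists_slowOrbit_of_lands`). The statements on exceptional points follow because
no point of a ray has a critical value among its proper forward images. -/

theorem exp_two_mul_critPt {a b : ℂ} (ha : a ≠ 0) (hb : b ≠ 0) :
    Complex.exp (critPt a b) * Complex.exp (critPt a b) = b / a := by
  rw [← Complex.exp_add, critPt, add_halves, Complex.exp_log (div_ne_zero hb ha)]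

theorem E_eq_exp {a b : ℂ} (ha : a ≠ 0) (hb : b ≠ 0) (z : ℂ) :
    E a b z = a * Complex.exp (critPt a b) *
      (Complex.exp (z - critPt a b) + Complex.exp (-(z - critPt a b))) := by
  have h := exp_two_mul_critPt ha hb
  have h1 : Complex.exp z = Complex.exp (critPt a b) * Complex.exp (z - critPt a b) := by
    rw [← Complex.exp_add]; congr 1; ring
  have h2 : Complex.exp (-(z - critPt a b)) = Complex.exp (critPt a b) * Complex.exp (-z) := by
    rw [← Complex.exp_add]; congr 1; ring
  have h3 : a * (b / a) = b := by field_simp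
  rw [E, h2, h1]
  linear_combination (-h3 - a * h) * Complex.exp (-z)

theorem v₁_eq {a b : ℂ} (ha : a ≠ 0) (hb : b ≠ 0) :
    v₁ a b = 2 * (a * Complex.exp (critPt a b)) := by
  rw [v₁, E_eq_exp ha hb]; simp; ring

theorem v₁_ne_zero {a b : ℂ} (ha : a ≠ 0) (hb : b ≠ 0) : v₁ a b ≠ 0 := by
  rw [v₁_eq ha hb]
  exact mul_ne_zero two_ne_zero (mul_ne_zero ha (Complex.exp_ne_zero _))

theorem E_eq {a b : ℂ} (ha : a ≠ 0) (hb : b ≠ 0) (z : ℂ) :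
    E a b z = v₁ a b * Complex.cosh (z - critPt a b) := by
  rw [E_eq_exp ha hb, v₁_eq ha hb, Complex.cosh]; ring

theorem v₂_eq {a b : ℂ} (ha : a ≠ 0) (hb : b ≠ 0) : v₂ a b = -v₁ a b := by
  rw [v₂, E_eq ha hb]; simp [Complex.cosh_mul_I]

theorem hasStrictDerivAt_E {a b : ℂ} (ha : a ≠ 0) (hb : b ≠ 0) (z : ℂ) :
    HasStrictDerivAt (E a b) (v₁ a b * Complex.sinh (z - critPt a b)) z := by
  have h : E a b = fun z => v₁ a b * Complex.cosh (z - critPt a b) := funext (E_eq ha hb)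
  rw [h]
  have h1 := (Complex.hasStrictDerivAt_cosh (z - critPt a b)).comp z
    ((hasStrictDerivAt_id z).sub_const (critPt a b))
  simpa using h1.const_mul (v₁ a b)

/-- The size of `E'` depends on the value `E z` alone, so derivative bounds for inverse branches can
be read off from their argument. -/
theorem deriv_E_sq {a b : ℂ} (ha : a ≠ 0) (hb : b ≠ 0) (z : ℂ) :
    (v₁ a b * Complex.sinh (z - critPt a b)) ^ 2 = E a b z ^ 2 - v₁ a b ^ 2 := by
  rw [E_eq ha hb, mul_pow, mul_pow, Complex.cosh_sq]; ring

theorem deriv_E_ne_zero {a b : ℂ} (ha : a ≠ 0) (hb : b ≠ 0) {z : ℂ}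
    (h1 : E a b z ≠ v₁ a b) (h2 : E a b z ≠ v₂ a b) :
    v₁ a b * Complex.sinh (z - critPt a b) ≠ 0 := by
  intro h
  have h3 := deriv_E_sq ha hb z
  rw [h] at h3
  have h4 : (E a b z - v₁ a b) * (E a b z - v₂ a b) = 0 := by
    rw [v₂_eq ha hb]; linear_combination -h3
  rcases mul_eq_zero.1 h4 with h5 | h5
  · exact h1 (sub_eq_zero.1 h5)
  · exact h2 (sub_eq_zero.1 h5)

theorem continuous_E (a b : ℂ) : Continuous (E a b) := by
  unfold E; fun_prop

/-- The height over the point with real part `x` of the curve in the preimage of the slit. -/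
def height (m x : ℝ) : ℝ := 2 * Real.arctan (m * Real.tanh (x / 2))

theorem continuous_height (m : ℝ) : Continuous (height m) := by
  have : Continuous Real.tanh := by
    simp only [funext Real.tanh_eq_sinh_div_cosh]
    exact Real.continuous_sinh.div Real.continuous_cosh fun x => (Real.cosh_pos x).ne'
  unfold height; fun_prop

theorem abs_height_lt (m x : ℝ) : |height m x| < Real.pi := by
  have h1 := Real.arctan_lt_pi_div_two (m * Real.tanh (x / 2))
  have h2 := Real.neg_pi_div_two_lt_arctan (m * Real.tanh (x / 2))
  rw [height, abs_lt]; constructor <;> linarith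

theorem cosh_re_im (u : ℂ) : Complex.cosh u =
    ⟨Real.cosh u.re * Real.cos u.im, Real.sinh u.re * Real.sin u.im⟩ := by
  conv_lhs => rw [← Complex.re_add_im u, Complex.cosh_add, Complex.cosh_mul_I, Complex.sinh_mul_I]
  apply Complex.ext <;>
    simp [Complex.cos_ofReal_re, Complex.sin_ofReal_re, Complex.sinh_ofReal_re, Complex.cosh_ofReal_re]

theorem sinh_re_im (u : ℂ) : Complex.sinh u =
    ⟨Real.sinh u.re * Real.cos u.im, Real.cosh u.re * Real.sin u.im⟩ := by
  conv_lhs => rw [← Complex.re_add_im u, Complex.sinh_add, Complex.cosh_mul_I, Complex.sinh_mul_I]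
  apply Complex.ext <;>
    simp [Complex.cos_ofReal_re, Complex.sin_ofReal_re, Complex.sinh_ofReal_re, Complex.cosh_ofReal_re]

theorem cosh_mem_Icc_iff (u : ℂ) :
    (∃ t : ℝ, -1 ≤ t ∧ t ≤ 1 ∧ Complex.cosh u = t) ↔ u.re = 0 := by
  constructor
  · rintro ⟨t, h1, h2, h⟩
    have hre := congrArg Complex.re h
    have him := congrArg Complex.im h
    rw [cosh_re_im] at hre him
    simp only [Complex.ofReal_re, Complex.ofReal_im] at hre him
    by_contra h0
    have hs : Real.sin u.im = 0 := by
      rcases mul_eq_zero.1 him with h3 | h3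
      · exact absurd (Real.sinh_eq_zero.1 h3) h0
      · exact h3
    have hc : Real.cos u.im ^ 2 = 1 := by
      have := Real.sin_sq_add_cos_sq u.im
      rw [hs] at this; linarith
    have h4 := Real.one_lt_cosh.2 h0
    have h5 : t ^ 2 = Real.cosh u.re ^ 2 := by rw [← hre, mul_pow, hc, mul_one]
    nlinarith
  · intro h
    refine ⟨Real.cos u.im, Real.neg_one_le_cos _, Real.cos_le_one _, ?_⟩
    rw [cosh_re_im, h]
    apply Complex.ext <;> simp [Complex.cos_ofReal_re]

/-- Division by `v₁` turns the segment into `[-1, 1]` and the vertical ray into one with direction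
`p = ±i / v₁`. The choice between up and down in the slit is exactly what makes `Re p ≥ 0`. -/
theorem mem_slit_iff {a b : ℂ} (ha : a ≠ 0) (hb : b ≠ 0) : ∃ p : ℂ, p ≠ 0 ∧ 0 ≤ p.re ∧
    ∀ w : ℂ, v₁ a b * w ∈ slit a b ↔
      (∃ t : ℝ, -1 ≤ t ∧ t ≤ 1 ∧ w = t) ∨ ∃ s : ℝ, 0 ≤ s ∧ w = 1 + p * s := by
  have hv := v₁_ne_zero ha hb
  have hseg : ∀ w : ℂ, v₁ a b * w ∈ segment ℝ (v₁ a b) (v₂ a b) ↔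
      ∃ t : ℝ, -1 ≤ t ∧ t ≤ 1 ∧ w = t := by
    intro w
    rw [v₂_eq ha hb, segment_eq_image]
    constructor
    · rintro ⟨θ, ⟨h0, h1⟩, h⟩
      refine ⟨1 - 2 * θ, by linarith, by linarith, mul_left_cancel₀ hv ?_⟩
      rw [← h]; simp; ring
    · rintro ⟨t, h0, h1, rfl⟩
      refine ⟨(1 - t) / 2, ⟨by linarith, by linarith⟩, ?_⟩
      simp; ring
  obtain ⟨σ, hσ, hσv, hray⟩ : ∃ σ : ℝ, (σ = 1 ∨ σ = -1) ∧ 0 ≤ σ * (v₁ a b).im ∧ ∀ z : ℂ,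
      (z.re = (v₁ a b).re ∧ (((v₂ a b).im ≤ (v₁ a b).im ∧ (v₁ a b).im ≤ z.im) ∨
        ((v₁ a b).im < (v₂ a b).im ∧ z.im ≤ (v₁ a b).im))) ↔
      ∃ s : ℝ, 0 ≤ s ∧ z = v₁ a b + σ * Complex.I * s := by
    rw [v₂_eq ha hb, Complex.neg_im]
    rcases le_or_gt 0 (v₁ a b).im with h | h
    · refine ⟨1, Or.inl rfl, by linarith, fun z => ⟨?_, ?_⟩⟩
      · rintro ⟨h1, h2⟩
        refine ⟨z.im - (v₁ a b).im, ?_, ?_⟩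
        · rcases h2 with h2 | h2 <;> linarith
        · apply Complex.ext <;> simp [h1]
      · rintro ⟨s, hs, rfl⟩
        simp [hs]; left; linarith
    · refine ⟨-1, Or.inr rfl, by linarith, fun z => ⟨?_, ?_⟩⟩
      · rintro ⟨h1, h2⟩
        refine ⟨(v₁ a b).im - z.im, ?_, ?_⟩
        · rcases h2 with h2 | h2 <;> linarith
        · apply Complex.ext <;> simp [h1]
      · rintro ⟨s, hs, rfl⟩
        simp [hs]; right; linarith
  refine ⟨σ * Complex.I / v₁ a b, ?_, ?_, fun w => ?_⟩
  · rcases hσ with rfl | rfl <;> simp [hv]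
  · rw [Complex.div_re]
    have := Complex.normSq_nonneg (v₁ a b)
    simp
    positivity
  · rw [slit, mem_union, hseg, mem_ofPred_eq, hray]
    refine or_congr_right (exists_congr fun s => and_congr_right fun _ => ?_)
    constructor
    · intro h
      apply mul_left_cancel₀ hv
      rw [h]; field_simp
    · rintro rfl
      field_simp

/-- The principal root of such a `p` has argument in `[-π/4, π/4]`; the real line spanned by `q` is
therefore not vertical. -/
theorem exists_sq_eq {p : ℂ} (hp : p ≠ 0) (hre : 0 ≤ p.re) :
    ∃ q : ℂ, q ^ 2 = p ∧ 0 < q.re := by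
  refine ⟨Complex.exp (Complex.log p / 2), ?_, ?_⟩
  · rw [← Complex.exp_nat_mul]
    push_cast
    rw [mul_div_cancel₀ _ two_ne_zero, Complex.exp_log hp]
  · rw [Complex.exp_re]
    refine mul_pos (Real.exp_pos _) (Real.cos_pos_of_mem_Ioo ?_)
    have h := Complex.abs_arg_le_pi_div_two_iff.2 hre
    have := abs_le.1 h
    have hpi := Real.pi_pos
    have h2 : (Complex.log p / 2).im = p.arg / 2 := by
      rw [Complex.div_ofNat_im, Complex.log_im]
    rw [h2]
    constructor <;> linarith

/-- With `u = 2(x + iy)` the condition is `tan y = m tanh x`. It is handled as `sin (y - arctan (m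
tanh x)) = 0`, which stays meaningful where `cos y = 0`. -/
theorem sinh_half_iff (m : ℝ) (u : ℂ) :
    (Complex.sinh (u / 2)).im = m * (Complex.sinh (u / 2)).re ↔
      ∃ k : ℤ, u.im = height m u.re + 2 * Real.pi * k := by
  have hre : (u / 2).re = u.re / 2 := by simp
  have him : (u / 2).im = u.im / 2 := by simp
  rw [sinh_re_im]
  simp only [hre, him, height]
  set x := u.re / 2
  set y := u.im / 2 with hy
  set A := Real.arctan (m * Real.tanh x) with hA
  have hc : 0 < Real.cosh x := Real.cosh_pos x
  have hcA : 0 < Real.cos A := Real.cos_arctan_pos _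
  have htan : Real.sin A * Real.cosh x = m * Real.sinh x * Real.cos A := by
    have h1 : Real.tan A = m * Real.tanh x := Real.tan_arctan _
    rw [Real.tan_eq_sin_div_cos, Real.tanh_eq_sinh_div_cosh] at h1
    field_simp at h1
    linear_combination h1
  have key : (Real.cosh x * Real.sin y = m * (Real.sinh x * Real.cos y)) ↔ Real.sin (y - A) = 0 := by
    rw [Real.sin_sub]
    constructor
    · intro h
      have : Real.cosh x * (Real.sin y * Real.cos A - Real.cos y * Real.sin A) = 0 := by
        linear_combination Real.cos A * h - Real.cos y * htan
      exact (mul_eq_zero.1 this).resolve_left hc.ne'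
    · intro h
      have : Real.cos A * (Real.cosh x * Real.sin y - m * (Real.sinh x * Real.cos y)) = 0 := by
        linear_combination Real.cosh x * h + Real.cos y * htan
      linarith [(mul_eq_zero.1 this).resolve_left hcA.ne']
  rw [key, Real.sin_eq_zero_iff]
  refine exists_congr fun k => ?_
  constructor <;> intro h <;> linarith

/-- The preimage of the slit consists of the vertical line through the critical point and of the
translates of a graph. -/
theorem exists_E_mem_slit_iff {a b : ℂ} (ha : a ≠ 0) (hb : b ≠ 0) : ∃ m : ℝ, ∀ z : ℂ,
    E a b z ∈ slit a b ↔ (z - critPt a b).re = 0 ∨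
      ∃ k : ℤ, (z - critPt a b).im = height m (z - critPt a b).re + 2 * Real.pi * k := by
  obtain ⟨p, hp, hpre, hslit⟩ := mem_slit_iff ha hb
  obtain ⟨q, hq, hqre⟩ := exists_sq_eq hp hpre
  have hq0 : q ≠ 0 := by rintro rfl; simp at hqre
  refine ⟨q.im / q.re, fun z => ?_⟩
  rw [E_eq ha hb, hslit, cosh_mem_Icc_iff, ← sinh_half_iff]
  set u := z - critPt a b
  refine or_congr_right ?_
  -- Since `cosh u - 1 = 2 sinh² (u/2)`, the value `cosh u` is on the ray `1 + q² [0, ∞)` exactly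
  -- when `sinh (u/2)` is on the real line spanned by `q`, of slope `q.im / q.re`.
  have hcosh : Complex.cosh u = 1 + 2 * Complex.sinh (u / 2) ^ 2 := by
    have h := Complex.cosh_two_mul (u / 2)
    rw [mul_div_cancel₀ _ (two_ne_zero : (2 : ℂ) ≠ 0)] at h
    rw [h, Complex.cosh_sq]; ring
  rw [hcosh]
  set S := Complex.sinh (u / 2)
  constructor
  · rintro ⟨s, hs, h⟩
    have h1 : (S / q) ^ 2 = ((s / 2 : ℝ) : ℂ) := by
      rw [div_pow, hq]; field_simp; push_cast; linear_combination h / 2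
    have h2 : (S / q).im = 0 := by
      have hre := congrArg Complex.re h1
      have him := congrArg Complex.im h1
      simp only [pow_two, Complex.mul_re, Complex.mul_im, Complex.ofReal_re, Complex.ofReal_im]
        at hre him
      have : (S / q).re * (S / q).im = 0 := by linarith
      rcases mul_eq_zero.1 this with h3 | h3
      · rw [h3] at hre
        have : (S / q).im * (S / q).im = 0 := by nlinarith [mul_self_nonneg (S / q).im]
        exact mul_self_eq_zero.1 this
      · exact h3
    have h3 : S = q * (S / q) := by field_simp
    have hre := congrArg Complex.re h3
    have him := congrArg Complex.im h3
    rw [Complex.mul_re, h2] at hre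
    rw [Complex.mul_im, h2] at him
    rw [hre, him]; field_simp; ring
  · intro h
    refine ⟨2 * (S.re / q.re) ^ 2, by positivity, ?_⟩
    have h3 : S = q * ((S.re / q.re : ℝ) : ℂ) := by
      apply Complex.ext
      · rw [Complex.re_mul_ofReal]; field_simp
      · rw [Complex.im_mul_ofReal, h]; field_simp
    rw [h3, ← hq]
    simp only [Complex.re_mul_ofReal]
    rw [mul_div_cancel_left₀ _ hqre.ne']
    push_cast
    ring

end

/-! ### Explicit strips; every labelling consists of them -/

section

theorem Side.sign_cases (d : Side) : d.sign = 1 ∨ d.sign = -1 := by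
  cases d <;> simp [Side.sign]

theorem Side.sign_injective {d d' : Side} (h : d.sign = d'.sign) : d = d' := by
  cases d <;> cases d' <;> simp [Side.sign] at h <;> first | rfl | norm_num at h

theorem Side.eq_of_pos {d d' : Side} {x : ℝ} (h : 0 < d.sign * x) (h' : 0 < d'.sign * x) :
    d = d' := by
  apply Side.sign_injective
  rcases d.sign_cases with h1 | h1 <;> rcases d'.sign_cases with h2 | h2 <;>
    rw [h1] at h ⊢ <;> rw [h2] at h' ⊢ <;> linarith

theorem Side.exists_pos {x : ℝ} (hx : x ≠ 0) : ∃ d : Side, 0 < d.sign * x := by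
  rcases lt_or_gt_of_ne hx with h | h
  · exact ⟨Side.left, by simpa [Side.sign] using h⟩
  · exact ⟨Side.right, by simpa [Side.sign] using h⟩

/-- The strips in explicit form. -/
def strip (m : ℝ) (c : ℂ) (j : Symb) : Set ℂ :=
  {z | 0 < j.2.sign * (z - c).re ∧ height m (z - c).re + 2 * Real.pi * j.1 < (z - c).im ∧
    (z - c).im < height m (z - c).re + 2 * Real.pi * (j.1 + 1)}

theorem isOpen_strip (m : ℝ) (c : ℂ) (j : Symb) : IsOpen (strip m c j) := by
  have h := continuous_height m
  have h1 : IsOpen {z : ℂ | 0 < j.2.sign * (z - c).re} :=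
    isOpen_lt (by fun_prop) (by fun_prop)
  have h2 : IsOpen {z : ℂ | height m (z - c).re + 2 * Real.pi * j.1 < (z - c).im} :=
    isOpen_lt (by fun_prop) (by fun_prop)
  have h3 : IsOpen {z : ℂ | (z - c).im < height m (z - c).re + 2 * Real.pi * (j.1 + 1)} :=
    isOpen_lt (by fun_prop) (by fun_prop)
  exact h1.inter (h2.inter h3)

theorem strip_shift (m : ℝ) (c : ℂ) (n : ℤ) (d : Side) (z : ℂ) :
    z ∈ strip m c (n, d) ↔ z + 2 * Real.pi * Complex.I ∈ strip m c (n + 1, d) := by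
  have h1 : (z + 2 * Real.pi * Complex.I - c).re = (z - c).re := by simp
  have h2 : (z + 2 * Real.pi * Complex.I - c).im = (z - c).im + 2 * Real.pi := by simp; ring
  simp only [strip, mem_ofPred_eq, h1, h2]
  push_cast
  constructor <;> rintro ⟨h3, h4, h5⟩ <;> exact ⟨h3, by linarith, by linarith⟩

/-- A vertical shear by `height` carries a convex box onto the strip. -/
theorem isPreconnected_strip (m : ℝ) (c : ℂ) (j : Symb) : IsPreconnected (strip m c j) := by
  set B : Set ℂ := {u | 0 < j.2.sign * u.re ∧ 2 * Real.pi * j.1 < u.im ∧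
    u.im < 2 * Real.pi * (j.1 + 1)} with hB
  have hconv : Convex ℝ B := by
    have h1 : Convex ℝ {u : ℂ | 0 < j.2.sign * u.re} := by
      apply convex_halfSpace_gt
      exact (Complex.reLm.smulRight (1 : ℝ) |> fun f => (j.2.sign • Complex.reLm).isLinear)
    exact h1.inter ((convex_halfSpace_im_gt _).inter (convex_halfSpace_im_lt _))
  have himg : strip m c j = (fun u : ℂ => c + u + height m u.re * Complex.I) '' B := by
    ext z
    constructor
    · rintro ⟨h1, h2, h3⟩
      refine ⟨z - c - height m (z - c).re * Complex.I, ⟨?_, ?_, ?_⟩, ?_⟩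
      · simpa using h1
      · simp at h2 ⊢; linarith
      · simp at h3 ⊢; linarith
      · simp; ring
    · rintro ⟨u, ⟨h1, h2, h3⟩, rfl⟩
      refine ⟨?_, ?_, ?_⟩
      · simpa using h1
      · simp; linarith
      · simp; linarith
  rw [himg]
  refine hconv.isPreconnected.image _ (Continuous.continuousOn ?_)
  have := continuous_height m
  fun_prop

theorem exists_mem_strip {m : ℝ} {c z : ℂ} (h1 : (z - c).re ≠ 0)
    (h2 : ¬ ∃ k : ℤ, (z - c).im = height m (z - c).re + 2 * Real.pi * k) :
    ∃ j, z ∈ strip m c j := by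
  obtain ⟨d, hd⟩ := Side.exists_pos h1
  have hpi := Real.pi_pos
  set x := ((z - c).im - height m (z - c).re) / (2 * Real.pi) with hx
  have hx' : (z - c).im = height m (z - c).re + 2 * Real.pi * x := by
    rw [hx]; field_simp; ring
  refine ⟨(⌊x⌋, d), hd, ?_, ?_⟩
  · rw [hx']
    have : (⌊x⌋ : ℝ) < x := by
      refine lt_of_le_of_ne (Int.floor_le x) fun h => h2 ⟨⌊x⌋, ?_⟩
      rw [h]; exact hx'
    simp only; gcongr
  · rw [hx']
    have := Int.lt_floor_add_one x
    simp only; gcongr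

theorem strip_disjoint {m : ℝ} {c z : ℂ} {j j' : Symb} (h : z ∈ strip m c j)
    (h' : z ∈ strip m c j') : j = j' := by
  obtain ⟨h1, h2, h3⟩ := h
  obtain ⟨h1', h2', h3'⟩ := h'
  have hpi : 0 < 2 * Real.pi := by positivity
  refine Prod.ext ?_ (Side.eq_of_pos h1 h1')
  have h4 : (j.1 : ℝ) < j'.1 + 1 := lt_of_mul_lt_mul_left (by linarith) hpi.le
  have h5 : (j'.1 : ℝ) < j.1 + 1 := lt_of_mul_lt_mul_left (by linarith) hpi.le
  have h4' : j.1 < j'.1 + 1 := by exact_mod_cast h4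
  have h5' : j'.1 < j.1 + 1 := by exact_mod_cast h5
  omega

theorem strip_not_line {m : ℝ} {c z : ℂ} {j : Symb} (h : z ∈ strip m c j) :
    ¬ ((z - c).re = 0 ∨ ∃ k : ℤ, (z - c).im = height m (z - c).re + 2 * Real.pi * k) := by
  obtain ⟨h1, h2, h3⟩ := h
  have hpi : 0 < 2 * Real.pi := by positivity
  rintro (h | ⟨k, h⟩)
  · rw [h, mul_zero] at h1; exact lt_irrefl _ h1
  · rw [h] at h2 h3
    have h4 : (j.1 : ℝ) < k := lt_of_mul_lt_mul_left (by linarith) hpi.le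
    have h5 : (k : ℝ) < j.1 + 1 := lt_of_mul_lt_mul_left (by linarith) hpi.le
    have h4' : j.1 < k := by exact_mod_cast h4
    have h5' : k < j.1 + 1 := by exact_mod_cast h5
    omega

theorem cosh_eq_cosh_iff {u u' : ℂ} (h : Complex.cosh u = Complex.cosh u') :
    ∃ k : ℤ, u' = u + 2 * Real.pi * k * Complex.I ∨ u' = -u + 2 * Real.pi * k * Complex.I := by
  rw [← Complex.cos_mul_I, ← Complex.cos_mul_I, Complex.cos_eq_cos_iff] at h
  obtain ⟨k, h | h⟩ := h
  · refine ⟨-k, Or.inl ?_⟩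
    apply mul_right_cancel₀ Complex.I_ne_zero
    rw [h]; push_cast; linear_combination (2 * Real.pi * k : ℂ) * Complex.I_mul_I
  · refine ⟨-k, Or.inr ?_⟩
    apply mul_right_cancel₀ Complex.I_ne_zero
    rw [h]; push_cast; linear_combination (2 * Real.pi * k : ℂ) * Complex.I_mul_I

/-- `cosh` identifies `u` only with `±u + 2πik`: the change of sign switches sides, and a nonzero
translation leaves the strip. -/
theorem injOn_strip {a b : ℂ} (ha : a ≠ 0) (hb : b ≠ 0) (m : ℝ) (j : Symb) :
    InjOn (E a b) (strip m (critPt a b) j) := by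
  intro z hz z' hz' h
  rw [E_eq ha hb, E_eq ha hb] at h
  obtain ⟨k, hk | hk⟩ := cosh_eq_cosh_iff (mul_left_cancel₀ (v₁_ne_zero ha hb) h)
  · have hz2 : z' = z + 2 * Real.pi * k * Complex.I := by linear_combination hk
    obtain ⟨h1, h2, h3⟩ := hz
    obtain ⟨h1', h2', h3'⟩ := hz'
    rw [hk] at h1' h2' h3'
    have hpi : 0 < 2 * Real.pi := by positivity
    simp at h1 h2 h3 h1' h2' h3'
    have h4 : (k : ℝ) < 1 := lt_of_mul_lt_mul_left (by linarith) hpi.le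
    have h5 : (-1 : ℝ) < k := lt_of_mul_lt_mul_left (by linarith) hpi.le
    have h4' : k < 1 := by exact_mod_cast h4
    have h5' : -1 < k := by exact_mod_cast h5
    have : k = 0 := by omega
    rw [hz2, this]; simp
  · have h1 := hz.1
    have h2 := hz'.1
    rw [hk] at h2
    simp at h1 h2
    linarith

/-- Any preimage can be moved into the prescribed strip by the symmetries of `cosh`: reflection in
the critical point selects the side, translation by multiples of `2πi` the integer. -/
theorem exists_mem_strip_E_eq {a b : ℂ} (ha : a ≠ 0) (hb : b ≠ 0) {m : ℝ}
    (hm : ∀ z : ℂ, E a b z ∈ slit a b ↔ (z - critPt a b).re = 0 ∨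
      ∃ k : ℤ, (z - critPt a b).im = height m (z - critPt a b).re + 2 * Real.pi * k)
    (j : Symb) {w : ℂ} (hw : w ∉ slit a b) : ∃ z ∈ strip m (critPt a b) j, E a b z = w := by
  have hv := v₁_ne_zero ha hb
  obtain ⟨u', hu'⟩ := Complex.cos_surjective (w / v₁ a b)
  obtain ⟨u, hu⟩ : ∃ u, E a b (critPt a b + u) = w := by
    refine ⟨u' * Complex.I, ?_⟩
    rw [E_eq ha hb, add_sub_cancel_left, Complex.cosh_mul_I, hu']; field_simp
  have hper : ∀ (u : ℂ) (k : ℤ), E a b (critPt a b + u + k * (2 * Real.pi * Complex.I)) =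
      E a b (critPt a b + u) := by
    intro u k
    have h2 : critPt a b + u + k * (2 * Real.pi * Complex.I) - critPt a b =
      u + k * (2 * Real.pi * Complex.I) := by ring
    have h3 : -(u + k * (2 * Real.pi * Complex.I)) =
      -u + ((-k : ℤ) : ℂ) * (2 * Real.pi * Complex.I) := by push_cast; ring
    rw [E_eq_exp ha hb, E_eq_exp ha hb, h2, h3, Complex.exp_periodic.int_mul k,
      Complex.exp_periodic.int_mul (-k), add_sub_cancel_left]
  have hneg : E a b (critPt a b + -u) = w := by
    rw [E_eq ha hb] at hu ⊢
    rw [add_sub_cancel_left] at hu ⊢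
    rw [Complex.cosh_neg, hu]
  have hre : u.re ≠ 0 := by
    intro h
    apply hw
    rw [← hu, hm]
    left; simpa using h
  obtain ⟨u, hu, hd⟩ : ∃ u, E a b (critPt a b + u) = w ∧ 0 < j.2.sign * u.re := by
    rcases lt_or_gt_of_ne (mul_ne_zero (show j.2.sign ≠ 0 by
      rcases j.2.sign_cases with h | h <;> rw [h] <;> norm_num) hre) with h | h
    · exact ⟨-u, hneg, by simpa using h⟩
    · exact ⟨u, hu, h⟩
  have hsl : E a b (critPt a b + u) ∉ slit a b := by rwa [hu]
  rw [hm, not_or] at hsl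
  obtain ⟨i, hi⟩ := exists_mem_strip hsl.1 hsl.2
  have hside : i.2 = j.2 := by
    refine Side.eq_of_pos hi.1 ?_
    simpa using hd
  refine ⟨critPt a b + u + (j.1 - i.1 : ℤ) * (2 * Real.pi * Complex.I), ⟨?_, ?_, ?_⟩, ?_⟩
  · simpa using hd
  · have := hi.2.1
    simp at this ⊢
    linarith
  · have := hi.2.2
    simp at this ⊢
    linarith
  · rw [hper, hu]

theorem connectedComponentIn_eq_strip {a b : ℂ} {m : ℝ}
    (hm : ∀ z : ℂ, E a b z ∈ slit a b ↔ (z - critPt a b).re = 0 ∨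
      ∃ k : ℤ, (z - critPt a b).im = height m (z - critPt a b).re + 2 * Real.pi * k)
    {j : Symb} {z : ℂ} (hz : z ∈ strip m (critPt a b) j) :
    connectedComponentIn (stripDomain a b) z = strip m (critPt a b) j := by
  have hsub : ∀ i, strip m (critPt a b) i ⊆ stripDomain a b := by
    intro i z hz
    rw [stripDomain, mem_ofPred_eq, hm]
    exact strip_not_line hz
  apply Subset.antisymm
  · refine isPreconnected_connectedComponentIn.subset_left_of_subset_union
      (v := ⋃ i ∈ {i | i ≠ j}, strip m (critPt a b) i) (isOpen_strip _ _ _)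
      (isOpen_biUnion fun i _ => isOpen_strip _ _ _) ?_ ?_
      ⟨z, mem_connectedComponentIn (hsub _ hz), hz⟩
    · rw [Set.disjoint_left]
      intro x hx hx'
      simp only [mem_iUnion] at hx'
      obtain ⟨i, hi, hx'⟩ := hx'
      exact hi (strip_disjoint hx' hx)
    · refine (connectedComponentIn_subset _ _).trans fun x hx => ?_
      rw [stripDomain, mem_ofPred_eq, hm, not_or] at hx
      obtain ⟨i, hi⟩ := exists_mem_strip hx.1 hx.2
      by_cases hij : i = j
      · left; rwa [← hij]
      · right; exact mem_biUnion (show i ∈ {i | i ≠ j} from hij) hi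
  · exact (isPreconnected_strip _ _ _).subset_connectedComponentIn hz (hsub _)

theorem nonempty_strip (m : ℝ) (c : ℂ) (j : Symb) : (strip m c j).Nonempty := by
  set h := height m j.2.sign
  have hpi := Real.pi_pos
  refine ⟨c + j.2.sign + (h + 2 * Real.pi * j.1 + Real.pi : ℝ) * Complex.I, ?_, ?_, ?_⟩
  · rcases j.2.sign_cases with h | h <;> simp [h]
  · simp; linarith
  · simp; linarith

/-- The ends of the real axis fix the side of each label; there remains one integer offset per side.
It is harmless, since imaginary parts matter only up to a bounded error. -/
theorem exists_labelling_eq_strip {a b : ℂ} {m : ℝ}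
    (hm : ∀ z : ℂ, E a b z ∈ slit a b ↔ (z - critPt a b).re = 0 ∨
      ∃ k : ℤ, (z - critPt a b).im = height m (z - critPt a b).re + 2 * Real.pi * k)
    {R : Symb → Set ℂ} (hR : IsStripLabelling a b R) :
    ∃ k : Side → ℤ, ∀ n d, R (n, d) = strip m (critPt a b) (n + k d, d) := by
  have hcomp : ∀ j, ∃ i, R j = strip m (critPt a b) i := by
    intro j
    obtain ⟨z, hz, h⟩ := hR.component j
    rw [stripDomain, mem_ofPred_eq, hm, not_or] at hz
    obtain ⟨i, hi⟩ := exists_mem_strip hz.1 hz.2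
    exact ⟨i, by rw [h, connectedComponentIn_eq_strip hm hi]⟩
  have hzero : ∀ d, ∃ k : ℤ, R (0, d) = strip m (critPt a b) (k, d) := by
    intro d
    obtain ⟨⟨k, d'⟩, h⟩ := hcomp (0, d)
    suffices d' = d by exact ⟨k, by rw [h, this]⟩
    have hcl : closure (R (0, d)) ⊆ {z | 0 ≤ d'.sign * (z - critPt a b).re} := by
      rw [h]
      refine closure_minimal (fun z hz => hz.1.le) (isClosed_le (by fun_prop) (by fun_prop))
    cases d with
    | left =>
      obtain ⟨x₀, hx₀⟩ := hR.left_end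
      have h1 := hcl (hx₀ (min x₀ ((critPt a b).re - 1)) (min_le_left _ _))
      have h2 := min_le_right x₀ ((critPt a b).re - 1)
      cases d' with
      | left => rfl
      | right => simp [Side.sign] at h1; linarith
    | right =>
      obtain ⟨x₀, hx₀⟩ := hR.right_end
      have h1 := hcl (hx₀ (max x₀ ((critPt a b).re + 1)) (le_max_left _ _))
      have h2 := le_max_right x₀ ((critPt a b).re + 1)
      cases d' with
      | right => rfl
      | left => simp [Side.sign] at h1; linarith
  choose k hk using hzero
  refine ⟨k, fun n d => ?_⟩
  induction n using Int.induction_on with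
  | zero => rw [hk, zero_add]
  | succ n ih =>
    ext z
    have h1 := hR.shift n d (z - 2 * Real.pi * Complex.I)
    have h2 := strip_shift m (critPt a b) (n + k d) d (z - 2 * Real.pi * Complex.I)
    rw [sub_add_cancel] at h1 h2
    rw [← h1, ih, h2, add_right_comm]
  | pred n ih =>
    ext z
    have h1 := hR.shift (-n - 1) d z
    have h2 := strip_shift m (critPt a b) (-n - 1 + k d) d z
    have h3 : (-n - 1 + 1 : ℤ) = -n := by ring
    rw [h1, h2, h3, ih]
    congr! 3; ring

end

/-! ### Existence of a labelling; vertical bounds for strips -/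

section

theorem tanh_monotone : Monotone Real.tanh := by
  intro x y hxy
  rw [Real.tanh_eq_sinh_div_cosh, Real.tanh_eq_sinh_div_cosh,
    div_le_div_iff₀ (Real.cosh_pos x) (Real.cosh_pos y)]
  have h := Real.sinh_nonpos_iff.2 (sub_nonpos.2 hxy)
  rw [Real.sinh_sub] at h
  linarith

theorem height_monotone_or_antitone (m : ℝ) : Monotone (height m) ∨ Antitone (height m) := by
  rcases le_total 0 m with hm | hm
  · left
    intro x y hxy
    have := tanh_monotone (div_le_div_of_nonneg_right hxy zero_le_two)
    unfold height
    gcongr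
  · right
    intro x y hxy
    have := tanh_monotone (div_le_div_of_nonneg_right hxy zero_le_two)
    unfold height
    exact mul_le_mul_of_nonneg_left
      (Real.arctan_mono (mul_le_mul_of_nonpos_left this hm)) zero_le_two

theorem eventually_sign_of_monotone_or_antitone {f : ℝ → ℝ} (hf : Monotone f ∨ Antitone f) :
    (∃ x₀, ∀ x ≥ x₀, 0 ≤ f x) ∨ ∃ x₀, ∀ x ≥ x₀, f x ≤ 0 := by
  rcases hf with hf | hf
  · by_cases h : ∃ x₀, 0 ≤ f x₀
    · obtain ⟨x₀, h⟩ := h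
      exact Or.inl ⟨x₀, fun x hx => h.trans (hf hx)⟩
    · push Not at h
      exact Or.inr ⟨0, fun x _ => (h x).le⟩
  · by_cases h : ∃ x₀, f x₀ ≤ 0
    · obtain ⟨x₀, h⟩ := h
      exact Or.inr ⟨x₀, fun x hx => (hf hx).trans h⟩
    · push Not at h
      exact Or.inl ⟨0, fun x _ => (h x).le⟩

theorem abs_critPt_im_le (a b : ℂ) : |(critPt a b).im| ≤ Real.pi / 2 := by
  rw [critPt, Complex.div_ofNat_im, Complex.log_im, abs_div, abs_two]
  have := Complex.abs_arg_le_pi (b / a)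
  linarith

theorem mem_closure_strip {m : ℝ} {c z : ℂ} {j : Symb} (h1 : 0 < j.2.sign * (z - c).re)
    (h2 : height m (z - c).re + 2 * Real.pi * j.1 ≤ (z - c).im)
    (h3 : (z - c).im ≤ height m (z - c).re + 2 * Real.pi * (j.1 + 1)) :
    z ∈ closure (strip m c j) := by
  set H := height m (z - c).re with hH
  have hpi := Real.pi_pos
  -- `y` lies over the same abscissa at mid-height of the strip; the open vertical segment from `z`
  -- to `y` stays inside.
  set y : ℂ := ⟨z.re, c.im + H + 2 * Real.pi * j.1 + Real.pi⟩ with hy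
  refine closure_mono ?_ (segment_subset_closure_openSegment (𝕜 := ℝ) (left_mem_segment ℝ z y))
  rintro w ⟨p, q, hp, hq, hpq, rfl⟩
  have hre : (p • z + q • y - c).re = (z - c).re := by
    simp [hy]; linear_combination z.re * hpq
  have him : (p • z + q • y - c).im =
      p * (z - c).im + q * (H + 2 * Real.pi * j.1 + Real.pi) := by
    simp [hy]; linear_combination c.im * hpq
  refine ⟨by rwa [hre], ?_, ?_⟩
  · rw [hre, him, ← hH]
    have : H + 2 * Real.pi * j.1 = p * (H + 2 * Real.pi * j.1) + q * (H + 2 * Real.pi * j.1) := by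
      rw [← add_mul, hpq, one_mul]
    have := mul_le_mul_of_nonneg_left h2 hp.le
    have : q * (H + 2 * Real.pi * j.1) < q * (H + 2 * Real.pi * j.1 + Real.pi) := by
      apply mul_lt_mul_of_pos_left _ hq; linarith
    linarith
  · rw [hre, him, ← hH]
    have : H + 2 * Real.pi * (j.1 + 1) =
        p * (H + 2 * Real.pi * (j.1 + 1)) + q * (H + 2 * Real.pi * (j.1 + 1)) := by
      rw [← add_mul, hpq, one_mul]
    have := mul_le_mul_of_nonneg_left h3 hp.le
    have : q * (H + 2 * Real.pi * j.1 + Real.pi) < q * (H + 2 * Real.pi * (j.1 + 1)) := by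
      apply mul_lt_mul_of_pos_left _ hq; linarith
    linarith

/-- Along an end of the real axis the height above the boundary graph is monotone and at most `2π`
in modulus, so its sign settles and the end runs in strip `0` or `-1`. It may run on a boundary
curve, hence the closure. -/
theorem exists_closure_strip_end (a b : ℂ) (m : ℝ) (d : Side) :
    ∃ (k : ℤ) (x₀ : ℝ), ∀ x ≥ x₀,
      ((d.sign * x : ℝ) : ℂ) ∈ closure (strip m (critPt a b) (k, d)) := by
  set c := critPt a b
  have hpi := Real.pi_pos
  set f : ℝ → ℝ := fun x => -c.im - height m (d.sign * x - c.re) with hf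
  have hbd : ∀ x, |f x| ≤ 2 * Real.pi := by
    intro x
    have h1 := (abs_height_lt m (d.sign * x - c.re)).le
    have h2 := abs_critPt_im_le a b
    rw [abs_le] at h1 h2 ⊢
    simp only [hf]
    constructor <;> linarith [h1.1, h1.2, h2.1, h2.2]
  have hmono : Monotone f ∨ Antitone f := by
    have hd : Monotone (fun x : ℝ => d.sign * x - c.re) ∨
        Antitone (fun x : ℝ => d.sign * x - c.re) := by
      rcases d.sign_cases with h | h
      · left; intro x y hxy; simp [h, hxy]
      · right; intro x y hxy; simp [h, hxy]
    rcases height_monotone_or_antitone m with h1 | h1 <;> rcases hd with h2 | h2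
    · right; intro x y hxy; have := h1 (h2 hxy); simp only [hf]; linarith
    · left; intro x y hxy; have := h1 (h2 hxy); simp only [hf]; linarith
    · left; intro x y hxy; have := h1 (h2 hxy); simp only [hf]; linarith
    · right; intro x y hxy; have := h1 (h2 hxy); simp only [hf]; linarith
  have hside : ∀ x > |c.re|, 0 < d.sign * (((d.sign * x : ℝ) : ℂ) - c).re := by
    intro x hx
    have := abs_lt.1 hx
    rcases d.sign_cases with h | h <;> simp [h] <;> linarith
  have hre : ∀ x : ℝ, (((d.sign * x : ℝ) : ℂ) - c).re = d.sign * x - c.re := by simp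
  have him : ∀ x : ℝ, (((d.sign * x : ℝ) : ℂ) - c).im = -c.im := by simp
  rcases eventually_sign_of_monotone_or_antitone hmono with ⟨x₀, h⟩ | ⟨x₀, h⟩
  · refine ⟨0, max x₀ (|c.re| + 1), fun x hx => ?_⟩
    have h1 := h x (le_trans (le_max_left _ _) hx)
    have h2 := (abs_le.1 (hbd x)).2
    refine mem_closure_strip (hside x ?_) ?_ ?_
    · linarith [le_max_right x₀ (|c.re| + 1)]
    · rw [hre, him]; simp only [hf] at h1 h2; push_cast; linarith
    · rw [hre, him]; simp only [hf] at h1 h2; push_cast; linarith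
  · refine ⟨-1, max x₀ (|c.re| + 1), fun x hx => ?_⟩
    have h1 := h x (le_trans (le_max_left _ _) hx)
    have h2 := (abs_le.1 (hbd x)).1
    refine mem_closure_strip (hside x ?_) ?_ ?_
    · linarith [le_max_right x₀ (|c.re| + 1)]
    · rw [hre, him]; simp only [hf] at h1 h2; push_cast; linarith
    · rw [hre, him]; simp only [hf] at h1 h2; push_cast; linarith

theorem exists_isStripLabelling {a b : ℂ} (ha : a ≠ 0) (hb : b ≠ 0) :
    ∃ R : Symb → Set ℂ, IsStripLabelling a b R := by
  obtain ⟨m, hm⟩ := exists_E_mem_slit_iff ha hb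
  choose k x₀ hk using exists_closure_strip_end a b m
  refine ⟨fun j => strip m (critPt a b) (j.1 + k j.2, j.2), ?_, ?_, ?_, ?_, ?_⟩
  · intro j
    obtain ⟨z, hz⟩ := nonempty_strip m (critPt a b) (j.1 + k j.2, j.2)
    refine ⟨z, ?_, (connectedComponentIn_eq_strip hm hz).symm⟩
    rw [stripDomain, mem_ofPred_eq, hm]
    exact strip_not_line hz
  · intro z hz
    rw [stripDomain, mem_ofPred_eq, hm, not_or] at hz
    obtain ⟨i, hi⟩ := exists_mem_strip hz.1 hz.2
    refine ⟨(i.1 - k i.2, i.2), by simpa using hi, fun j hj => ?_⟩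
    have := strip_disjoint hj hi
    rw [← this]; simp
  · intro n d z
    have := strip_shift m (critPt a b) (n + k d) d z
    simp only [this, add_right_comm]
  · refine ⟨x₀ Side.right, fun x hx => ?_⟩
    simpa [Side.sign] using hk Side.right x hx
  · refine ⟨-x₀ Side.left, fun x hx => ?_⟩
    simpa [Side.sign] using hk Side.left (-x) (by linarith)

variable {a b : ℂ} {R : Symb → Set ℂ}

/-- The facts about the strips of a labelling on which the construction of rays relies. -/
theorem IsStripLabelling.exists_im_bound (hR : IsStripLabelling a b R) (ha : a ≠ 0) (hb : b ≠ 0) :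
    (∀ j, IsOpen (R j)) ∧ (∀ j, InjOn (E a b) (R j)) ∧
    (∀ j w, w ∉ slit a b → ∃ z ∈ R j, E a b z = w) ∧
    (∀ j, ∀ z ∈ R j, E a b z ∉ slit a b) ∧
    (∀ j, ∀ z ∈ R j, 0 < j.2.sign * (z - critPt a b).re) ∧
    ∃ C > 0, ∀ j : Symb, ∀ z ∈ R j, |z.im - 2 * Real.pi * j.1| ≤ C := by
  obtain ⟨m, hm⟩ := exists_E_mem_slit_iff ha hb
  obtain ⟨k, hk⟩ := exists_labelling_eq_strip hm hR
  have hk' : ∀ j : Symb, R j = strip m (critPt a b) (j.1 + k j.2, j.2) := fun j => hk j.1 j.2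
  refine ⟨fun j => ?_, fun j => ?_, fun j w hw => ?_, fun j z hz => ?_, fun j z hz => ?_, ?_⟩
  · rw [hk']; exact isOpen_strip _ _ _
  · rw [hk']; exact injOn_strip ha hb m _
  · rw [hk']; exact exists_mem_strip_E_eq ha hb hm _ hw
  · rw [hk'] at hz; rw [hm]; exact strip_not_line hz
  · rw [hk'] at hz; exact hz.1
  · have hpi := Real.pi_pos
    refine ⟨|(critPt a b).im| + Real.pi + 2 * Real.pi *
      (|(k Side.left : ℝ)| + |(k Side.right : ℝ)| + 1), by positivity, fun j z hz => ?_⟩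
    rw [hk'] at hz
    obtain ⟨-, h1, h2⟩ := hz
    have h3 := abs_lt.1 (abs_height_lt m (z - critPt a b).re)
    have h4 : |(k j.2 : ℝ)| ≤ |(k Side.left : ℝ)| + |(k Side.right : ℝ)| := by
      cases j.2 <;> simp
    rw [Complex.sub_im] at h1 h2
    push_cast at h1 h2
    have h5 := abs_le.1 (le_refl |(critPt a b).im|)
    have h6 := abs_le.1 h4
    have h7 := mul_le_mul_of_nonneg_left h6.1 (by positivity : (0 : ℝ) ≤ 2 * Real.pi)
    have h8 := mul_le_mul_of_nonneg_left h6.2 (by positivity : (0 : ℝ) ≤ 2 * Real.pi)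
    rw [abs_le]
    constructor <;> nlinarith [h3.1, h3.2, h5.1, h5.2]

end

/-! ### Iteration of `F`, shadowing, and minimal potentials -/

section

theorem F_strictMono : StrictMono F := fun x y h => by
  unfold F; linarith [Real.exp_lt_exp.2 h]

theorem continuous_F : Continuous F := by unfold F; fun_prop

@[simp] theorem F_zero : F 0 = 0 := by simp [F]

theorem le_F (t : ℝ) : t ≤ F t := by
  have := Real.add_one_le_exp t
  unfold F; linarith

theorem F_iterate_strictMono (n : ℕ) : StrictMono F^[n] := F_strictMono.iterate n

theorem F_iterate_zero (n : ℕ) : F^[n] 0 = 0 := Function.iterate_fixed F_zero n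

theorem F_iterate_nonneg (n : ℕ) {t : ℝ} (ht : 0 ≤ t) : 0 ≤ F^[n] t := by
  rw [← F_iterate_zero n]; exact (F_iterate_strictMono n).monotone ht

theorem F_iterate_pos (n : ℕ) {t : ℝ} (ht : 0 < t) : 0 < F^[n] t := by
  rw [← F_iterate_zero n]; exact (F_iterate_strictMono n) ht

theorem le_F_iterate (n : ℕ) (t : ℝ) : t ≤ F^[n] t := by
  induction n with
  | zero => simp
  | succ n ih => rw [Function.iterate_succ_apply']; exact ih.trans (le_F _)

theorem tendsto_F_iterate {t : ℝ} (ht : 0 < t) : Tendsto (fun n => F^[n] t) atTop atTop := by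
  have key : ∀ n : ℕ, t + n * (t ^ 2 / 2) ≤ F^[n] t := by
    intro n
    induction n with
    | zero => simp
    | succ n ih =>
      rw [Function.iterate_succ_apply']
      have h0 := le_F_iterate n t
      have h1 := Real.quadratic_le_exp_of_nonneg (ht.le.trans h0)
      have h2 : t ^ 2 ≤ (F^[n] t) ^ 2 := pow_le_pow_left₀ ht.le h0 2
      push_cast
      have h3 : F (F^[n] t) = Real.exp (F^[n] t) - 1 := rfl
      rw [h3]
      linarith
  refine tendsto_atTop_mono key (tendsto_atTop_add_const_left _ _ ?_)
  exact tendsto_natCast_atTop_atTop.atTop_mul_const (by positivity)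

/-- Superadditivity of `F`; iterated, it makes the orbits of different potentials drift apart to
infinity. -/
theorem F_sub_le {u t : ℝ} (hu : 0 ≤ u) (ht : u ≤ t) : F (t - u) ≤ F t - F u := by
  unfold F
  have h1 : Real.exp t = Real.exp u * Real.exp (t - u) := by rw [← Real.exp_add]; congr 1; ring
  have h2 := Real.one_le_exp hu
  have h3 := Real.one_le_exp (sub_nonneg.2 ht)
  rw [h1]; nlinarith

theorem F_iterate_sub_le (n : ℕ) {u t : ℝ} (hu : 0 ≤ u) (ht : u ≤ t) :
    F^[n] (t - u) ≤ F^[n] t - F^[n] u := by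
  induction n with
  | zero => simp
  | succ n ih =>
    rw [Function.iterate_succ_apply', Function.iterate_succ_apply', Function.iterate_succ_apply']
    exact (F_strictMono.monotone ih).trans
      (F_sub_le (F_iterate_nonneg n hu) ((F_iterate_strictMono n).monotone ht))

theorem tendsto_F_iterate_sub {u t : ℝ} (hu : 0 ≤ u) (ht : u < t) :
    Tendsto (fun n => F^[n] t - F^[n] u) atTop atTop :=
  tendsto_atTop_mono (fun n => F_iterate_sub_le n hu ht.le) (tendsto_F_iterate (sub_pos.2 ht))

/-- Each quotient is at most the exponential of minus the previous difference, and the differences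
tend to infinity. -/
theorem tendsto_F_iterate_div {u t : ℝ} (hu : 0 ≤ u) (ht : u < t) :
    Tendsto (fun n => F^[n] u / F^[n] t) atTop (𝓝 0) := by
  rw [← tendsto_add_atTop_iff_nat 1]
  have h1 : Tendsto (fun n => Real.exp (-(F^[n] t - F^[n] u))) atTop (𝓝 0) :=
    Real.tendsto_exp_neg_atTop_nhds_zero.comp (tendsto_F_iterate_sub hu ht)
  refine squeeze_zero (fun n => div_nonneg (F_iterate_nonneg _ hu)
    (F_iterate_nonneg _ (hu.trans ht.le))) (fun n => ?_) h1
  have h2 := F_iterate_pos (n + 1) (hu.trans_lt ht)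
  rw [div_le_iff₀ h2, Function.iterate_succ_apply', Function.iterate_succ_apply']
  set A := F^[n] u
  set B := F^[n] t
  have hAB : A ≤ B := (F_iterate_strictMono n).monotone ht.le
  unfold F
  have h3 : Real.exp A = Real.exp (-(B - A)) * Real.exp B := by
    rw [← Real.exp_add]; congr 1; ring
  have h4 : Real.exp (-(B - A)) ≤ 1 := Real.exp_le_one_iff.2 (by linarith)
  linarith

/-- The inverse of `F`. -/
def Finv (t : ℝ) : ℝ := Real.log (1 + t)

theorem F_Finv {t : ℝ} (ht : -1 < t) : F (Finv t) = t := by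
  unfold F Finv; rw [Real.exp_log (by linarith)]; ring

theorem Finv_F (t : ℝ) : Finv (F t) = t := by
  unfold F Finv; rw [add_sub_cancel, Real.log_exp]

theorem Finv_nonneg {t : ℝ} (ht : 0 ≤ t) : 0 ≤ Finv t := Real.log_nonneg (by linarith)

theorem Finv_lt_Finv {u t : ℝ} (hu : -1 < u) (h : u < t) : Finv u < Finv t :=
  Real.log_lt_log (by linarith) (by linarith)

theorem continuousOn_Finv : ContinuousOn Finv (Ioi (-1)) := by
  unfold Finv
  exact ContinuousOn.log (by fun_prop) fun x hx => by
    have : (-1 : ℝ) < x := hx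
    linarith

theorem exists_F_iterate_eq (n : ℕ) {y : ℝ} (hy : 0 ≤ y) : ∃ x, F^[n] x = y := by
  induction n generalizing y with
  | zero => exact ⟨y, rfl⟩
  | succ n ih =>
    obtain ⟨x, hx⟩ := ih (Finv_nonneg hy)
    exact ⟨x, by rw [Function.iterate_succ_apply', hx, F_Finv (by linarith)]⟩

/-- Pulled back to time `0`, the intervals `[x k - c, x k + c]` are nested; a common point is the
potential sought. -/
theorem exists_shadow {x : ℕ → ℝ} {c : ℝ} (hc : 0 ≤ c) (hx : ∀ k, c ≤ x k)
    (h1 : ∀ k, x (k + 1) + c ≤ F (x k + c)) (h2 : ∀ k, F (x k - c) ≤ x (k + 1) - c) :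
    ∃ t, ∀ k, x k - c ≤ F^[k] t ∧ F^[k] t ≤ x k + c := by
  choose l hl using fun k => exists_F_iterate_eq k (sub_nonneg.2 (hx k))
  choose u hu using fun k => exists_F_iterate_eq k (by linarith [hx k] : 0 ≤ x k + c)
  have hlm : Monotone l := monotone_nat_of_le_succ fun k => by
    rw [← (F_iterate_strictMono (k + 1)).le_iff_le, hl, Function.iterate_succ_apply', hl]
    exact h2 k
  have hum : Antitone u := antitone_nat_of_succ_le fun k => by
    rw [← (F_iterate_strictMono (k + 1)).le_iff_le, hu, Function.iterate_succ_apply', hu]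
    exact h1 k
  have hlu : l ≤ u := fun k => by
    rw [← (F_iterate_strictMono k).le_iff_le, hl, hu]; linarith
  have h := mem_iInter.1 (hlm.ciSup_mem_iInter_Icc_of_antitone hum hlu)
  refine ⟨⨆ n, l n, fun k => ⟨?_, ?_⟩⟩
  · rw [← hl k]; exact (F_iterate_strictMono k).monotone (h k).1
  · rw [← hu k]; exact (F_iterate_strictMono k).monotone (h k).2

@[simp] theorem shift_apply (n : ℕ) (s : Address) (k : ℕ) : shift n s k = s (k + n) := rfl

theorem shift_shift (m n : ℕ) (s : Address) : shift m (shift n s) = shift (m + n) s := by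
  funext k; simp [add_assoc]

theorem shift_succ (n : ℕ) (s : Address) : shift (n + 1) s = shift n (shift 1 s) :=
  (shift_shift n 1 s).symm

theorem ExpBounded.shift {s : Address} (hs : ExpBounded s) (n : ℕ) : ExpBounded (shift n s) := by
  obtain ⟨x, hx, h⟩ := hs
  refine ⟨F^[n] x, F_iterate_pos n hx, fun k => ?_⟩
  rw [← Function.iterate_add_apply]
  exact h (k + n)

theorem expBounded_of_shift_one {s : Address} (hs : ExpBounded (CosineFamily.shift 1 s)) :
    ExpBounded s := by
  obtain ⟨x, hx, h⟩ := hs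
  refine ⟨max x |((s 0).1 : ℝ)|, lt_max_of_lt_left hx, fun k => ?_⟩
  cases k with
  | zero => simp
  | succ k =>
    refine (h k).trans ?_
    rw [Function.iterate_succ_apply']
    exact ((F_iterate_strictMono k).monotone (le_max_left _ _)).trans (le_F _)

/-- The potentials over which the minimal potential is the infimum. -/
def potentials (s : Address) : Set ℝ :=
  {t : ℝ | 0 < t ∧ Tendsto (fun k : ℕ => |((s k).1 : ℝ)| / F^[k] t) atTop (𝓝 0)}

theorem bddBelow_potentials (s : Address) : BddBelow (potentials s) := ⟨0, fun _ h => h.1.le⟩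

theorem minPot_nonneg (s : Address) : 0 ≤ minPot s := Real.sInf_nonneg fun _ h => h.1.le

theorem mem_potentials_of_bound {s : Address} {y t : ℝ} (hy : 0 ≤ y) (hyt : y < t)
    (h : ∀ᶠ k in atTop, |((s k).1 : ℝ)| ≤ F^[k] y) : t ∈ potentials s := by
  have ht := hy.trans_lt hyt
  refine ⟨ht, ?_⟩
  refine squeeze_zero' (Eventually.of_forall fun k => div_nonneg (abs_nonneg _)
    (F_iterate_nonneg k ht.le)) ?_ (tendsto_F_iterate_div hy hyt)
  filter_upwards [h] with k hk
  exact div_le_div_of_nonneg_right hk (F_iterate_nonneg k ht.le)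

theorem minPot_le_of_bound {s : Address} {y : ℝ} (hy : 0 ≤ y)
    (h : ∀ᶠ k in atTop, |((s k).1 : ℝ)| ≤ F^[k] y) : minPot s ≤ y :=
  le_of_forall_gt_imp_ge_of_dense fun _ ht =>
    csInf_le (bddBelow_potentials s) (mem_potentials_of_bound hy ht h)

theorem mem_potentials {s : Address} (hs : ExpBounded s) {t : ℝ} (ht : minPot s < t) :
    t ∈ potentials s := by
  have hne : (potentials s).Nonempty := by
    obtain ⟨x, hx, h⟩ := hs
    exact ⟨x + 1, mem_potentials_of_bound hx.le (by linarith) (Eventually.of_forall h)⟩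
  obtain ⟨u, hu, hut⟩ := exists_lt_of_csInf_lt hne ht
  refine ⟨hu.1.trans hut, ?_⟩
  refine squeeze_zero (fun k => div_nonneg (abs_nonneg _) (F_iterate_nonneg k
    (hu.1.trans hut).le)) (fun k => ?_) hu.2
  exact div_le_div_of_nonneg_left (abs_nonneg _) (F_iterate_pos k hu.1)
    ((F_iterate_strictMono k).monotone hut.le)

theorem eventually_abs_le {s : Address} (hs : ExpBounded s) {t : ℝ} (ht : minPot s < t) :
    ∀ᶠ k in atTop, |((s k).1 : ℝ)| ≤ F^[k] t := by
  have h := mem_potentials hs ht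
  filter_upwards [h.2.eventually (gt_mem_nhds one_pos)] with k hk
  rw [div_lt_one (F_iterate_pos k h.1)] at hk
  exact hk.le

/-- One constant serves all larger potentials, which later makes the tail estimates uniform in the
potential. -/
theorem exists_abs_le_mul {s : Address} (hs : ExpBounded s) {t : ℝ} (ht : minPot s < t) :
    ∃ K, 0 ≤ K ∧ ∀ u ≥ t, ∀ k, |((s k).1 : ℝ)| ≤ K * F^[k] u := by
  have h := mem_potentials hs ht
  obtain ⟨K, hK⟩ := h.2.bddAbove_range
  have hK' : ∀ k, |((s k).1 : ℝ)| / F^[k] t ≤ K := fun k => hK ⟨k, rfl⟩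
  have hK0 : 0 ≤ K := le_trans (div_nonneg (abs_nonneg _) (F_iterate_nonneg 0 h.1.le)) (hK' 0)
  refine ⟨K, hK0, fun u hu k => ?_⟩
  have := hK' k
  rw [div_le_iff₀ (F_iterate_pos k h.1)] at this
  exact this.trans (mul_le_mul_of_nonneg_left ((F_iterate_strictMono k).monotone hu) hK0)

theorem minPot_shift_one {s : Address} (hs : ExpBounded s) :
    minPot (shift 1 s) = F (minPot s) := by
  apply le_antisymm
  · have h1 : ∀ t > minPot s, minPot (shift 1 s) ≤ F t := by
      intro t ht
      have h := mem_potentials hs ht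
      refine csInf_le (bddBelow_potentials _) ⟨F_iterate_pos 1 h.1, ?_⟩
      have := (tendsto_add_atTop_iff_nat 1).2 h.2
      simpa [Function.iterate_succ_apply] using this
    have h2 : Tendsto F (𝓝[>] minPot s) (𝓝 (F (minPot s))) :=
      (continuous_F.tendsto _).mono_left nhdsWithin_le_nhds
    exact ge_of_tendsto h2 (eventually_nhdsWithin_of_forall h1)
  · refine le_of_forall_gt_imp_ge_of_dense fun u hu => ?_
    have hu0 : 0 < u := (minPot_nonneg _).trans_lt hu
    have h := mem_potentials (hs.shift 1) hu
    have h3 : Finv u ∈ potentials s := by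
      refine ⟨Real.log_pos (by linarith), ?_⟩
      rw [← tendsto_add_atTop_iff_nat 1]
      refine h.2.congr fun k => ?_
      rw [Function.iterate_succ_apply, F_Finv (by linarith)]
      rfl
    have h4 : minPot s ≤ Finv u := csInf_le (bddBelow_potentials s) h3
    rw [← F_Finv (show -1 < u by linarith)]
    exact F_strictMono.monotone h4

theorem minPot_shift {s : Address} (hs : ExpBounded s) (n : ℕ) :
    minPot (shift n s) = F^[n] (minPot s) := by
  induction n generalizing s with
  | zero => rfl
  | succ n ih => rw [shift_succ, ih (hs.shift 1), minPot_shift_one hs, Function.iterate_succ_apply]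

end

/-! ### Expansion of `E` and contraction of the inverse branches -/

section

/-- A labelling of the strips together with constants for the estimates: `C` bounds the vertical
extent of the strips, `M` compares `‖E z‖` with `exp |Re z|`, and beyond real part `r` the map `E`
is expanding and its values avoid the slit. -/
structure StripData (a b : ℂ) (R : Symb → Set ℂ) where
  ha : a ≠ 0
  hb : b ≠ 0
  labelling : IsStripLabelling a b R
  isOpen : ∀ j, IsOpen (R j)
  injOn : ∀ j, InjOn (E a b) (R j)
  surj : ∀ j w, w ∉ slit a b → ∃ z ∈ R j, E a b z = w
  not_mem : ∀ j, ∀ z ∈ R j, E a b z ∉ slit a b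
  side : ∀ j : Symb, ∀ z ∈ R j, 0 < j.2.sign * (z - critPt a b).re
  C : ℝ
  C_pos : 0 < C
  im_bound : ∀ j : Symb, ∀ z ∈ R j, |z.im - 2 * Real.pi * j.1| ≤ C
  M : ℝ
  M_ge : 7 ≤ M
  norm_le : ∀ z, ‖E a b z‖ ≤ M * Real.exp |z.re|
  r : ℝ
  r_pos : 0 < r
  le_norm : ∀ z : ℂ, r ≤ |z.re| → Real.exp |z.re| ≤ M * ‖E a b z‖
  slit_re : ∀ z ∈ slit a b, |z.re| ≤ r - 1
  norm_v₁ : ‖v₁ a b‖ + 2 ≤ r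
  critPt_re : |(critPt a b).re| < r

theorem norm_E_le (a b z : ℂ) : ‖E a b z‖ ≤ (‖a‖ + ‖b‖) * Real.exp |z.re| := by
  unfold E
  refine (norm_add_le _ _).trans ?_
  rw [norm_mul, norm_mul, Complex.norm_exp, Complex.norm_exp, Complex.neg_re, add_mul]
  gcongr
  · exact le_abs_self _
  · exact neg_le_abs _

/-- The hypothesis makes the dominant exponential term at least twice the other one. -/
theorem le_norm_E {a b : ℂ} (ha : a ≠ 0) (hb : b ≠ 0) {z : ℂ}
    (hz : 2 * max ‖a‖ ‖b‖ ≤ min ‖a‖ ‖b‖ * Real.exp |z.re|) :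
    Real.exp |z.re| ≤ 2 / min ‖a‖ ‖b‖ * ‖E a b z‖ := by
  have hm : 0 < min ‖a‖ ‖b‖ := lt_min (norm_pos_iff.2 ha) (norm_pos_iff.2 hb)
  have he : 1 ≤ Real.exp |z.re| := Real.one_le_exp (abs_nonneg _)
  have h1 : min ‖a‖ ‖b‖ * Real.exp |z.re| - max ‖a‖ ‖b‖ ≤ ‖E a b z‖ := by
    have hA : ‖a * Complex.exp z‖ = ‖a‖ * Real.exp z.re := by rw [norm_mul, Complex.norm_exp]
    have hB : ‖b * Complex.exp (-z)‖ = ‖b‖ * Real.exp (-z.re) := by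
      rw [norm_mul, Complex.norm_exp, Complex.neg_re]
    rcases le_total 0 z.re with h | h
    · rw [abs_of_nonneg h] at *
      have h2 := norm_sub_norm_le (a * Complex.exp z) (-(b * Complex.exp (-z)))
      rw [sub_neg_eq_add, norm_neg, hA, hB] at h2
      have h3 : ‖b‖ * Real.exp (-z.re) ≤ max ‖a‖ ‖b‖ * 1 :=
        mul_le_mul (le_max_right _ _) (Real.exp_le_one_iff.2 (by linarith)) (Real.exp_pos _).le
          (le_max_of_le_left (norm_nonneg _))
      have h4 : min ‖a‖ ‖b‖ * Real.exp z.re ≤ ‖a‖ * Real.exp z.re :=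
        mul_le_mul_of_nonneg_right (min_le_left _ _) (Real.exp_pos _).le
      unfold E
      linarith
    · rw [abs_of_nonpos h] at *
      have h2 := norm_sub_norm_le (b * Complex.exp (-z)) (-(a * Complex.exp z))
      rw [sub_neg_eq_add, norm_neg, hA, hB, add_comm (b * _)] at h2
      have h3 : ‖a‖ * Real.exp z.re ≤ max ‖a‖ ‖b‖ * 1 :=
        mul_le_mul (le_max_left _ _) (Real.exp_le_one_iff.2 (by linarith)) (Real.exp_pos _).le
          (le_max_of_le_left (norm_nonneg _))
      have h4 : min ‖a‖ ‖b‖ * Real.exp (-z.re) ≤ ‖b‖ * Real.exp (-z.re) :=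
        mul_le_mul_of_nonneg_right (min_le_right _ _) (Real.exp_pos _).le
      unfold E
      linarith
  rw [div_mul_eq_mul_div, le_div_iff₀ hm]
  linarith

theorem slit_re_bound {a b : ℂ} (ha : a ≠ 0) (hb : b ≠ 0) {z : ℂ} (hz : z ∈ slit a b) :
    |z.re| ≤ ‖v₁ a b‖ := by
  rcases hz with hz | hz
  · rw [v₂_eq ha hb, segment_eq_image] at hz
    obtain ⟨θ, ⟨h0, h1⟩, rfl⟩ := hz
    refine (Complex.abs_re_le_norm _).trans ?_
    have h2 : (1 - θ) • v₁ a b + θ • (-v₁ a b) = (1 - 2 * θ : ℝ) • v₁ a b := by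
      simp; ring
    simp only [h2, norm_smul]
    refine mul_le_of_le_one_left (norm_nonneg _) ?_
    rw [Real.norm_eq_abs, abs_le]
    constructor <;> linarith
  · rw [hz.1]; exact Complex.abs_re_le_norm _

theorem exists_stripData {a b : ℂ} (ha : a ≠ 0) (hb : b ≠ 0) {R : Symb → Set ℂ}
    (hR : IsStripLabelling a b R) : Nonempty (StripData a b R) := by
  obtain ⟨h1, h2, h3, h4, h5, C, hC, h6⟩ := hR.exists_im_bound ha hb
  have hm : 0 < min ‖a‖ ‖b‖ := lt_min (norm_pos_iff.2 ha) (norm_pos_iff.2 hb)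
  -- The summand `7 > 2π` lets `M` also absorb the factor `2π` in front of the address entries.
  set M := 7 + (‖a‖ + ‖b‖) + 2 / min ‖a‖ ‖b‖ with hM
  have hM1 : 0 ≤ 2 / min ‖a‖ ‖b‖ := by positivity
  have hM2 : 0 ≤ ‖a‖ + ‖b‖ := by positivity
  have hr1 : 0 ≤ 2 * max ‖a‖ ‖b‖ / min ‖a‖ ‖b‖ := by positivity
  refine ⟨⟨ha, hb, hR, h1, h2, h3, h4, h5, C, hC, h6, M, by linarith, fun z =>
    (norm_E_le a b z).trans (mul_le_mul_of_nonneg_right (by linarith) (Real.exp_pos _).le),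
    ‖v₁ a b‖ + 2 + |(critPt a b).re| + 2 * max ‖a‖ ‖b‖ / min ‖a‖ ‖b‖, by positivity,
    fun z hz => ?_, fun z hz => ?_, by linarith [abs_nonneg (critPt a b).re],
    by linarith [norm_nonneg (v₁ a b)]⟩⟩
  · refine (le_norm_E ha hb ?_).trans (mul_le_mul_of_nonneg_right (by linarith) (norm_nonneg _))
    have := Real.add_one_le_exp |z.re|
    have h7 : 2 * max ‖a‖ ‖b‖ / min ‖a‖ ‖b‖ ≤ Real.exp |z.re| := by
      linarith [norm_nonneg (v₁ a b), abs_nonneg (critPt a b).re]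
    rwa [div_le_iff₀ hm, mul_comm _ (min ‖a‖ ‖b‖)] at h7
  · linarith [slit_re_bound ha hb hz, abs_nonneg (critPt a b).re]

namespace StripData

variable {a b : ℂ} {R : Symb → Set ℂ} (D : StripData a b R)
include D

theorem not_mem_slit {z : ℂ} (hz : D.r ≤ |z.re|) : z ∉ slit a b := fun h => by
  linarith [D.slit_re z h]

theorem sign_mul_re {j : Symb} {z : ℂ} (hz : z ∈ R j) (hr : D.r ≤ |z.re|) :
    j.2.sign * z.re = |z.re| := by
  have h1 := D.side j z hz
  have h2 := abs_lt.1 D.critPt_re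
  rw [Complex.sub_re] at h1
  rcases j.2.sign_cases with h | h <;> rw [h] at h1 ⊢
  · have : 0 ≤ z.re := by
      by_contra h3
      rw [abs_of_neg (not_le.1 h3)] at hr; linarith
    rw [abs_of_nonneg this, one_mul]
  · have : z.re ≤ 0 := by
      by_contra h3
      rw [abs_of_pos (not_le.1 h3)] at hr; linarith
    rw [abs_of_nonpos this]; ring

theorem label_unique {i j : Symb} {z : ℂ} (hi : z ∈ R i) (hj : z ∈ R j) : i = j := by
  obtain ⟨k, -, hk⟩ := D.labelling.existsUnique_label z (D.not_mem i z hi)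
  rw [hk i hi, hk j hj]

theorem exists_label {z : ℂ} (hz : E a b z ∉ slit a b) : ∃ j, z ∈ R j :=
  (D.labelling.existsUnique_label z hz).exists

theorem subset_of_isPreconnected {T : Set ℂ} (hT : IsPreconnected T)
    (hsub : ∀ z ∈ T, E a b z ∉ slit a b) {j : Symb} {z : ℂ} (hzT : z ∈ T) (hz : z ∈ R j) :
    T ⊆ R j := by
  obtain ⟨x, hx, h⟩ := D.labelling.component j
  rw [h] at hz ⊢
  rw [connectedComponentIn_eq hz]
  exact hT.subset_connectedComponentIn hzT hsub

theorem mem_of_tendsto {ι : Type*} {l : Filter ι} [NeBot l] {f : ι → ℂ} {z : ℂ} {j : Symb}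
    (hf : Tendsto f l (𝓝 z)) (hj : ∀ᶠ i in l, f i ∈ R j) (hz : E a b z ∉ slit a b) : z ∈ R j := by
  obtain ⟨i, hi⟩ := D.exists_label hz
  have h1 := hf.eventually ((D.isOpen i).mem_nhds hi)
  obtain ⟨x, hx1, hx2⟩ := (h1.and hj).exists
  rwa [← D.label_unique hx1 hx2]

/-- The inverse branch of `E` with values in `R j`. -/
def branch (_ : StripData a b R) (j : Symb) (w : ℂ) : ℂ := Function.invFunOn (E a b) (R j) w

theorem branch_mem (j : Symb) {w : ℂ} (hw : w ∉ slit a b) : D.branch j w ∈ R j :=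
  Function.invFunOn_mem (D.surj j w hw)

theorem E_branch (j : Symb) {w : ℂ} (hw : w ∉ slit a b) : E a b (D.branch j w) = w :=
  Function.invFunOn_eq (D.surj j w hw)

theorem branch_E {j : Symb} {z : ℂ} (hz : z ∈ R j) : D.branch j (E a b z) = z :=
  D.injOn j (D.branch_mem j (D.not_mem j z hz)) hz (D.E_branch j (D.not_mem j z hz))

/-- `|E'|² = |E² - v₁²| ≥ (|v₁| + 2)² - |v₁|² ≥ 4`; this is the purpose of the requirement `‖v₁‖ + 2
≤ r`. -/
theorem two_le_norm_deriv {z : ℂ} (hz : D.r ≤ |(E a b z).re|) :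
    2 ≤ ‖v₁ a b * Complex.sinh (z - critPt a b)‖ := by
  have h1 := congrArg norm (deriv_E_sq D.ha D.hb z)
  rw [norm_pow] at h1
  have h2 := norm_sub_norm_le (E a b z ^ 2) (v₁ a b ^ 2)
  rw [norm_pow, norm_pow] at h2
  have h3 : ‖v₁ a b‖ + 2 ≤ ‖E a b z‖ :=
    D.norm_v₁.trans (hz.trans (Complex.abs_re_le_norm _))
  have h4 := norm_nonneg (v₁ a b)
  have h5 := norm_nonneg (v₁ a b * Complex.sinh (z - critPt a b))
  nlinarith

/-- `E` sends neighbourhoods of the branch value inside the open strip onto neighbourhoods of `w`,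
and injectivity on the strip identifies the branch there. -/
theorem continuousAt_branch (j : Symb) {w : ℂ} (hw : D.r ≤ |w.re|) :
    ContinuousAt (D.branch j) w := by
  have hws := D.not_mem_slit hw
  have hE := D.E_branch j hws
  have hd : v₁ a b * Complex.sinh (D.branch j w - critPt a b) ≠ 0 := by
    rw [← norm_pos_iff]
    linarith [D.two_le_norm_deriv (z := D.branch j w) (by rwa [hE])]
  have hmap := (hasStrictDerivAt_E D.ha D.hb (D.branch j w)).map_nhds_eq hd
  rw [hE] at hmap
  intro U hU
  have h1 : U ∩ R j ∈ 𝓝 (D.branch j w) :=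
    inter_mem hU ((D.isOpen j).mem_nhds (D.branch_mem j hws))
  have h2 : E a b '' (U ∩ R j) ∈ 𝓝 w := by rw [← hmap]; exact image_mem_map h1
  change ∀ᶠ y in 𝓝 w, D.branch j y ∈ U
  filter_upwards [h2] with y hy
  obtain ⟨z, ⟨hzU, hzR⟩, rfl⟩ := hy
  rw [D.branch_E hzR]
  exact hzU

theorem hasDerivAt_branch (j : Symb) {w : ℂ} (hw : D.r ≤ |w.re|) :
    HasDerivAt (D.branch j) (v₁ a b * Complex.sinh (D.branch j w - critPt a b))⁻¹ w := by
  have hE := D.E_branch j (D.not_mem_slit hw)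
  have hd : v₁ a b * Complex.sinh (D.branch j w - critPt a b) ≠ 0 := by
    rw [← norm_pos_iff]
    linarith [D.two_le_norm_deriv (z := D.branch j w) (by rwa [hE])]
  refine HasDerivAt.of_local_left_inverse (D.continuousAt_branch j hw)
    (hasStrictDerivAt_E D.ha D.hb _).hasDerivAt hd ?_
  -- The slit lies in `|Re| ≤ r - 1`; the margin `1` leaves a neighbourhood of `w` on which the
  -- branch inverts `E`.
  have : {y : ℂ | D.r - 1 < |y.re|} ∈ 𝓝 w :=
    (isOpen_lt continuous_const (by fun_prop)).mem_nhds (show D.r - 1 < |w.re| by linarith)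
  filter_upwards [this] with y hy
  refine D.E_branch j fun h => ?_
  have := D.slit_re y h
  have hy' : D.r - 1 < |y.re| := hy
  linarith

/-- Both arguments lie on the same side `d`, so the mean value inequality applies on a convex
half-plane. -/
theorem norm_branch_sub_le (d : Side) (j : Symb) {w w' : ℂ} (hr : D.r ≤ d.sign * w.re)
    (hr' : D.r ≤ d.sign * w'.re) : ‖D.branch j w - D.branch j w'‖ ≤ ‖w - w'‖ / 2 := by
  set H : Set ℂ := {z | D.r ≤ d.sign * z.re} with hH
  have hconv : Convex ℝ H :=
    convex_halfSpace_ge (d.sign • Complex.reLm).isLinear D.r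
  have hHr : ∀ z ∈ H, D.r ≤ |z.re| := by
    intro z hz
    refine le_trans hz ?_
    rcases d.sign_cases with h | h <;> rw [h]
    · rw [one_mul]; exact le_abs_self _
    · rw [neg_one_mul]; exact neg_le_abs _
  have := hconv.norm_image_sub_le_of_norm_hasDerivWithin_le (f := D.branch j) (C := 2⁻¹)
    (fun x hx => (D.hasDerivAt_branch j (hHr x hx)).hasDerivWithinAt) (fun x hx => ?_) hr' hr
  · rw [div_eq_inv_mul]; exact this
  · rw [norm_inv]
    refine inv_anti₀ two_pos (D.two_le_norm_deriv ?_)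
    rw [D.E_branch j (D.not_mem_slit (hHr x hx))]
    exact hHr x hx

theorem norm_sub_le_of_E {i j : Symb} {z z' : ℂ} (hz : z ∈ R j) (hz' : z' ∈ R j)
    (hw : E a b z ∈ R i) (hw' : E a b z' ∈ R i) (hr : D.r ≤ |(E a b z).re|)
    (hr' : D.r ≤ |(E a b z').re|) : ‖z - z'‖ ≤ ‖E a b z - E a b z'‖ / 2 := by
  have := D.norm_branch_sub_le i.2 j (w := E a b z) (w' := E a b z')
    (by rwa [D.sign_mul_re hw hr]) (by rwa [D.sign_mul_re hw' hr'])
  rwa [D.branch_E hz, D.branch_E hz'] at this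

/-- Orbits with external address `s` that stay at large real parts. -/
def Orbit (s : Address) (z : ℂ) : Prop :=
  ∀ k : ℕ, (E a b)^[k] z ∈ R (s k) ∧ D.r ≤ |((E a b)^[k] z).re|

end StripData

end

/-! ### Ray tails as limits of pulled-back model orbits -/

section

theorem exists_exp_ge (α β γ : ℝ) :
    ∃ d ≥ γ, ∀ x ≥ d, α + β * x ≤ Real.exp x := by
  have h1 : Tendsto (fun x : ℝ => Real.exp x / x ^ 2) atTop atTop :=
    Real.tendsto_exp_div_pow_atTop 2
  obtain ⟨d, hd⟩ := ((h1.eventually_ge_atTop (|α| + |β|)).and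
    (eventually_ge_atTop (max 1 γ))).exists_forall_of_atTop
  refine ⟨max d γ, le_max_right _ _, fun x hx => ?_⟩
  obtain ⟨h2, h3⟩ := hd x (le_trans (le_max_left _ _) hx)
  have hx1 : 1 ≤ x := le_trans (le_max_left _ _) h3
  rw [le_div_iff₀ (by positivity)] at h2
  have h4 := le_abs_self α
  have h5 := le_abs_self β
  have h6 : |α| * 1 ≤ |α| * x ^ 2 :=
    mul_le_mul_of_nonneg_left (by nlinarith) (abs_nonneg α)
  have h7 : |β| * x ≤ |β| * x ^ 2 :=
    mul_le_mul_of_nonneg_left (by nlinarith) (abs_nonneg β)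
  have h8 : β * x ≤ |β| * x := mul_le_mul_of_nonneg_right h5 (by linarith)
  linarith

theorem sign_mul_le_abs (d : Side) (x : ℝ) : d.sign * x ≤ |x| := by
  rcases d.sign_cases with h | h <;> rw [h]
  · rw [one_mul]; exact le_abs_self _
  · rw [neg_one_mul]; exact neg_le_abs _

/-- The model orbit `± F^k(t) + 2πi n_k`. -/
def model (s : Address) (t : ℝ) (k : ℕ) : ℂ :=
  ((s k).2.sign * F^[k] t : ℝ) + 2 * Real.pi * Complex.I * ((s k).1 : ℂ)

theorem model_re (s : Address) (t : ℝ) (k : ℕ) :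
    (model s t k).re = (s k).2.sign * F^[k] t := by simp [model]

theorem model_im (s : Address) (t : ℝ) (k : ℕ) :
    (model s t k).im = 2 * Real.pi * (s k).1 := by simp [model]

theorem model_shift (s : Address) (t : ℝ) (n k : ℕ) :
    model (shift n s) (F^[n] t) k = model s t (k + n) := by
  simp [model, Function.iterate_add_apply]

/-- Two model orbits at the same address differ by a real number, namely plus or minus the
difference of the orbits of their potentials. -/
theorem abs_F_iterate_sub_le {s : Address} {t t' : ℝ} {k : ℕ} {z z' : ℂ} {B B' : ℝ}
    (h : ‖z - model s t k‖ ≤ B) (h' : ‖z' - model s t' k‖ ≤ B') :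
    |F^[k] t - F^[k] t'| ≤ B + B' + ‖z - z'‖ := by
  have h1 : |F^[k] t - F^[k] t'| = |(model s t k - model s t' k).re| := by
    rw [Complex.sub_re, model_re, model_re, ← mul_sub, abs_mul]
    rcases (s k).2.sign_cases with h | h <;> rw [h] <;> simp
  rw [h1]
  refine (Complex.abs_re_le_norm _).trans ?_
  have h2 : model s t k - model s t' k = -(z - model s t k) + (z' - model s t' k) + (z - z') := by
    ring
  rw [h2]
  refine (norm_add₃_le).trans ?_
  rw [norm_neg]
  linarith

theorem potential_eq_of_bounded {t t' B : ℝ} (ht : 0 ≤ t) (ht' : 0 ≤ t')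
    (h : ∀ k, |F^[k] t - F^[k] t'| ≤ B) : t = t' := by
  by_contra hne
  wlog hlt : t < t' generalizing t t'
  · exact this ht' ht (fun k => by rw [abs_sub_comm]; exact h k) (Ne.symm hne)
      (lt_of_le_of_ne (not_lt.1 hlt) (Ne.symm hne))
  obtain ⟨k, hk⟩ := ((tendsto_F_iterate_sub ht hlt).eventually_gt_atTop B).exists
  have := (neg_le_abs _).trans (h k)
  linarith

namespace StripData

variable {a b : ℂ} {R : Symb → Set ℂ} (D : StripData a b R)
include D

variable {D} in
theorem Orbit.shift {s : Address} {z : ℂ} (h : D.Orbit s z) (n : ℕ) :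
    D.Orbit (shift n s) ((E a b)^[n] z) := fun k => by
  rw [← Function.iterate_add_apply]; exact h (k + n)

variable {D} in
theorem Orbit.norm_sub_le {s : Address} {z y : ℂ} (hz : D.Orbit s z) (hy : D.Orbit s y) (n : ℕ) :
    ‖z - y‖ ≤ ‖(E a b)^[n] z - (E a b)^[n] y‖ / 2 ^ n := by
  induction n generalizing s z y with
  | zero => simp
  | succ n ih =>
    have h := ih (hz.shift 1) (hy.shift 1)
    have h2 := D.norm_sub_le_of_E (hz 0).1 (hy 0).1 (hz 1).1 (hy 1).1 (hz 1).2 (hy 1).2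
    rw [Function.iterate_succ_apply, Function.iterate_succ_apply]
    simp only [Function.iterate_one, Function.iterate_zero, id] at h h2
    rw [pow_succ, ← div_div]
    linarith

variable {D} in
-- Rigidity: an initial distance would be at least doubled at every step.
theorem Orbit.eq_of_bounded {s : Address} {z y : ℂ} (hz : D.Orbit s z) (hy : D.Orbit s y) {B : ℝ}
    (h : ∀ n, ‖(E a b)^[n] z - (E a b)^[n] y‖ ≤ B) : z = y := by
  have h1 : ∀ n : ℕ, ‖z - y‖ ≤ B * (1 / 2) ^ n := fun n => by
    refine (hz.norm_sub_le hy n).trans ?_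
    rw [one_div, inv_pow, ← div_eq_mul_inv]
    exact div_le_div_of_nonneg_right (h n) (by positivity)
  have h2 : Tendsto (fun n : ℕ => B * (1 / 2 : ℝ) ^ n) atTop (𝓝 (B * 0)) :=
    (tendsto_pow_atTop_nhds_zero_of_lt_one (by norm_num) (by norm_num)).const_mul B
  rw [mul_zero] at h2
  exact sub_eq_zero.1 (norm_le_zero_iff.1 (ge_of_tendsto' h2 h1))

variable {D} in
theorem Orbit.abs_im_sub_le {s : Address} {z y : ℂ} (hz : D.Orbit s z) (hy : D.Orbit s y) (n : ℕ) :
    |((E a b)^[n] z).im - ((E a b)^[n] y).im| ≤ 2 * D.C := by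
  have h1 := D.im_bound _ _ (hz n).1
  have h2 := D.im_bound _ _ (hy n).1
  rw [abs_le] at h1 h2 ⊢
  constructor <;> linarith [h1.1, h1.2, h2.1, h2.2]

theorem M_pos : 0 < D.M := by linarith [D.M_ge]

theorem norm_succ_le (z : ℂ) (n : ℕ) :
    ‖(E a b)^[n + 1] z‖ ≤ D.M * Real.exp |((E a b)^[n] z).re| := by
  rw [Function.iterate_succ_apply']; exact D.norm_le _

theorem exp_le_norm_succ {z : ℂ} {n : ℕ} (h : D.r ≤ |((E a b)^[n] z).re|) :
    Real.exp |((E a b)^[n] z).re| ≤ D.M * ‖(E a b)^[n + 1] z‖ := by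
  rw [Function.iterate_succ_apply']; exact D.le_norm _ h

theorem exists_gap : ∃ d ≥ D.r + 1 + D.C, ∀ x ≥ d,
    4 * D.M ^ 2 + 2 * D.M * (2 * D.C) + 2 * D.M * x ≤ Real.exp x :=
  exists_exp_ge _ _ _

/-- A distance between real parts that grows under iteration. -/
def gap : ℝ := D.exists_gap.choose

theorem r_add_C_le_gap : D.r + 1 + D.C ≤ D.gap := D.exists_gap.choose_spec.1

theorem r_lt_gap : D.r + 1 ≤ D.gap := by linarith [D.r_add_C_le_gap, D.C_pos]

theorem C_le_gap : D.C ≤ D.gap := by linarith [D.r_add_C_le_gap, D.r_pos]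

theorem gap_pos : 0 < D.gap := by linarith [D.r_lt_gap, D.r_pos]

theorem gap_spec {x : ℝ} (hx : D.gap ≤ x) :
    4 * D.M ^ 2 + 2 * D.M * (2 * D.C) + 2 * D.M * x ≤ Real.exp x :=
  D.exists_gap.choose_spec.2 x hx

/-- If the real part of a point exceeds a reference sequence by the gap, and the imaginary parts
of its orbit are controlled by the reference sequence, then this remains true along the orbit. -/
theorem dominate {X : ℕ → ℝ} {y : ℂ} (hX0 : ∀ k, 0 ≤ X k)
    (hX : ∀ k, X (k + 1) ≤ D.M * Real.exp (X k))
    (him : ∀ k, |((E a b)^[k + 1] y).im| ≤ D.M * Real.exp (X k) + 2 * D.C)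
    (h0 : X 0 + D.gap ≤ |y.re|) (k : ℕ) : X k + D.gap ≤ |((E a b)^[k] y).re| := by
  induction k with
  | zero => exact h0
  | succ k ih =>
    have hM := D.M_pos
    have hr := D.r_lt_gap
    have hg := D.gap_spec le_rfl
    have h1 := D.exp_le_norm_succ (z := y) (n := k) (by linarith [hX0 k])
    have h2 := Complex.norm_le_abs_re_add_abs_im ((E a b)^[k + 1] y)
    have h3 := him k
    have h4 := hX k
    set Y := |((E a b)^[k] y).re|
    set Y' := |((E a b)^[k + 1] y).re|
    -- Exceeding `X k` by the gap multiplies the exponential by `exp gap`. By `gap_spec` this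
    -- suffices for the modulus to outweigh the bound on the imaginary part, the next reference
    -- value and the gap together.
    have h5 : Real.exp (X k) * Real.exp D.gap ≤ Real.exp Y := by
      rw [← Real.exp_add]; exact Real.exp_le_exp.2 ih
    have h6 : 1 ≤ Real.exp (X k) := Real.one_le_exp (hX0 k)
    have h7 : Real.exp (X k) * (4 * D.M ^ 2 + 2 * D.M * (2 * D.C) + 2 * D.M * D.gap) ≤
        Real.exp Y := (mul_le_mul_of_nonneg_left hg (Real.exp_pos _).le).trans h5
    have h8 : Real.exp Y ≤ D.M * (Y' + (D.M * Real.exp (X k) + 2 * D.C)) :=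
      h1.trans (mul_le_mul_of_nonneg_left (by linarith) hM.le)
    have hgp : 0 < D.gap := by linarith [D.r_pos]
    have hC := D.C_pos
    have h9 : 4 * D.M * Real.exp (X k) + 2 * (2 * D.C) + 2 * D.gap ≤
        Y' + (D.M * Real.exp (X k) + 2 * D.C) := by
      refine le_of_mul_le_mul_left (le_trans ?_ h8) hM
      refine le_trans ?_ h7
      have : 0 ≤ (Real.exp (X k) - 1) * (2 * D.M * (2 * D.C) + 2 * D.M * D.gap) := by
        apply mul_nonneg <;> [linarith; positivity]
      nlinarith
    have := mul_pos hM (Real.exp_pos (X k))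
    linarith

/-- The loss in real parts under pull-back. -/
def loss : ℝ := Real.log (2 * D.M)

theorem exp_loss : Real.exp D.loss = 2 * D.M := Real.exp_log (by linarith [D.M_ge])

theorem loss_pos : 0 < D.loss := Real.log_pos (by linarith [D.M_ge])

theorem exists_threshold : ∃ d ≥ D.gap + D.loss, ∀ x ≥ d,
    2 * (1 + D.loss) + 0 * x ≤ Real.exp x :=
  exists_exp_ge _ _ _

/-- Beyond this potential, tails of rays are defined. -/
def threshold : ℝ := D.exists_threshold.choose

theorem threshold_ge : D.gap + D.loss ≤ D.threshold := D.exists_threshold.choose_spec.1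

theorem threshold_spec {x : ℝ} (hx : D.threshold ≤ x) : 2 * (1 + D.loss) ≤ Real.exp x := by
  have := D.exists_threshold.choose_spec.2 x hx
  linarith

theorem r_lt_threshold : D.r + D.loss < D.threshold := by
  linarith [D.threshold_ge, D.r_lt_gap]

theorem threshold_pos : 0 < D.threshold := by
  linarith [D.r_lt_threshold, D.r_pos, D.loss_pos]

/-- The approximations to points on tails by pulling back the model orbit. -/
def pullback (s : Address) (t : ℝ) : ℕ → ℕ → ℂ
  | 0, k => model s t k
  | n + 1, k => D.branch (s k) (pullback s t n (k + 1))

theorem threshold_le_iterate {t : ℝ} (ht : D.threshold ≤ t) (k : ℕ) : D.threshold ≤ F^[k] t :=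
  ht.trans (le_F_iterate k t)

/-- The lower bound reproduces itself under pull-back: beyond the threshold `F t - loss ≥ exp t /
2`, and `exp loss = 2M` pays for both factors. -/
theorem abs_re_ge_of_E {t : ℝ} (ht : D.threshold ≤ t) {z : ℂ}
    (h : F t - D.loss ≤ ‖E a b z‖) : t - D.loss ≤ |z.re| := by
  have h1 := D.norm_le z
  have h2 := D.threshold_spec ht
  have h3 : Real.exp t ≤ 2 * D.M * Real.exp |z.re| := by
    unfold F at h; linarith
  rw [← D.exp_loss, ← Real.exp_add, Real.exp_le_exp] at h3
  linarith

theorem sign_mul_re_pullback {s : Address} {t : ℝ} (ht : D.threshold ≤ t) (n k : ℕ) :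
    F^[k] t - D.loss ≤ (s k).2.sign * (D.pullback s t n k).re := by
  induction n generalizing k with
  | zero =>
    rw [pullback, model_re, ← mul_assoc]
    have := D.loss_pos
    rcases (s k).2.sign_cases with h | h <;> rw [h] <;> linarith
  | succ n ih =>
    have h1 := ih (k + 1)
    have h2 := D.threshold_le_iterate ht (k + 1)
    have h3 : F^[k + 1] t - D.loss ≤ |(D.pullback s t n (k + 1)).re| := by
      refine h1.trans ?_
      rcases (s (k + 1)).2.sign_cases with h | h <;> rw [h]
      · rw [one_mul]; exact le_abs_self _
      · rw [neg_one_mul]; exact neg_le_abs _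
    have h4 := D.r_lt_threshold
    have h5 := D.not_mem_slit (z := D.pullback s t n (k + 1)) (by linarith)
    have h6 := D.branch_mem (s k) h5
    have h7 := D.E_branch (s k) h5
    have h8 := D.abs_re_ge_of_E (D.threshold_le_iterate ht k)
      (z := D.branch (s k) (D.pullback s t n (k + 1))) (by
        rw [h7, ← Function.iterate_succ_apply' F]
        exact h3.trans (Complex.abs_re_le_norm _))
    rw [pullback, D.sign_mul_re h6 (by linarith [D.threshold_le_iterate ht k])]
    exact h8

theorem r_le_pullback {s : Address} {t : ℝ} (ht : D.threshold ≤ t) (n k : ℕ) :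
    D.r ≤ (s k).2.sign * (D.pullback s t n k).re := by
  linarith [D.sign_mul_re_pullback (s := s) ht n k, D.threshold_le_iterate ht k, D.r_lt_threshold]

/-- The distance of the points on a tail from the model orbit, if the entries of the address are
at most `K` times the model orbit. -/
def tailBound (K : ℝ) : ℝ := D.loss + Real.log (D.M * (1 + 7 * K)) + D.C

/-- The model point at time `k + 1` has modulus comparable to `exp (F^[k] t)`, so its pull-back has
real part `±F^[k] t` up to a constant and lies in the right strip. Only the upper bound for the
modulus uses the growth of the address. -/
theorem norm_pullback_one_sub_le {s : Address} {t K : ℝ} (ht : D.threshold ≤ t) (hK0 : 0 ≤ K)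
    (hK : ∀ k, |((s k).1 : ℝ)| ≤ K * F^[k] t) (k : ℕ) :
    ‖D.pullback s t 1 k - model s t k‖ ≤ D.tailBound K := by
  have hM := D.M_pos
  have h0 := D.r_le_pullback (s := s) ht 0 (k + 1)
  have h5 := D.not_mem_slit (z := model s t (k + 1)) (h0.trans (sign_mul_le_abs _ _))
  have h6 := D.branch_mem (s k) h5
  have h7 := D.E_branch (s k) h5
  have h8 := D.sign_mul_re_pullback (s := s) ht 1 k
  have h9 := D.r_le_pullback (s := s) ht 1 k
  rw [pullback, pullback] at h8 h9 ⊢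
  set z := D.branch (s k) (model s t (k + 1))
  have h10 : D.r ≤ |z.re| := h9.trans (sign_mul_le_abs _ _)
  have hsgn := D.sign_mul_re h6 h10
  have hpi := Real.pi_lt_d2
  have hF : 0 ≤ F^[k + 1] t := F_iterate_nonneg _ (D.threshold_pos.le.trans ht)
  have h11 : ‖model s t (k + 1)‖ ≤ (1 + 7 * K) * Real.exp (F^[k] t) := by
    refine (Complex.norm_le_abs_re_add_abs_im _).trans ?_
    rw [model_re, model_im, abs_mul, abs_mul, abs_of_nonneg hF,
      abs_of_pos (by positivity : 0 < 2 * Real.pi)]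
    have h12 : |(s (k + 1)).2.sign| = 1 := by
      rcases (s (k + 1)).2.sign_cases with h | h <;> rw [h] <;> simp
    have h13 := hK (k + 1)
    have h14 : F^[k + 1] t ≤ Real.exp (F^[k] t) := by
      rw [Function.iterate_succ_apply']; unfold F; linarith
    have h15 : 2 * Real.pi * |((s (k + 1)).1 : ℝ)| ≤ 7 * |((s (k + 1)).1 : ℝ)| :=
      mul_le_mul_of_nonneg_right (by linarith) (abs_nonneg _)
    rw [h12, one_mul]
    have h16 := mul_le_mul_of_nonneg_left h14 (by linarith : 0 ≤ 1 + 7 * K)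
    linarith
  have h17 : |z.re| ≤ F^[k] t + Real.log (D.M * (1 + 7 * K)) := by
    have h18 := D.le_norm z h10
    rw [h7] at h18
    have h19 : Real.exp |z.re| ≤ D.M * (1 + 7 * K) * Real.exp (F^[k] t) := by
      refine h18.trans ?_
      rw [mul_assoc]; exact mul_le_mul_of_nonneg_left h11 hM.le
    have h20 : 0 < D.M * (1 + 7 * K) := by positivity
    rw [← Real.exp_log h20, ← Real.exp_add, Real.exp_le_exp] at h19
    linarith
  have hlog : 0 ≤ Real.log (D.M * (1 + 7 * K)) := by
    apply Real.log_nonneg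
    nlinarith [D.M_ge]
  refine (Complex.norm_le_abs_re_add_abs_im _).trans ?_
  rw [Complex.sub_re, Complex.sub_im, model_re, model_im, tailBound]
  have h21 : |z.re - (s k).2.sign * F^[k] t| ≤ D.loss + Real.log (D.M * (1 + 7 * K)) := by
    have hl := D.loss_pos
    rw [hsgn] at h8
    rcases (s k).2.sign_cases with h | h <;> rw [h] at hsgn ⊢ <;> rw [abs_le] <;>
      constructor <;> linarith
  linarith [D.im_bound _ _ h6]

/-- The error of a single pull-back is bounded, and `n` further contractions act on it. -/
theorem norm_pullback_succ_sub_le {s : Address} {t K : ℝ} (ht : D.threshold ≤ t) (hK0 : 0 ≤ K)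
    (hK : ∀ k, |((s k).1 : ℝ)| ≤ K * F^[k] t) (n k : ℕ) :
    ‖D.pullback s t (n + 1) k - D.pullback s t n k‖ ≤ D.tailBound K / 2 ^ n := by
  induction n generalizing k with
  | zero =>
    rw [pow_zero, div_one]; exact D.norm_pullback_one_sub_le ht hK0 hK k
  | succ n ih =>
    have h := D.norm_branch_sub_le (s (k + 1)).2 (s k) (D.r_le_pullback (s := s) ht (n + 1) (k + 1))
      (D.r_le_pullback (s := s) ht n (k + 1))
    have h2 := ih (k + 1)
    change ‖D.branch (s k) (D.pullback s t (n + 1) (k + 1)) -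
      D.branch (s k) (D.pullback s t n (k + 1))‖ ≤ _
    rw [pow_succ, ← div_div]
    linarith

theorem exists_tail_point {s : Address} {t K : ℝ} (ht : D.threshold ≤ t) (hK0 : 0 ≤ K)
    (hK : ∀ k, |((s k).1 : ℝ)| ≤ K * F^[k] t) :
    ∃ z, D.Orbit s z ∧ (∀ k, F^[k] t - D.loss ≤ |((E a b)^[k] z).re|) ∧
      ∀ k, ‖(E a b)^[k] z - model s t k‖ ≤ 2 * D.tailBound K := by
  have hdist : ∀ k n, dist (D.pullback s t n k) (D.pullback s t (n + 1) k) ≤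
      2 * D.tailBound K / 2 / 2 ^ n := by
    intro k n
    rw [dist_comm, dist_eq_norm, mul_div_cancel_left₀ _ two_ne_zero]
    exact D.norm_pullback_succ_sub_le ht hK0 hK n k
  have hlim : ∀ k, ∃ Z, Tendsto (fun n => D.pullback s t n k) atTop (𝓝 Z) := fun k =>
    cauchySeq_tendsto_of_complete (cauchySeq_of_le_geometric_two (hdist k))
  choose Z hZ using hlim
  have hZre : ∀ k, F^[k] t - D.loss ≤ (s k).2.sign * (Z k).re := fun k =>
    ge_of_tendsto (((Complex.continuous_re.tendsto _).comp (hZ k)).const_mul _)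
      (Eventually.of_forall fun n => D.sign_mul_re_pullback ht n k)
  have hZabs : ∀ k, F^[k] t - D.loss ≤ |(Z k).re| := fun k =>
    (hZre k).trans (sign_mul_le_abs _ _)
  have hZr : ∀ k, D.r ≤ |(Z k).re| := fun k => by
    linarith [hZabs k, D.threshold_le_iterate ht k, D.r_lt_threshold]
  have hstep : ∀ k, Z k = D.branch (s k) (Z (k + 1)) := fun k => by
    refine tendsto_nhds_unique ((tendsto_add_atTop_iff_nat 1).2 (hZ k)) ?_
    exact (D.continuousAt_branch (s k) (hZr (k + 1))).tendsto.comp (hZ (k + 1))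
  have hE : ∀ k, (E a b)^[k] (Z 0) = Z k := by
    intro k
    induction k with
    | zero => rfl
    | succ k ih =>
      rw [Function.iterate_succ_apply', ih, hstep k]
      exact D.E_branch _ (D.not_mem_slit (hZr _))
  refine ⟨Z 0, fun k => ⟨?_, ?_⟩, fun k => ?_, fun k => ?_⟩
  · rw [hE, hstep]; exact D.branch_mem _ (D.not_mem_slit (hZr _))
  · rw [hE]; exact hZr k
  · rw [hE]; exact hZabs k
  · rw [hE, ← dist_eq_norm, dist_comm]
    exact dist_le_of_le_geometric_two_of_tendsto₀ (hdist k) (hZ k)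

open Classical in
/-- The tails of the rays. -/
def tail (s : Address) (t : ℝ) : ℂ :=
  if h : ∃ z, D.Orbit s z ∧ (∀ k, F^[k] t - D.loss ≤ |((E a b)^[k] z).re|) ∧
      ∃ B, ∀ k, ‖(E a b)^[k] z - model s t k‖ ≤ B then h.choose else 0

theorem tail_spec {s : Address} (hs : ExpBounded s) {t : ℝ} (ht : D.threshold ≤ t)
    (hst : minPot s < t) : D.Orbit s (D.tail s t) ∧
      (∀ k, F^[k] t - D.loss ≤ |((E a b)^[k] (D.tail s t)).re|) ∧
      ∃ B, ∀ k, ‖(E a b)^[k] (D.tail s t) - model s t k‖ ≤ B := by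
  obtain ⟨K, hK0, hK⟩ := exists_abs_le_mul hs hst
  obtain ⟨z, hz1, hz2, hz3⟩ := D.exists_tail_point ht hK0 (hK t le_rfl)
  have h : ∃ z, D.Orbit s z ∧ (∀ k, F^[k] t - D.loss ≤ |((E a b)^[k] z).re|) ∧
      ∃ B, ∀ k, ‖(E a b)^[k] z - model s t k‖ ≤ B := ⟨z, hz1, hz2, _, hz3⟩
  rw [tail, dif_pos h]
  exact h.choose_spec

/-- By rigidity the orbit near a model orbit is unique, so the choice made in `tail` does not
matter. -/
theorem eq_of_model {s : Address} {t B B' : ℝ} {z y : ℂ} (hz : D.Orbit s z) (hy : D.Orbit s y)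
    (hzB : ∀ k, ‖(E a b)^[k] z - model s t k‖ ≤ B)
    (hyB : ∀ k, ‖(E a b)^[k] y - model s t k‖ ≤ B') : z = y :=
  hz.eq_of_bounded hy (B := B + B') fun k => by
    have := norm_sub_le_norm_sub_add_norm_sub ((E a b)^[k] z) (model s t k) ((E a b)^[k] y)
    rw [norm_sub_rev (model s t k)] at this
    linarith [hzB k, hyB k]

theorem tail_uniform {s : Address} (hs : ExpBounded s) {t₀ : ℝ} (ht : D.threshold ≤ t₀)
    (hst : minPot s < t₀) :
    ∃ B, ∀ t ≥ t₀, ∀ k, ‖(E a b)^[k] (D.tail s t) - model s t k‖ ≤ B := by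
  obtain ⟨K, hK0, hK⟩ := exists_abs_le_mul hs hst
  refine ⟨2 * D.tailBound K, fun t ht' => ?_⟩
  obtain ⟨z, hz1, -, hz3⟩ := D.exists_tail_point (ht.trans ht') hK0 (hK t ht')
  obtain ⟨h1, -, B, h3⟩ := D.tail_spec hs (ht.trans ht') (hst.trans_le ht')
  rw [D.eq_of_model h1 hz1 h3 hz3]
  exact hz3

theorem E_iterate_tail {s : Address} (hs : ExpBounded s) {t : ℝ} (ht : D.threshold ≤ t)
    (hst : minPot s < t) (n : ℕ) :
    (E a b)^[n] (D.tail s t) = D.tail (shift n s) (F^[n] t) := by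
  obtain ⟨h1, -, B, h3⟩ := D.tail_spec hs ht hst
  obtain ⟨h1', -, B', h3'⟩ := D.tail_spec (hs.shift n) (D.threshold_le_iterate ht n)
    (t := F^[n] t) (by rw [minPot_shift hs]; exact F_iterate_strictMono n hst)
  refine D.eq_of_model (B := B) (h1.shift n) h1' (fun k => ?_) h3'
  rw [model_shift, ← Function.iterate_add_apply]
  exact h3 _

theorem tail_injective {s s' : Address} (hs : ExpBounded s) (hs' : ExpBounded s') {t t' : ℝ}
    (ht : D.threshold ≤ t) (ht' : D.threshold ≤ t') (hst : minPot s < t) (hst' : minPot s' < t')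
    (h : D.tail s t = D.tail s' t') : s = s' ∧ t = t' := by
  obtain ⟨h1, -, B, h3⟩ := D.tail_spec hs ht hst
  obtain ⟨h1', -, B', h3'⟩ := D.tail_spec hs' ht' hst'
  have hss : s = s' := funext fun k => D.label_unique (h1 k).1 (by rw [h]; exact (h1' k).1)
  subst hss
  refine ⟨rfl, potential_eq_of_bounded (B := B + B') (D.threshold_pos.le.trans ht)
    (D.threshold_pos.le.trans ht') fun k => ?_⟩
  have := abs_F_iterate_sub_le (h3 k) (h3' k)
  rw [h, sub_self, norm_zero, add_zero] at this
  exact this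

theorem continuousOn_tail {s : Address} (hs : ExpBounded s) {t₀ : ℝ} (ht : D.threshold ≤ t₀)
    (hst : minPot s < t₀) : ContinuousOn (D.tail s) (Ici t₀) := by
  obtain ⟨B, hB⟩ := D.tail_uniform hs ht hst
  have hF : ∀ n, Continuous F^[n] := fun n => continuous_F.iterate n
  have key : ∀ t ≥ t₀, ∀ u ≥ t₀, ∀ n,
      ‖D.tail s u - D.tail s t‖ ≤ (2 * B + |F^[n] u - F^[n] t|) * (1 / 2) ^ n := by
    intro t ht' u hu n
    have h1 := (D.tail_spec hs (ht.trans ht') (hst.trans_le ht')).1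
    have h2 := (D.tail_spec hs (ht.trans hu) (hst.trans_le hu)).1
    refine (h2.norm_sub_le h1 n).trans ?_
    rw [one_div, inv_pow, ← div_eq_mul_inv]
    refine div_le_div_of_nonneg_right ?_ (by positivity)
    have h3 : (E a b)^[n] (D.tail s u) - (E a b)^[n] (D.tail s t) =
      ((E a b)^[n] (D.tail s u) - model s u n) - ((E a b)^[n] (D.tail s t) - model s t n) +
      (model s u n - model s t n) := by ring
    have h4 : ‖model s u n - model s t n‖ = |F^[n] u - F^[n] t| := by
      have : model s u n - model s t n = ((s n).2.sign * (F^[n] u - F^[n] t) : ℝ) := by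
        simp [model]; ring
      rw [this, Complex.norm_real, Real.norm_eq_abs, abs_mul]
      rcases (s n).2.sign_cases with h | h <;> rw [h] <;> simp
    rw [h3]
    refine (norm_add_le _ _).trans ?_
    have := norm_sub_le ((E a b)^[n] (D.tail s u) - model s u n)
      ((E a b)^[n] (D.tail s t) - model s t n)
    rw [h4]
    linarith [hB u hu n, hB t ht' n]
  intro t ht'
  rw [ContinuousWithinAt, Metric.tendsto_nhds]
  intro ε hε
  have h1 : Tendsto (fun n : ℕ => (2 * B + 1) * (1 / 2 : ℝ) ^ n) atTop (𝓝 ((2 * B + 1) * 0)) :=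
    (tendsto_pow_atTop_nhds_zero_of_lt_one (by norm_num) (by norm_num)).const_mul _
  rw [mul_zero] at h1
  -- First `n` makes the contraction factor small; then `u` is taken so close to `t` that `F^[n]`
  -- moves by less than `1`.
  obtain ⟨n, hn⟩ := (h1.eventually (gt_mem_nhds hε)).exists
  have h2 : ∀ᶠ u in 𝓝[Ici t₀] t, |F^[n] u - F^[n] t| < 1 := by
    have := ((hF n).tendsto t).mono_left (nhdsWithin_le_nhds (s := Ici t₀))
    simpa [Real.dist_eq] using Metric.tendsto_nhds.1 this 1 one_pos
  filter_upwards [h2, self_mem_nhdsWithin] with u hu1 hu2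
  rw [dist_eq_norm]
  refine (key t ht' u hu2 n).trans_lt (lt_of_le_of_lt ?_ hn)
  exact mul_le_mul_of_nonneg_right (by linarith) (by positivity)

theorem isEscaping_tail {s : Address} (hs : ExpBounded s) {t : ℝ} (ht : D.threshold ≤ t)
    (hst : minPot s < t) : IsEscaping a b (D.tail s t) := by
  obtain ⟨-, h2, -⟩ := D.tail_spec hs ht hst
  refine tendsto_atTop_mono (fun k => (h2 k).trans (Complex.abs_re_le_norm _)) ?_
  exact tendsto_atTop_add_const_right _ (-D.loss)
    (tendsto_F_iterate (D.threshold_pos.trans_le ht))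

theorem isRayTail_tail {s : Address} (hs : ExpBounded s) {T : ℝ} (hT : D.threshold ≤ T)
    (hsT : minPot s < T) : IsRayTail a b R s T (D.tail s) where
  pos := D.threshold_pos.trans_le hT
  continuousOn := D.continuousOn_tail hs hT hsT
  injOn := fun t ht t' ht' h => (D.tail_injective hs hs (hT.trans ht) (hT.trans ht')
    (hsT.trans_le ht) (hsT.trans_le ht') h).2
  escaping := fun t ht => D.isEscaping_tail hs (hT.trans ht) (hsT.trans_le ht)
  address := fun t ht k =>
    have h := (D.tail_spec hs (hT.trans ht) (hsT.trans_le ht)).1 k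
    ⟨D.not_mem_slit h.2, h.1⟩
  re_tendsto := by
    have key : ∀ t ≥ T, t - D.loss ≤ (s 0).2.sign * (D.tail s t).re := fun t ht => by
      obtain ⟨h1, h2, -⟩ := D.tail_spec hs (hT.trans ht) (hsT.trans_le ht)
      have h3 := D.sign_mul_re (h1 0).1 (h1 0).2
      rw [Function.iterate_zero, id] at h3
      rw [h3]; exact h2 0
    have h1 : Tendsto (fun t => t - D.loss) atTop atTop :=
      tendsto_atTop_add_const_right _ (-D.loss) tendsto_id
    have h2 : Tendsto (fun t => (s 0).2.sign * (D.tail s t).re) atTop atTop :=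
      tendsto_atTop_mono' _ ((eventually_ge_atTop T).mono key) h1
    rcases (s 0).2.sign_cases with h | h <;> rw [h] at h2
    · left; simpa using h2
    · right
      have := tendsto_neg_atTop_atBot.comp h2
      simpa [Function.comp_def] using this
  asymptotics := fun t ht => (D.tail_spec hs (hT.trans ht) (hsT.trans_le ht)).2.2

end StripData

end

/-! ### Lifting curves through `E` -/

section

theorem isSimplyConnected_Ioi (τ : ℝ) : IsSimplyConnected (Ioi τ) := by
  have := (convex_Ioi τ).contractibleSpace nonempty_Ioi
  exact SimplyConnectedSpace.ofContractible _

theorem exists_continuous_log {τ : ℝ} {f : ℝ → ℂ} (hf : ContinuousOn f (Ioi τ))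
    (h0 : ∀ u > τ, f u ≠ 0) :
    ∃ l : ℝ → ℂ, ContinuousOn l (Ioi τ) ∧ ∀ u > τ, Complex.exp (l u) = f u := by
  obtain ⟨l, h1, h2⟩ := Complex.exists_continuousOn_eqOn_exp_comp (isSimplyConnected_Ioi τ)
    isOpen_Ioi hf (by rintro ⟨u, hu, h⟩; exact h0 u hu h)
  exact ⟨l, h1, fun u hu => h2 hu⟩

/-- Curves which avoid the critical values lift under `E`. -/
theorem exists_lift {a b : ℂ} (ha : a ≠ 0) (hb : b ≠ 0) {τ : ℝ} {γ : ℝ → ℂ}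
    (hγ : ContinuousOn γ (Ioi τ)) (hv : ∀ u > τ, γ u ≠ v₁ a b ∧ γ u ≠ v₂ a b) {t₀ : ℝ}
    (ht₀ : τ < t₀) {z₀ : ℂ} (hz₀ : E a b z₀ = γ t₀) :
    ∃ δ : ℝ → ℂ, ContinuousOn δ (Ioi τ) ∧ (∀ u > τ, E a b (δ u) = γ u) ∧ δ t₀ = z₀ := by
  have hv0 := v₁_ne_zero ha hb
  set W : ℝ → ℂ := fun u => γ u / v₁ a b with hW
  have hWc : ContinuousOn W (Ioi τ) := hγ.div_const _
  have hW1 : ∀ u > τ, W u ^ 2 - 1 ≠ 0 := by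
    intro u hu h
    have h1 : (γ u - v₁ a b) * (γ u - v₂ a b) = 0 := by
      have h2 : γ u ^ 2 - v₁ a b ^ 2 = v₁ a b ^ 2 * (W u ^ 2 - 1) := by
        simp only [hW]; field_simp
      rw [v₂_eq ha hb]; linear_combination h2 + v₁ a b ^ 2 * h
    rcases mul_eq_zero.1 h1 with h1 | h1
    · exact (hv u hu).1 (sub_eq_zero.1 h1)
    · exact (hv u hu).2 (sub_eq_zero.1 h1)
  -- Explicit inversion of `cosh`. Since `W ≠ ±1`, the function `W² - 1` has a continuous square
  -- root `q`; then `(W + q)(W - q) = 1`, and a continuous logarithm `μ` of `W + q` satisfies `cosh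
  -- μ = W`.
  obtain ⟨l, hl, hl'⟩ := exists_continuous_log (f := fun u => W u ^ 2 - 1) (by fun_prop) hW1
  set q : ℝ → ℂ := fun u => Complex.exp (l u / 2) with hq
  have hq2 : ∀ u > τ, q u ^ 2 = W u ^ 2 - 1 := by
    intro u hu
    simp only [hq]
    rw [← hl' u hu, ← Complex.exp_nat_mul]
    push_cast
    rw [mul_div_cancel₀ _ two_ne_zero]
  have hprod : ∀ u > τ, (W u + q u) * (W u - q u) = 1 := fun u hu => by
    linear_combination -hq2 u hu
  have hqc : ContinuousOn q (Ioi τ) := Complex.continuous_exp.comp_continuousOn (hl.div_const 2)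
  obtain ⟨μ, hμ, hμ'⟩ := exists_continuous_log (f := fun u => W u + q u) (by fun_prop)
    (fun u hu h => by have := hprod u hu; rw [h] at this; simp at this)
  have hcosh : ∀ u > τ, Complex.cosh (μ u) = W u := by
    intro u hu
    have h1 := hprod u hu
    have h2 : Complex.exp (-μ u) = W u - q u := by
      rw [Complex.exp_neg, hμ' u hu]
      exact inv_eq_of_mul_eq_one_right h1
    rw [Complex.cosh, h2, hμ' u hu]; ring
  have hWγ : ∀ u, v₁ a b * W u = γ u := fun u => by simp only [hW]; field_simp
  have hz : Complex.cosh (μ t₀) = Complex.cosh (z₀ - critPt a b) := by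
    rw [hcosh _ ht₀]
    apply mul_left_cancel₀ hv0
    rw [hWγ, ← hz₀, E_eq ha hb]
  have hE : ∀ (w : ℂ) (k : ℤ), Complex.cosh (w + 2 * Real.pi * k * Complex.I) =
      Complex.cosh w := by
    intro w k
    rw [← Complex.cos_mul_I, ← Complex.cos_mul_I, Complex.cos_eq_cos_iff]
    refine ⟨k, Or.inl ?_⟩
    linear_combination (-2 * Real.pi * k : ℂ) * Complex.I_mul_I
  obtain ⟨k, hk | hk⟩ := cosh_eq_cosh_iff hz
  · refine ⟨fun u => critPt a b + (μ u + 2 * Real.pi * k * Complex.I), by fun_prop,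
      fun u hu => ?_, ?_⟩
    · rw [E_eq ha hb, add_sub_cancel_left, hE, hcosh u hu, hWγ]
    · simp only; rw [← hk]; ring
  · refine ⟨fun u => critPt a b + (-μ u + 2 * Real.pi * k * Complex.I), by fun_prop,
      fun u hu => ?_, ?_⟩
    · rw [E_eq ha hb, add_sub_cancel_left, hE, Complex.cosh_neg, hcosh u hu, hWγ]
    · simp only; rw [← hk]; ring

theorem exists_open_injOn {a b : ℂ} (ha : a ≠ 0) (hb : b ≠ 0) {z : ℂ}
    (h1 : E a b z ≠ v₁ a b) (h2 : E a b z ≠ v₂ a b) :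
    ∃ U, IsOpen U ∧ z ∈ U ∧ InjOn (E a b) U := by
  have h := (hasStrictDerivAt_E ha hb z).eventually_left_inverse (deriv_E_ne_zero ha hb h1 h2)
  obtain ⟨U, hU, hUo, hz⟩ := eventually_nhds_iff.1 h
  refine ⟨U, hUo, hz, fun x hx y hy hxy => ?_⟩
  rw [← hU x hx, ← hU y hy, hxy]

/-- Away from the critical values `E` is locally injective, so lifts that agree at one point of a
connected set agree everywhere on it. -/
theorem lift_unique {a b : ℂ} (ha : a ≠ 0) (hb : b ≠ 0) {S : Set ℝ} (hS : IsPreconnected S)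
    {δ δ' : ℝ → ℂ} (hδ : ContinuousOn δ S) (hδ' : ContinuousOn δ' S)
    (hE : ∀ u ∈ S, E a b (δ u) = E a b (δ' u))
    (hv : ∀ u ∈ S, E a b (δ u) ≠ v₁ a b ∧ E a b (δ u) ≠ v₂ a b) {u₀ : ℝ} (hu₀ : u₀ ∈ S)
    (h : δ u₀ = δ' u₀) : EqOn δ δ' S := by
  have := isPreconnected_iff_preconnectedSpace.1 hS
  set X := {z : ℂ // E a b z ≠ v₁ a b ∧ E a b z ≠ v₂ a b}
  set p : X → ℂ := fun z => E a b z.1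
  have hinj : IsLocallyInjective p := by
    rintro ⟨z, h1, h2⟩
    obtain ⟨U, hU, hz, hinj⟩ := exists_open_injOn ha hb h1 h2
    exact ⟨Subtype.val ⁻¹' U, hU.preimage continuous_subtype_val, hz,
      fun x hx y hy hxy => Subtype.ext (hinj hx hy hxy)⟩
  set g₁ : S → X := fun u => ⟨δ u, hv u u.2⟩
  set g₂ : S → X := fun u => ⟨δ' u, by rw [← hE u u.2]; exact hv u u.2⟩
  have h1 : Continuous g₁ :=
    (continuousOn_iff_continuous_domRestrict.1 hδ).subtype_mk _
  have h2 : Continuous g₂ :=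
    (continuousOn_iff_continuous_domRestrict.1 hδ').subtype_mk _
  have h3 := (T2Space.isSeparatedMap p).eq_of_comp_eq hinj h1 h2
    (funext fun u => hE u u.2) ⟨u₀, hu₀⟩ (Subtype.ext h)
  intro u hu
  exact congrArg Subtype.val (congrFun h3 ⟨u, hu⟩)

theorem IsEscaping.of_iterate {a b z : ℂ} {n : ℕ} (h : IsEscaping a b ((E a b)^[n] z)) :
    IsEscaping a b z := by
  unfold IsEscaping at *
  rw [← tendsto_add_atTop_iff_nat n]
  simpa [Function.iterate_add_apply] using h

theorem IsEscaping.iterate {a b z : ℂ} (h : IsEscaping a b z) (n : ℕ) :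
    IsEscaping a b ((E a b)^[n] z) := by
  unfold IsEscaping at *
  rw [← tendsto_add_atTop_iff_nat n] at h
  simpa [Function.iterate_add_apply] using h

end

/-! ### Extending tails to smaller potentials -/

section

theorem Finv_gt {t : ℝ} (ht : 0 ≤ t) {u : ℝ} (hu : F t < u) : t < Finv u := by
  rw [← Finv_F t]
  exact Finv_lt_Finv (by linarith [le_F t]) hu

theorem continuousOn_comp_F {t : ℝ} {γ' : ℝ → ℂ} (h : ContinuousOn γ' (Ioi (F t))) :
    ContinuousOn (fun u => γ' (F u)) (Ioi t) :=
  h.comp continuous_F.continuousOn fun _ hu => F_strictMono hu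

/-- Prepending a symbol to an address. -/
def prepend (j : Symb) (s : Address) : Address
  | 0 => j
  | k + 1 => s k

theorem shift_prepend (j : Symb) (s : Address) :
    shift 1 (prepend j s) = s := rfl

theorem expBounded_prepend {s : Address} (j : Symb) (hs : ExpBounded s) :
    ExpBounded (prepend j s) := expBounded_of_shift_one hs

namespace StripData

variable {a b : ℂ} {R : Symb → Set ℂ} (D : StripData a b R)
include D

theorem ne_critical {z : ℂ} (hz : D.r ≤ |z.re|) : z ≠ v₁ a b ∧ z ≠ v₂ a b := by
  have h1 := D.norm_v₁
  have h2 := hz.trans (Complex.abs_re_le_norm z)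
  constructor
  · rintro rfl; linarith
  · rintro rfl; rw [v₂_eq D.ha D.hb, norm_neg] at h2; linarith

/-- `γ` extends the tail at `s` to potentials greater than `t`, compatibly with the dynamics, and
no image of `γ` meets a critical value. -/
structure IsCurve (s : Address) (t : ℝ) (γ : ℝ → ℂ) : Prop where
  cont : ContinuousOn γ (Ioi t)
  noncrit : ∀ u > t, ∀ n : ℕ, (E a b)^[n + 1] (γ u) ≠ v₁ a b ∧ (E a b)^[n + 1] (γ u) ≠ v₂ a b
  tail : ∀ u > t, ∀ n : ℕ, D.threshold ≤ F^[n] u →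
    (E a b)^[n] (γ u) = D.tail (shift n s) (F^[n] u)

variable {D} {s : Address} {t t' : ℝ} {γ γ' : ℝ → ℂ}

theorem IsCurve.mono (h : D.IsCurve s t γ) (htt : t ≤ t') : D.IsCurve s t' γ where
  cont := h.cont.mono (Ioi_subset_Ioi htt)
  noncrit := fun u hu => h.noncrit u (htt.trans_lt hu)
  tail := fun u hu => h.tail u (htt.trans_lt hu)

theorem IsCurve.eq_tail (h : D.IsCurve s t γ) {u : ℝ} (hu : t < u) (hT : D.threshold ≤ u) :
    γ u = D.tail s u := h.tail u hu 0 hT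

theorem IsCurve.congr (h : D.IsCurve s t γ) (heq : EqOn γ' γ (Ioi t)) : D.IsCurve s t γ' where
  cont := h.cont.congr heq
  noncrit := fun u hu => by rw [heq hu]; exact h.noncrit u hu
  tail := fun u hu => by rw [heq hu]; exact h.tail u hu

variable (D) in
theorem isCurve_tail (hs : ExpBounded s) (hT : D.threshold ≤ t) (ht : minPot s ≤ t) :
    D.IsCurve s t (D.tail s) where
  cont := fun u hu => by
    have hu' : t < u := hu
    have h1 : t < (t + u) / 2 := by linarith
    refine (D.continuousOn_tail hs (hT.trans h1.le) (ht.trans_lt h1)).continuousAt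
      (Ici_mem_nhds (by linarith)) |>.continuousWithinAt
  noncrit := fun u hu n => D.ne_critical
    ((D.tail_spec hs (hT.trans hu.le) (ht.trans_lt hu)).1 (n + 1)).2
  tail := fun u hu n _ => D.E_iterate_tail hs (hT.trans hu.le) (ht.trans_lt hu) n

theorem IsCurve.push (h : D.IsCurve s t γ) (ht : 0 ≤ t) :
    D.IsCurve (shift 1 s) (F t) (fun u => E a b (γ (Finv u))) := by
  have hF : ∀ u > F t, F (Finv u) = u := fun u hu => F_Finv (by linarith [le_F t])
  refine ⟨?_, fun u hu n => ?_, fun u hu n hn => ?_⟩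
  · refine (continuous_E a b).comp_continuousOn (h.cont.comp (continuousOn_Finv.mono ?_) ?_)
    · exact Ioi_subset_Ioi (by linarith [le_F t])
    · exact fun u hu => Finv_gt ht hu
  · rw [← Function.iterate_succ_apply]
    exact h.noncrit _ (Finv_gt ht hu) (n + 1)
  · rw [← Function.iterate_succ_apply, h.tail _ (Finv_gt ht hu) (n + 1), Function.iterate_succ_apply,
      hF u hu, shift_succ]
    rwa [Function.iterate_succ_apply, hF u hu]

theorem IsCurve.noncrit_one (h : D.IsCurve s t γ) {u : ℝ} (hu : t < u) :
    E a b (γ u) ≠ v₁ a b ∧ E a b (γ u) ≠ v₂ a b := h.noncrit u hu 0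

/-- Induction on the time needed to reach the tails: the pushed-forward curves agree, and lifting is
unique. -/
theorem IsCurve.unique (h : D.IsCurve s t γ) (h' : D.IsCurve s t γ') (ht : 0 ≤ t) :
    EqOn γ γ' (Ioi t) := by
  have key : ∀ (n : ℕ) (s : Address) (t : ℝ) (γ γ' : ℝ → ℂ), 0 ≤ t → D.threshold ≤ F^[n] t →
      D.IsCurve s t γ → D.IsCurve s t γ' → EqOn γ γ' (Ioi t) := by
    intro n
    induction n with
    | zero =>
      intro s t γ γ' _ hT h h' u hu
      have hu' : D.threshold ≤ u := le_trans hT (le_of_lt hu)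
      rw [h.eq_tail hu hu', h'.eq_tail hu hu']
    | succ n ih =>
      intro s t γ γ' ht hT h h'
      have h1 := ih (shift 1 s) (F t) _ _ (ht.trans (le_F t)) hT (h.push ht) (h'.push ht)
      have hu₀ : max t D.threshold + 1 ∈ Ioi t := by
        have := le_max_left t D.threshold
        simp only [mem_Ioi]; linarith
      refine lift_unique D.ha D.hb isPreconnected_Ioi h.cont h'.cont (fun u hu => ?_)
        (fun u hu => h.noncrit_one hu) hu₀ ?_
      · have h2 := h1 (F_strictMono (show t < u from hu))
        simpa only [Finv_F] using h2
      · have : D.threshold ≤ max t D.threshold + 1 := by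
          linarith [le_max_right t D.threshold]
        rw [h.eq_tail hu₀ this, h'.eq_tail hu₀ this]
  intro u hu
  have hu' : t < u := hu
  -- `t` may be `0`, which is fixed by `F`; the midpoint is positive, so its orbit passes the
  -- threshold.
  have h1 : t < (t + u) / 2 := by linarith
  obtain ⟨n, hn⟩ := ((tendsto_F_iterate (ht.trans_lt h1)).eventually_ge_atTop D.threshold).exists
  exact key n s _ γ γ' (ht.trans h1.le) hn (h.mono h1.le) (h'.mono h1.le)
    (show (t + u) / 2 < u by linarith)

/-- A lift of a curve at `σ s` which meets the tail at `s` is a curve at `s`. -/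
theorem isCurve_of_lift (hs : ExpBounded s) (hst : minPot s ≤ t)
    (h : D.IsCurve (shift 1 s) (F t) γ') (hcrit : ∀ u > F t, γ' u ≠ v₁ a b ∧ γ' u ≠ v₂ a b)
    (hγ : ContinuousOn γ (Ioi t)) (hE : ∀ u > t, E a b (γ u) = γ' (F u)) {u₀ : ℝ} (hu₀ : t < u₀)
    (hT : D.threshold ≤ u₀) (h₀ : γ u₀ = D.tail s u₀) : D.IsCurve s t γ := by
  have hF : ∀ u > t, F t < F u := fun u hu => F_strictMono hu
  -- These potentials form an interval, so uniqueness of lifts spreads the agreement at `u₀` over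
  -- the whole tail.
  have htail : EqOn γ (D.tail s) (Ioi t ∩ Ici D.threshold) := by
    have hcont : ContinuousOn (D.tail s) (Ioi t ∩ Ici D.threshold) := by
      intro u hu
      have hut : t < u := hu.1
      have h0 : minPot s < (t + u) / 2 := by linarith
      have h0' : (t + u) / 2 ≤ u := by linarith
      have h1 := D.continuousOn_tail hs (t₀ := max D.threshold ((t + u) / 2)) (le_max_left _ _)
        (lt_max_of_lt_right h0)
      have h2 : u ∈ Ici (max D.threshold ((t + u) / 2)) :=
        max_le hu.2 h0'
      refine (h1 u h2).mono_of_mem_nhdsWithin ?_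
      have h3 : Ici ((t + u) / 2) ∈ 𝓝[Ioi t ∩ Ici D.threshold] u :=
        mem_nhdsWithin_of_mem_nhds (Ici_mem_nhds (by linarith))
      filter_upwards [h3, self_mem_nhdsWithin] with x hx1 hx2
      exact max_le (show D.threshold ≤ x from hx2.2) (show (t + u) / 2 ≤ x from hx1)
    refine lift_unique D.ha D.hb (ordConnected_Ioi.inter ordConnected_Ici).isPreconnected
      (hγ.mono inter_subset_left) hcont (fun u hu => ?_) (fun u hu => ?_)
      (u₀ := u₀) ⟨hu₀, hT⟩ h₀
    · have hu2 : D.threshold ≤ u := hu.2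
      rw [hE u hu.1, h.eq_tail (hF u hu.1) (hu2.trans (le_F u))]
      exact (D.E_iterate_tail hs hu2 (hst.trans_lt hu.1) 1).symm
    · rw [hE u hu.1]; exact hcrit _ (hF u hu.1)
  refine ⟨hγ, fun u hu n => ?_, fun u hu n hn => ?_⟩
  · cases n with
    | zero => simp only [zero_add, Function.iterate_one]; rw [hE u hu]; exact hcrit _ (hF u hu)
    | succ n => rw [Function.iterate_succ_apply, hE u hu]; exact h.noncrit _ (hF u hu) n
  · cases n with
    | zero => exact htail ⟨hu, hn⟩
    | succ n =>
      rw [Function.iterate_succ_apply, hE u hu, h.tail _ (hF u hu) n hn, shift_succ]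
      rfl

theorem IsCurve.pull (hs : ExpBounded s) (hst : minPot s ≤ t)
    (h : D.IsCurve (shift 1 s) (F t) γ') (hcrit : ∀ u > F t, γ' u ≠ v₁ a b ∧ γ' u ≠ v₂ a b) :
    ∃ γ, D.IsCurve s t γ := by
  set u₀ := max t D.threshold + 1
  have hu₀ : t < u₀ := by linarith [le_max_left t D.threshold]
  have hT : D.threshold ≤ u₀ := by linarith [le_max_right t D.threshold]
  obtain ⟨γ, h1, h2, h3⟩ := exists_lift D.ha D.hb (continuousOn_comp_F h.cont)
    (fun u hu => hcrit _ (F_strictMono hu)) hu₀ (z₀ := D.tail s u₀) (by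
      rw [h.eq_tail (F_strictMono hu₀) (hT.trans (le_F _))]
      exact D.E_iterate_tail hs hT (hst.trans_lt hu₀) 1)
  exact ⟨γ, isCurve_of_lift hs hst h hcrit h1 h2 hu₀ hT h3⟩

/-- Every lift of a curve at `s` is a curve at an address which prepends a symbol to `s`. -/
theorem exists_isCurve_prepend (hs : ExpBounded s) (hst : minPot s ≤ F t)
    (h : D.IsCurve s (F t) γ') (hcrit : ∀ u > F t, γ' u ≠ v₁ a b ∧ γ' u ≠ v₂ a b)
    (hγ : ContinuousOn γ (Ioi t)) (hE : ∀ u > t, E a b (γ u) = γ' (F u)) :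
    ∃ j, D.IsCurve (prepend j s) t γ := by
  set u₀ := max t D.threshold + 1
  have hu₀ : t < u₀ := by linarith [le_max_left t D.threshold]
  have hT : D.threshold ≤ u₀ := by linarith [le_max_right t D.threshold]
  have hE₀ : E a b (γ u₀) = D.tail s (F u₀) := by
    rw [hE _ hu₀, h.eq_tail (F_strictMono hu₀) (hT.trans (le_F _))]
  have hlarge := (D.tail_spec hs (hT.trans (le_F _)) (hst.trans_lt (F_strictMono hu₀))).1 0
  have hns : E a b (γ u₀) ∉ slit a b := by
    rw [hE₀]; exact D.not_mem_slit hlarge.2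
  -- The strip containing the lift at a large potential supplies the symbol; injectivity of `E` on
  -- it identifies the lift with the tail there.
  obtain ⟨j, hj⟩ := D.exists_label hns
  have hb := expBounded_prepend j hs
  have hmin : minPot (prepend j s) ≤ t := by
    have := minPot_shift_one hb
    rw [shift_prepend] at this
    rw [this] at hst
    exact F_strictMono.le_iff_le.1 hst
  refine ⟨j, isCurve_of_lift hb hmin h hcrit hγ hE hu₀ hT ?_⟩
  have h1 := D.E_iterate_tail hb hT (hmin.trans_lt hu₀) 1
  have h2 := ((D.tail_spec hb hT (hmin.trans_lt hu₀)).1 0).1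
  refine D.injOn j hj h2 ?_
  rw [hE₀]
  exact h1.symm

end StripData

end

/-! ### The dynamic rays and their starting potentials -/

section

theorem IsRayTail.congr {a b : ℂ} {R : Symb → Set ℂ} {s : Address} {T : ℝ}
    {g g' : ℝ → ℂ} (h : IsRayTail a b R s T g) (heq : EqOn g' g (Ici T)) :
    IsRayTail a b R s T g' where
  pos := h.pos
  continuousOn := h.continuousOn.congr heq
  injOn := h.injOn.congr heq.symm
  escaping := fun t ht => by rw [heq ht]; exact h.escaping t ht
  address := fun t ht => by rw [heq ht]; exact h.address t ht
  re_tendsto := by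
    have h1 : (fun t => (g t).re) =ᶠ[atTop] fun t => (g' t).re := by
      filter_upwards [eventually_ge_atTop T] with t ht
      rw [heq ht]
    exact h.re_tendsto.imp (fun h => h.congr' h1) fun h => h.congr' h1
  asymptotics := fun t ht => by rw [heq ht]; exact h.asymptotics t ht

namespace StripData

variable {a b : ℂ} {R : Symb → Set ℂ} (D : StripData a b R)
include D

/-- The potentials to which the tail at `s` extends. -/
def domains (s : Address) : Set ℝ := {t | minPot s ≤ t ∧ ∃ γ, D.IsCurve s t γ}

/-- The potential at which the ray starts. -/
def start (s : Address) : ℝ := sInf (D.domains s)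

open Classical in
/-- The dynamic rays. -/
def ray (s : Address) (u : ℝ) : ℂ :=
  if h : ∃ γ, ∃ t, minPot s ≤ t ∧ t < u ∧ D.IsCurve s t γ then h.choose u else 0

variable {D} {s : Address}

theorem bddBelow_domains : BddBelow (D.domains s) := ⟨minPot s, fun _ h => h.1⟩

theorem domains_nonempty (hs : ExpBounded s) : (D.domains s).Nonempty :=
  ⟨max (minPot s) D.threshold, le_max_left _ _, _,
    D.isCurve_tail hs (le_max_right _ _) (le_max_left _ _)⟩

theorem minPot_le_start (hs : ExpBounded s) : minPot s ≤ D.start s :=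
  le_csInf (domains_nonempty hs) fun _ h => h.1

theorem start_nonneg (hs : ExpBounded s) : 0 ≤ D.start s :=
  (minPot_nonneg s).trans (minPot_le_start hs)

theorem start_le {t : ℝ} (hst : minPot s ≤ t) {γ : ℝ → ℂ} (h : D.IsCurve s t γ) :
    D.start s ≤ t := csInf_le bddBelow_domains ⟨hst, γ, h⟩

theorem ray_eq {t : ℝ} (hst : minPot s ≤ t) {γ : ℝ → ℂ} (h : D.IsCurve s t γ) :
    EqOn (D.ray s) γ (Ioi t) := by
  intro u hu
  have hex : ∃ γ, ∃ t, minPot s ≤ t ∧ t < u ∧ D.IsCurve s t γ := ⟨γ, t, hst, hu, h⟩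
  rw [ray, dif_pos hex]
  obtain ⟨t', h1, h2, h3⟩ := hex.choose_spec
  exact (h3.mono (le_max_left t' t)).unique (h.mono (le_max_right t' t))
    (le_max_of_le_left ((minPot_nonneg s).trans h1)) (show max t' t < u from max_lt h2 hu)

/-- The conditions on a curve are local in the potential and curves are unique, so those starting
closer and closer to the infimum glue. -/
theorem isCurve_ray (hs : ExpBounded s) : D.IsCurve s (D.start s) (D.ray s) := by
  have key : ∀ u > D.start s, ∃ t, D.start s ≤ t ∧ t < u ∧ D.IsCurve s t (D.ray s) := by
    intro u hu
    obtain ⟨t, ⟨h1, γ, h2⟩, h3⟩ := exists_lt_of_csInf_lt (domains_nonempty hs) hu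
    exact ⟨t, start_le h1 h2, h3, h2.congr (ray_eq h1 h2)⟩
  refine ⟨fun u hu => ?_, fun u hu => ?_, fun u hu => ?_⟩
  · obtain ⟨t, -, h2, h3⟩ := key u hu
    exact (h3.cont.continuousAt (Ioi_mem_nhds h2)).continuousWithinAt
  · obtain ⟨t, -, h2, h3⟩ := key u hu
    exact h3.noncrit u h2
  · obtain ⟨t, -, h2, h3⟩ := key u hu
    exact h3.tail u h2

theorem ray_functional (hs : ExpBounded s) {t : ℝ} (ht : D.start s < t) :
    D.start (shift 1 s) < F t ∧ E a b (D.ray s t) = D.ray (shift 1 s) (F t) := by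
  have h1 := (isCurve_ray (D := D) hs).push (start_nonneg hs)
  have h2 : minPot (shift 1 s) ≤ F (D.start s) := by
    rw [minPot_shift_one hs]; exact F_strictMono.monotone (minPot_le_start hs)
  refine ⟨(start_le h2 h1).trans_lt (F_strictMono ht), ?_⟩
  rw [ray_eq h2 h1 (F_strictMono ht)]
  simp only [Finv_F]

theorem ray_functional_iterate (hs : ExpBounded s) {t : ℝ} (ht : D.start s < t) (n : ℕ) :
    D.start (shift n s) < F^[n] t ∧ (E a b)^[n] (D.ray s t) = D.ray (shift n s) (F^[n] t) := by
  induction n generalizing s t with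
  | zero => exact ⟨ht, rfl⟩
  | succ n ih =>
    obtain ⟨h1, h2⟩ := ray_functional hs ht
    obtain ⟨h3, h4⟩ := ih (hs.shift 1) h1
    rw [shift_succ, Function.iterate_succ_apply, Function.iterate_succ_apply, h2]
    exact ⟨h3, h4⟩

theorem le_start_of_mem_critPotentials (hs : ExpBounded s) {t : ℝ}
    (h : t ∈ critPotentials a b D.start D.ray s) : t ≤ D.start s := by
  obtain ⟨-, n, hn, -, h2⟩ := h
  by_contra hlt
  obtain ⟨m, rfl⟩ : ∃ m, n = m + 1 := ⟨n - 1, by omega⟩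
  have h3 := (isCurve_ray (D := D) hs).noncrit t (not_le.1 hlt) m
  rw [(ray_functional_iterate hs (not_le.1 hlt) (m + 1)).2] at h3
  exact h2.elim h3.1 h3.2

/-- Avoiding the critical values is an open condition, so a lift that reaches `t` reaches a little
further. -/
theorem exists_isCurve_below (hs : ExpBounded s) {t : ℝ} (ht : minPot s < t)
    (h1 : D.start (shift 1 s) < F t)
    (h2 : ∀ u ≥ F t, D.ray (shift 1 s) u ≠ v₁ a b ∧ D.ray (shift 1 s) u ≠ v₂ a b) :
    D.start s < t := by
  have hc := isCurve_ray (D := D) (hs.shift 1)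
  have h3 : ContinuousAt (D.ray (shift 1 s)) (F t) :=
    hc.cont.continuousAt (Ioi_mem_nhds h1)
  have h4 : ∀ᶠ u in 𝓝 (F t), D.ray (shift 1 s) u ≠ v₁ a b ∧ D.ray (shift 1 s) u ≠ v₂ a b :=
    (h3.eventually_ne (h2 _ le_rfl).1).and (h3.eventually_ne (h2 _ le_rfl).2)
  obtain ⟨p, hp, hp'⟩ := exists_Ioc_subset_of_mem_nhds h4 ⟨_, h1⟩
  set q := max p (max (D.start (shift 1 s)) (F (minPot s))) with hq
  have hqt : q < F t := max_lt hp (max_lt h1 (F_strictMono ht))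
  have hq0 : 0 ≤ q := le_max_of_le_right (le_max_of_le_left (start_nonneg (hs.shift 1)))
  have hFq : F (Finv q) = q := F_Finv (by linarith)
  have hmin : minPot s ≤ Finv q := by
    rw [← F_strictMono.le_iff_le, hFq]; exact le_max_of_le_right (le_max_right _ _)
  obtain ⟨γ, hγ⟩ := IsCurve.pull (t := Finv q) hs hmin
    (by rw [hFq]; exact hc.mono (le_max_of_le_right (le_max_left _ _))) (by
      rw [hFq]
      intro u hu
      rcases le_or_gt u (F t) with h | h
      · exact hp' ⟨(le_max_left _ _).trans_lt hu, h⟩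
      · exact h2 u h.le)
  refine (start_le hmin hγ).trans_lt ?_
  rwa [← F_strictMono.lt_iff_lt, hFq]

/-- Let `m + 1` be the first positive time at which the ray at the shifted address extends below the
image of the start. Without a critical value there, `exists_isCurve_below` would give the same
extension at time `m`, against minimality, or for `m = 0` against the definition of the start. -/
theorem start_mem_critPotentials (hs : ExpBounded s) (h : minPot s < D.start s) :
    D.start s ∈ critPotentials a b D.start D.ray s := by
  classical
  have hpos : 0 < D.start s := (minPot_nonneg s).trans_lt h
  have hex : ∃ m : ℕ, D.start (shift (m + 1) s) < F^[m + 1] (D.start s) := by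
    obtain ⟨m, hm⟩ := (((tendsto_add_atTop_iff_nat 1).2 (tendsto_F_iterate hpos)).eventually_gt_atTop
      D.threshold).exists
    refine ⟨m, (start_le (le_max_left _ _) (D.isCurve_tail (hs.shift (m + 1)) (le_max_right _ _)
      (le_max_left _ _))).trans_lt (max_lt ?_ hm)⟩
    rw [minPot_shift hs]
    exact F_iterate_strictMono _ h
  obtain ⟨hn, hmin⟩ := And.intro (Nat.find_spec hex) fun m => Nat.find_min hex (m := m)
  set m := Nat.find hex
  refine ⟨h, m + 1, by omega, hn, ?_⟩
  by_contra hcrit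
  rw [not_or] at hcrit
  have hlt : D.start (shift m s) < F^[m] (D.start s) := by
    refine exists_isCurve_below (hs.shift m) (by
      rw [minPot_shift hs]; exact F_iterate_strictMono _ h) ?_ fun u hu => ?_
    · rw [← Function.iterate_succ_apply' F, shift_shift, add_comm]; exact hn
    · rw [← Function.iterate_succ_apply' F] at hu
      rw [shift_shift, add_comm 1 m]
      rcases eq_or_lt_of_le hu with h1 | h1
      · rw [← h1]; exact hcrit
      · obtain ⟨x, rfl⟩ : ∃ x, F^[m + 1] x = u := by
          have hu0 : 0 ≤ u := (F_iterate_nonneg _ hpos.le).trans hu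
          exact exists_F_iterate_eq _ hu0
        have hx : D.start s < x := (F_iterate_strictMono _).lt_iff_lt.1 h1
        rw [← (ray_functional_iterate hs hx (m + 1)).2]
        exact (isCurve_ray hs).noncrit x hx m
  rcases Nat.eq_zero_or_pos m with h0 | h0
  · rw [h0] at hlt; exact lt_irrefl _ hlt
  · refine hmin (m - 1) (by omega) ?_
    rwa [Nat.sub_add_cancel h0]

theorem exists_threshold_le_iterate {t : ℝ} (ht : 0 < t) : ∃ n : ℕ, D.threshold ≤ F^[n] t :=
  ((tendsto_F_iterate ht).eventually_ge_atTop D.threshold).exists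

/-- If two points on rays coincide then so do, at a later time, points on tails. -/
theorem ray_eq_ray {s s' : Address} (hs : ExpBounded s) (hs' : ExpBounded s') {t t' : ℝ}
    (ht : D.start s < t) (ht' : D.start s' < t') (h : D.ray s t = D.ray s' t') :
    ∃ n, shift n s = shift n s' ∧ t = t' := by
  have h0 : 0 < min t t' := lt_min ((start_nonneg hs).trans_lt ht) ((start_nonneg hs').trans_lt ht')
  obtain ⟨n, hn⟩ := exists_threshold_le_iterate (D := D) h0
  have h1 : D.threshold ≤ F^[n] t := hn.trans ((F_iterate_strictMono n).monotone (min_le_left _ _))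
  have h2 : D.threshold ≤ F^[n] t' := hn.trans ((F_iterate_strictMono n).monotone (min_le_right _ _))
  have h3 := (isCurve_ray hs).tail t ht n h1
  have h4 := (isCurve_ray hs').tail t' ht' n h2
  rw [h, h4] at h3
  have h5 := D.tail_injective (hs'.shift n) (hs.shift n) h2 h1
    (by rw [minPot_shift hs']; exact F_iterate_strictMono n ((minPot_le_start hs').trans_lt ht'))
    (by rw [minPot_shift hs]; exact F_iterate_strictMono n ((minPot_le_start hs).trans_lt ht)) h3
  exact ⟨n, h5.1.symm, (F_iterate_strictMono n).injective h5.2.symm⟩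

theorem isDynamicRays : IsDynamicRays a b R D.start D.ray where
  continuousOn := fun s hs => (isCurve_ray hs).cont
  injOn := fun s hs t ht t' ht' h => (ray_eq_ray hs hs ht ht' h).choose_spec.2
  escaping := fun s hs t ht => by
    obtain ⟨n, hn⟩ := exists_threshold_le_iterate (D := D) ((start_nonneg hs).trans_lt ht)
    apply IsEscaping.of_iterate (n := n)
    rw [(isCurve_ray hs).tail t ht n hn]
    exact D.isEscaping_tail (hs.shift n) hn
      (by rw [minPot_shift hs]; exact F_iterate_strictMono n ((minPot_le_start hs).trans_lt ht))
  tail := fun s hs => by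
    have h1 : D.start s < max D.threshold (D.start s + 1) :=
      lt_max_of_lt_right (lt_add_one _)
    refine ⟨_, h1, (D.isRayTail_tail hs (le_max_left _ _)
      ((minPot_le_start hs).trans_lt h1)).congr fun t ht => ?_⟩
    exact (isCurve_ray hs).eq_tail (h1.trans_le ht) ((le_max_left _ _).trans ht)
  functional := fun s hs t ht => ray_functional hs ht
  start_regular := fun s hs h => by
    by_contra hne
    have := start_mem_critPotentials hs (lt_of_le_of_ne (minPot_le_start hs) (Ne.symm hne))
    rw [h] at this
    exact this
  start_exceptional := fun s hs h => by
    obtain ⟨t, ht⟩ := h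
    have h1 := le_start_of_mem_critPotentials hs ht
    exact ⟨start_mem_critPotentials hs (ht.1.trans_le h1),
      fun u hu => le_start_of_mem_critPotentials hs hu⟩

end StripData

end

/-! ### Slow and fast escaping orbits -/

section

namespace StripData

variable {a b : ℂ} {R : Symb → Set ℂ} (D : StripData a b R)
include D

/-- Since `‖E z‖ ≤ M exp |Re z|`, a point with bounded real part cannot have a large image. -/
theorem tendsto_abs_re {z : ℂ} (hz : IsEscaping a b z) :
    Tendsto (fun k => |((E a b)^[k] z).re|) atTop atTop := by
  rw [tendsto_atTop]
  intro ρ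
  have h := (tendsto_add_atTop_iff_nat 1).2 hz
  filter_upwards [h.eventually_gt_atTop (D.M * Real.exp ρ)] with k hk
  have h1 := hk.trans_le (D.norm_succ_le z k)
  exact (Real.exp_lt_exp.1 (lt_of_mul_lt_mul_left h1 D.M_pos.le)).le

/-- No orbit outgrows the iterates of `F`; this is what bounds the address of an orbit and its
minimal potential. -/
theorem norm_add_gap_le {z : ℂ} {y : ℝ} (hy : |z.re| + D.gap ≤ y) (m : ℕ) :
    ‖(E a b)^[m + 1] z‖ + D.gap ≤ F^[m + 1] y := by
  have hM := D.M_ge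
  have key : ∀ (w : ℂ) (Y : ℝ), |w.re| + D.gap ≤ Y → ‖E a b w‖ + D.gap ≤ F Y := by
    intro w Y hY
    have h1 := D.norm_le w
    have h2 := D.gap_spec (x := D.gap) le_rfl
    have h3 : Real.exp |w.re| * Real.exp D.gap ≤ Real.exp Y := by
      rw [← Real.exp_add]; exact Real.exp_le_exp.2 hY
    have h4 : 1 ≤ Real.exp |w.re| := Real.one_le_exp (abs_nonneg _)
    have h5 := D.C_pos
    have h6 := D.gap_pos
    have h7 := mul_le_mul_of_nonneg_left h2 (by linarith : 0 ≤ Real.exp |w.re|)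
    unfold F
    have h8 : D.M + D.gap + 1 ≤ 4 * D.M ^ 2 + 2 * D.M * (2 * D.C) + 2 * D.M * D.gap := by
      nlinarith [mul_pos (by linarith : 0 < D.M) h5]
    have h9 := mul_le_mul_of_nonneg_left h8 (by linarith : 0 ≤ Real.exp |w.re|)
    nlinarith
  have key2 : ∀ m, |((E a b)^[m] z).re| + D.gap ≤ F^[m] y := by
    intro m
    induction m with
    | zero => exact hy
    | succ m ih =>
      rw [Function.iterate_succ_apply', Function.iterate_succ_apply']
      have := key _ _ ih
      linarith [Complex.abs_re_le_norm (E a b ((E a b)^[m] z))]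
  rw [Function.iterate_succ_apply', Function.iterate_succ_apply']
  exact key _ _ (key2 m)

variable {D} {s : Address} {z : ℂ}

theorem Orbit.abs_entry_le (h : D.Orbit s z) (k : ℕ) :
    |((s k).1 : ℝ)| ≤ ‖(E a b)^[k] z‖ + D.gap := by
  have h1 := D.im_bound _ _ (h k).1
  have h2 := Complex.abs_im_le_norm ((E a b)^[k] z)
  have h3 := D.C_le_gap
  have hpi := Real.pi_gt_three
  have h4 : 2 * Real.pi * |((s k).1 : ℝ)| ≤ ‖(E a b)^[k] z‖ + D.gap := by
    rw [← abs_of_pos (by positivity : 0 < 2 * Real.pi), ← abs_mul]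
    have h5 := abs_sub_abs_le_abs_sub (2 * Real.pi * ((s k).1 : ℝ)) ((E a b)^[k] z).im
    rw [abs_sub_comm] at h5
    linarith
  nlinarith [abs_nonneg ((s k).1 : ℝ)]

theorem Orbit.expBounded (h : D.Orbit s z) : ExpBounded s := by
  have hg := D.gap_pos
  refine ⟨‖z‖ + D.gap, by positivity, fun k => (h.abs_entry_le k).trans ?_⟩
  cases k with
  | zero => rfl
  | succ k => exact D.norm_add_gap_le (by linarith [Complex.abs_re_le_norm z]) k

theorem Orbit.minPot_le (h : D.Orbit s z) : minPot s ≤ |z.re| + D.gap := by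
  refine minPot_le_of_bound (by linarith [abs_nonneg z.re, D.gap_pos]) ?_
  filter_upwards [eventually_ge_atTop 1] with k hk
  obtain ⟨m, rfl⟩ : ∃ m, k = m + 1 := ⟨k - 1, by omega⟩
  exact (h.abs_entry_le _).trans (D.norm_add_gap_le le_rfl m)

variable (D) in
/-- The loss in real parts when comparing with an orbit at the same address. -/
def slack : ℝ := Real.log (3 * D.M ^ 2)

variable (D) in
theorem exp_slack : Real.exp D.slack = 3 * D.M ^ 2 :=
  Real.exp_log (by nlinarith [D.M_ge])

variable (D) in
theorem loss_le_slack : D.loss ≤ D.slack :=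
  Real.log_le_log (by linarith [D.M_ge]) (by nlinarith [D.M_ge])

variable (D) in
/-- Real parts beyond which orbits are organized in rays. -/
def far : ℝ := D.threshold + 2 * D.slack + 2 * D.C + 2 * D.gap + 1

variable (D) in
/-- Orbits at address `s` which stay far out. -/
structure FarOrbit (s : Address) (z : ℂ) : Prop where
  orbit : D.Orbit s z
  far : ∀ k, D.far ≤ |((E a b)^[k] z).re|

theorem FarOrbit.shift (h : D.FarOrbit s z) (n : ℕ) :
    D.FarOrbit (shift n s) ((E a b)^[n] z) :=
  ⟨h.orbit.shift n, fun k => by rw [← Function.iterate_add_apply]; exact h.far _⟩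

variable (D) in
theorem exists_farOrbit {w : ℂ} (hw : IsEscaping a b w) :
    ∃ n s, D.FarOrbit s ((E a b)^[n] w) := by
  obtain ⟨n, hn⟩ := ((D.tendsto_abs_re hw).eventually_ge_atTop
    (max D.far D.r)).exists_forall_of_atTop
  have h1 : ∀ k, max D.far D.r ≤ |((E a b)^[k] ((E a b)^[n] w)).re| := fun k => by
    rw [← Function.iterate_add_apply]; exact hn _ (by omega)
  have h2 : ∀ k, ∃ j, (E a b)^[k] ((E a b)^[n] w) ∈ R j := fun k => by
    apply D.exists_label
    rw [← Function.iterate_succ_apply' (E a b)]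
    exact D.not_mem_slit ((le_max_right _ _).trans (h1 (k + 1)))
  choose s hs using h2
  exact ⟨n, s, fun k => ⟨hs k, (le_max_right _ _).trans (h1 k)⟩,
    fun k => (le_max_left _ _).trans (h1 k)⟩

variable (D) in
theorem far_sub_slack : D.r ≤ D.far - D.slack ∧
    D.slack + 2 * D.C ≤ D.far - D.slack ∧ D.threshold + 1 + 2 * D.gap ≤ D.far := by
  have h1 := D.loss_le_slack
  have h2 := D.loss_pos
  have h3 := D.C_pos
  have h4 := D.gap_pos
  have h5 := D.threshold_pos
  have h6 := D.r_lt_threshold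
  unfold far
  refine ⟨?_, ?_, ?_⟩ <;> linarith

/-- The loss does not accumulate: a loss of `slack` at the image still gives `‖E z‖ ≤ 3 ‖y'‖`, hence
`exp |Re z| ≤ 3 M² exp |Re y|`, and `exp slack = 3 M²`. -/
theorem abs_re_sub_slack_le {i : Symb} {y y' : ℂ} (hz : D.far ≤ |z.re|)
    (hz' : D.far ≤ |(E a b z).re|) (hzi : E a b z ∈ R i) (hyi : y' ∈ R i)
    (hy' : |(E a b z).re| - D.slack ≤ |y'.re|) (hE : E a b y = y') :
    |z.re| - D.slack ≤ |y.re| := by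
  obtain ⟨h1, h2, h3⟩ := D.far_sub_slack
  have hM := D.M_pos
  have hsl := D.loss_pos.trans_le D.loss_le_slack
  have h4 := D.le_norm z (by linarith)
  have h5 := Complex.norm_le_abs_re_add_abs_im (E a b z)
  have h6 := D.im_bound _ _ hzi
  have h7 := D.im_bound _ _ hyi
  have h8 : |(E a b z).im| ≤ |y'.im| + 2 * D.C := by
    have := abs_sub_abs_le_abs_sub (E a b z).im y'.im
    have h9 : |(E a b z).im - y'.im| ≤ 2 * D.C := by
      rw [abs_le] at h6 h7 ⊢
      constructor <;> linarith
    linarith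
  have h9 := Complex.abs_re_le_norm y'
  have h10 := Complex.abs_im_le_norm y'
  have h11 := D.norm_le y
  rw [hE] at h11
  have h12 : ‖E a b z‖ ≤ 3 * ‖y'‖ := by linarith
  have h13 : Real.exp |z.re| ≤ 3 * D.M ^ 2 * Real.exp |y.re| := by
    refine h4.trans ((mul_le_mul_of_nonneg_left (h12.trans
      (mul_le_mul_of_nonneg_left h11 (by norm_num))) hM.le).trans (le_of_eq ?_))
    ring
  rw [← D.exp_slack, ← Real.exp_add, Real.exp_le_exp] at h13
  linarith

/-- The tail at `σⁿ s` is pulled back along the strips visited by `z`. Its real parts stay at most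
`slack` below those of the far orbit, so no critical value is met. -/
theorem FarOrbit.exists_isCurve (n : ℕ) {t : ℝ} (h : D.FarOrbit s z) (hst : minPot s ≤ t)
    (hn : |((E a b)^[n] z).re| ≤ F^[n] t) (hT : D.threshold ≤ F^[n] t) :
    ∃ γ, D.IsCurve s t γ ∧ ∀ u > t, γ u ∈ R (s 0) ∧ |z.re| - D.slack ≤ |(γ u).re| := by
  obtain ⟨hr, -, -⟩ := D.far_sub_slack
  induction n generalizing s z t with
  | zero =>
    have hs := h.orbit.expBounded
    refine ⟨_, D.isCurve_tail hs hT hst, fun u hu => ?_⟩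
    obtain ⟨h1, h2, -⟩ := D.tail_spec hs (le_trans hT hu.le) (hst.trans_lt hu)
    refine ⟨(h1 0).1, ?_⟩
    have h3 := h2 0
    have h4 := D.loss_le_slack
    simp only [Function.iterate_zero, id] at h3 hn
    linarith
  | succ n ih =>
    have hs := h.orbit.expBounded
    obtain ⟨γ', h1, h2⟩ := ih (t := F t) (h.shift 1) (by
      rw [minPot_shift_one hs]; exact F_strictMono.monotone hst) hn hT
    have hfar := h.far 1
    rw [Function.iterate_one] at hfar h2
    have h3 : ∀ u > F t, D.r ≤ |(γ' u).re| := fun u hu => by linarith [(h2 u hu).2]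
    have hE : ∀ u > t, E a b (D.branch (s 0) (γ' (F u))) = γ' (F u) := fun u hu =>
      D.E_branch _ (D.not_mem_slit (h3 _ (F_strictMono hu)))
    set u₀ := max t D.threshold + 1
    have hu₀ : t < u₀ := by linarith [le_max_left t D.threshold]
    have hTu : D.threshold ≤ u₀ := by linarith [le_max_right t D.threshold]
    refine ⟨fun u => D.branch (s 0) (γ' (F u)), isCurve_of_lift hs hst h1
      (fun u hu => D.ne_critical (h3 u hu)) (fun u hu => ?_) hE hu₀ hTu ?_, fun u hu => ⟨?_, ?_⟩⟩
    · refine ContinuousAt.comp_continuousWithinAt (D.continuousAt_branch _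
        (h3 _ (F_strictMono hu))) (continuousOn_comp_F h1.cont u hu)
    · have h4 := D.E_iterate_tail hs hTu (hst.trans_lt hu₀) 1
      have h5 := ((D.tail_spec hs hTu (hst.trans_lt hu₀)).1 0).1
      rw [h1.eq_tail (F_strictMono hu₀) (hTu.trans (le_F _))]
      rw [Function.iterate_one, Function.iterate_one] at h4
      rw [← h4]
      exact D.branch_E h5
    · exact D.branch_mem _ (D.not_mem_slit (h3 _ (F_strictMono hu)))
    · exact abs_re_sub_slack_le (h.far 0) hfar (h.orbit 1).1 (h2 _ (F_strictMono hu)).1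
        (h2 _ (F_strictMono hu)).2 (hE u hu)

variable (D) in
/-- Far orbits which escape more slowly than all points on the ray at their address. -/
structure SlowOrbit (s : Address) (z : ℂ) : Prop extends
    D.FarOrbit s z where
  slow : ∀ t > minPot s, ∀ᶠ n in atTop, |((E a b)^[n] z).re| ≤ F^[n] t

theorem SlowOrbit.shift_one (h : D.SlowOrbit s z) : D.SlowOrbit (shift 1 s) (E a b z) where
  toFarOrbit := h.toFarOrbit.shift 1
  slow := fun t ht => by
    rw [minPot_shift_one h.orbit.expBounded] at ht
    have ht0 : 0 ≤ t := ((minPot_nonneg s).trans (le_F _)).trans ht.le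
    have h1 := (tendsto_add_atTop_nat 1).eventually (h.slow (Finv t) (Finv_gt (minPot_nonneg s) ht))
    filter_upwards [h1] with n hn
    rwa [Function.iterate_succ_apply, Function.iterate_succ_apply, F_Finv (by linarith)] at hn

theorem SlowOrbit.shift (h : D.SlowOrbit s z) (n : ℕ) :
    D.SlowOrbit (shift n s) ((E a b)^[n] z) := by
  induction n generalizing s z with
  | zero => exact h
  | succ n ih => rw [shift_succ]; exact ih h.shift_one

theorem SlowOrbit.exists_isCurve (h : D.SlowOrbit s z) {t : ℝ} (ht : minPot s < t) :
    ∃ γ, D.IsCurve s t γ ∧ ∀ u > t, γ u ∈ R (s 0) ∧ |z.re| - D.slack ≤ |(γ u).re| := by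
  have h1 := tendsto_F_iterate ((minPot_nonneg s).trans_lt ht)
  obtain ⟨n, hn1, hn2⟩ := ((h.slow t ht).and (h1.eventually_ge_atTop D.threshold)).exists
  exact h.toFarOrbit.exists_isCurve n ht.le hn1 hn2

theorem SlowOrbit.start_eq (h : D.SlowOrbit s z) : D.start s = minPot s := by
  refine le_antisymm (le_of_forall_gt_imp_ge_of_dense fun t ht => ?_)
    (minPot_le_start h.orbit.expBounded)
  obtain ⟨γ, hγ, -⟩ := h.exists_isCurve ht
  exact start_le (le_of_lt ht) hγ

theorem SlowOrbit.ray_mem (h : D.SlowOrbit s z) {t : ℝ} (ht : minPot s < t) :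
    D.ray s t ∈ R (s 0) ∧ |z.re| - D.slack ≤ |(D.ray s t).re| := by
  have h1 : minPot s < (minPot s + t) / 2 := by linarith
  obtain ⟨γ, hγ, h2⟩ := h.exists_isCurve h1
  have h3 : (minPot s + t) / 2 < t := by linarith
  rw [ray_eq h1.le hγ h3]
  exact h2 t h3

theorem SlowOrbit.abs_re_ray (h : D.SlowOrbit s z) {t : ℝ} (ht : minPot s < t) (n : ℕ) :
    (E a b)^[n] (D.ray s t) ∈ R (s n) ∧
      |((E a b)^[n] z).re| - D.slack ≤ |((E a b)^[n] (D.ray s t)).re| := by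
  have hs := h.orbit.expBounded
  rw [(ray_functional_iterate hs (by rwa [h.start_eq]) n).2]
  have := (h.shift n).ray_mem (t := F^[n] t) (by
    rw [minPot_shift hs]; exact F_iterate_strictMono n ht)
  simpa using this

theorem SlowOrbit.orbit_ray (h : D.SlowOrbit s z) {t : ℝ} (ht : minPot s < t) :
    D.Orbit s (D.ray s t) := fun n => by
  obtain ⟨h1, h2⟩ := h.abs_re_ray ht n
  exact ⟨h1, by linarith [h.far n, (D.far_sub_slack).1]⟩

/-- Every point on a ray is eventually close to the model orbit. -/
theorem ray_model (hs : ExpBounded s) {t : ℝ} (ht : D.start s < t) :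
    ∃ B, ∃ N : ℕ, ∀ k ≥ N, ‖(E a b)^[k] (D.ray s t) - model s t k‖ ≤ B ∧
      (E a b)^[k] (D.ray s t) ∈ R (s k) := by
  obtain ⟨n, hn⟩ := exists_threshold_le_iterate (D := D) ((start_nonneg hs).trans_lt ht)
  obtain ⟨h1, -, B, h2⟩ := D.tail_spec (hs.shift n) hn
    (by rw [minPot_shift hs]; exact F_iterate_strictMono n ((minPot_le_start hs).trans_lt ht))
  refine ⟨B, n, fun k hk => ?_⟩
  obtain ⟨m, rfl⟩ : ∃ m, k = m + n := ⟨k - n, by omega⟩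
  rw [Function.iterate_add_apply, (isCurve_ray hs).tail t ht n hn, ← model_shift]
  exact ⟨h2 m, (h1 m).1⟩

theorem ray_abs_re (hs : ExpBounded s) {t : ℝ} (ht : D.start s < t) :
    ∃ B, ∃ N : ℕ, ∀ k ≥ N, |(|((E a b)^[k] (D.ray s t)).re| - F^[k] t)| ≤ B := by
  obtain ⟨B, N, h⟩ := ray_model hs ht
  refine ⟨B, N, fun k hk => ?_⟩
  have h1 : F^[k] t = |(model s t k).re| := by
    rw [model_re, abs_mul,
      abs_of_nonneg (F_iterate_nonneg k ((start_nonneg hs).trans ht.le))]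
    rcases (s k).2.sign_cases with h | h <;> rw [h] <;> simp
  rw [h1]
  refine (abs_abs_sub_abs_le_abs_sub _ _).trans ?_
  rw [← Complex.sub_re]
  exact (Complex.abs_re_le_norm _).trans (h k hk).1

/-- No iterate of a point on a ray can exceed the orbit of a larger potential by the gap for all
times. -/
theorem not_dominated (hs : ExpBounded s) {t : ℝ} (ht : D.start s < t) {n : ℕ} {ξ : ℝ}
    (hξ : F^[n] t < ξ)
    (h : ∀ k, F^[k] ξ ≤ |((E a b)^[k] ((E a b)^[n] (D.ray s t))).re|) : False := by
  obtain ⟨B, N, h1⟩ := ray_abs_re hs ht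
  have h0 := F_iterate_nonneg n ((start_nonneg hs).trans ht.le)
  obtain ⟨k, hk1, hk2⟩ := (((tendsto_F_iterate_sub h0 hξ).eventually_gt_atTop B).and
    (eventually_ge_atTop N)).exists
  have h2 := (le_abs_self _).trans (h1 (k + n) (by omega))
  have h3 := h k
  rw [← Function.iterate_add_apply] at h3 hk1
  linarith

/-- Otherwise `StripData.dominate` would keep the orbit of the ray point above `F^[k] (F^[n] t + 1)`
forever, too fast for its potential. The orbit of `z` enters the reference sequence because it
controls the imaginary parts of all orbits at `s`. -/
theorem SlowOrbit.abs_re_ray_le (h : D.SlowOrbit s z) {t : ℝ} (ht : minPot s < t) {n : ℕ}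
    (hn : F^[n] t < |((E a b)^[n] z).re| + D.gap + 1) :
    |((E a b)^[n] (D.ray s t)).re| ≤ |((E a b)^[n] z).re| + 2 * D.gap + 2 := by
  by_contra! hlt
  have hs := h.orbit.expBounded
  have hst : D.start s < t := by rwa [h.start_eq]
  have hg := D.gap_pos
  have hM := D.M_ge
  have hFt : 0 ≤ F^[n] t := F_iterate_nonneg n ((minPot_nonneg s).trans ht.le)
  refine not_dominated hs hst (n := n) (ξ := F^[n] t + 1) (by linarith) fun k => ?_
  have hor := h.orbit_ray ht
  have hexp : ∀ x : ℝ, Real.exp x ≤ D.M * Real.exp x := fun x =>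
    le_mul_of_one_le_left (Real.exp_pos x).le (by linarith)
  have := D.dominate (X := fun k => max |((E a b)^[k + n] z).re| (F^[k] (F^[n] t + 1)))
    (y := (E a b)^[n] (D.ray s t)) (fun k => le_max_of_le_left (abs_nonneg _)) (fun k => ?_)
    (fun k => ?_) ?_ k
  · have h1 := le_max_right |((E a b)^[k + n] z).re| (F^[k] (F^[n] t + 1))
    linarith
  · refine max_le ?_ ?_
    · have h1 := (Complex.abs_re_le_norm _).trans (D.norm_succ_le z (k + n))
      rw [add_right_comm]
      exact h1.trans (mul_le_mul_of_nonneg_left (Real.exp_le_exp.2 (le_max_left _ _)) (by linarith))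
    · rw [Function.iterate_succ_apply']
      refine le_trans ?_ ((Real.exp_le_exp.2 (le_max_right _ _)).trans (hexp _))
      unfold F; linarith
  · rw [← Function.iterate_add_apply]
    have h1 := h.orbit.abs_im_sub_le hor (k + 1 + n)
    have h2 := (Complex.abs_im_le_norm _).trans (D.norm_succ_le z (k + n))
    rw [add_right_comm] at h2
    have h3 := abs_sub_abs_le_abs_sub ((E a b)^[k + 1 + n] (D.ray s t)).im
      ((E a b)^[k + 1 + n] z).im
    rw [abs_sub_comm] at h3
    have h4 := mul_le_mul_of_nonneg_left (Real.exp_le_exp.2 (le_max_left |((E a b)^[k + n] z).re|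
      (F^[k] (F^[n] t + 1)))) (by linarith : 0 ≤ D.M)
    linarith
  · simp only [zero_add, Function.iterate_zero, id]
    have : max |((E a b)^[n] z).re| (F^[n] t + 1) ≤ |((E a b)^[n] z).re| + D.gap + 2 :=
      max_le (by linarith) (by linarith)
    linarith

theorem abs_re_sub_eq {i : Symb} {y w : ℂ} (hy : y ∈ R i) (hw : w ∈ R i) (hyr : D.r ≤ |y.re|)
    (hwr : D.r ≤ |w.re|) : |y.re - w.re| = |(|y.re| - |w.re|)| := by
  rw [← D.sign_mul_re hy hyr, ← D.sign_mul_re hw hwr, ← mul_sub, abs_mul]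
  rcases i.2.sign_cases with h | h <;> rw [h] <;> simp

theorem SlowOrbit.norm_ray_sub_le (h : D.SlowOrbit s z) {t : ℝ} (ht : minPot s < t) {n : ℕ}
    (hn : F^[n] t < |((E a b)^[n] z).re| + D.gap + 1) :
    ‖D.ray s t - z‖ ≤ (2 * D.gap + 2 + D.slack + 2 * D.C) / 2 ^ n := by
  have hor := h.orbit_ray ht
  refine (hor.norm_sub_le h.orbit n).trans (div_le_div_of_nonneg_right ?_ (by positivity))
  refine (Complex.norm_le_abs_re_add_abs_im _).trans ?_
  rw [Complex.sub_re, Complex.sub_im,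
    abs_re_sub_eq (hor n).1 (h.orbit n).1 (hor n).2 (h.orbit n).2]
  have h1 := hor.abs_im_sub_le h.orbit n
  have h2 := h.abs_re_ray_le ht hn
  have h3 := (h.abs_re_ray ht n).2
  have h4 := D.gap_pos
  have h5 := D.loss_pos.trans_le D.loss_le_slack
  have h6 : |(|((E a b)^[n] (D.ray s t)).re| - |((E a b)^[n] z).re|)| ≤
      2 * D.gap + 2 + D.slack := by
    rw [abs_le]; constructor <;> linarith
  linarith

theorem SlowOrbit.tendsto_ray (h : D.SlowOrbit s z) :
    Tendsto (D.ray s) (𝓝[>] minPot s) (𝓝 z) := by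
  have hs := h.orbit.expBounded
  rw [Metric.tendsto_nhds]
  intro ε hε
  have h1 : Tendsto (fun n : ℕ => (2 * D.gap + 2 + D.slack + 2 * D.C) * (1 / 2 : ℝ) ^ n) atTop
      (𝓝 ((2 * D.gap + 2 + D.slack + 2 * D.C) * 0)) :=
    (tendsto_pow_atTop_nhds_zero_of_lt_one (by norm_num) (by norm_num)).const_mul _
  rw [mul_zero] at h1
  obtain ⟨n, hn⟩ := (h1.eventually (gt_mem_nhds hε)).exists
  -- By `Orbit.minPot_le` at time `n` this holds at the minimal potential itself; continuity passes
  -- it on to slightly larger ones.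
  have h2 : F^[n] (minPot s) < |((E a b)^[n] z).re| + D.gap + 1 := by
    have := (h.orbit.shift n).minPot_le
    rw [minPot_shift hs] at this
    linarith
  have h3 : ∀ᶠ t in 𝓝[>] minPot s, F^[n] t < |((E a b)^[n] z).re| + D.gap + 1 :=
    (((continuous_F.iterate n).tendsto _).mono_left nhdsWithin_le_nhds).eventually (gt_mem_nhds h2)
  filter_upwards [h3, self_mem_nhdsWithin] with t ht1 ht2
  rw [dist_eq_norm]
  refine (h.norm_ray_sub_le ht2 ht1).trans_lt ?_
  rwa [one_div, inv_pow, ← div_eq_mul_inv] at hn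

theorem SlowOrbit.landsUniformly (h : D.SlowOrbit s z) (hz : IsEscaping a b z) :
    LandsUniformly a b D.start D.ray s z := by
  refine ⟨h.start_eq, hz, h.tendsto_ray, fun r => ?_⟩
  have hsl := D.loss_pos.trans_le D.loss_le_slack
  obtain ⟨N, hN⟩ := ((D.tendsto_abs_re hz).eventually_gt_atTop (r + D.slack)).exists_forall_of_atTop
  refine ⟨N, fun n hn => ⟨by linarith [hN n hn], fun t ht => ?_⟩⟩
  linarith [hN n hn, (h.abs_re_ray ht n).2]

theorem Orbit.abs_im_le (h : D.Orbit s z) {k : ℕ} {y : ℝ} (hy : |((s k).1 : ℝ)| ≤ y) :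
    |((E a b)^[k] z).im| ≤ 7 * y + D.C := by
  have hpi := Real.pi_lt_d2
  have h4 := D.im_bound _ _ (h k).1
  have h6 := abs_sub_abs_le_abs_sub ((E a b)^[k] z).im (2 * Real.pi * (s k).1)
  rw [abs_mul, abs_of_pos (by positivity : 0 < 2 * Real.pi)] at h6
  have h7 : 2 * Real.pi * |((s k).1 : ℝ)| ≤ 7 * y :=
    mul_le_mul (by linarith) hy (abs_nonneg _) (by norm_num)
  linarith

theorem Orbit.dominate (h : D.Orbit s z) {t : ℝ} (ht : 0 ≤ t) {n : ℕ}
    (hs : ∀ k ≥ n, |((s k).1 : ℝ)| ≤ F^[k] t) (hn : F^[n] t + D.gap ≤ |((E a b)^[n] z).re|)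
    (k : ℕ) : F^[k + n] t + D.gap ≤ |((E a b)^[k + n] z).re| := by
  have hM := D.M_ge
  have hC := D.C_pos
  have hF0 : ∀ k, 0 ≤ F^[k] t := fun k => F_iterate_nonneg k ht
  have hFexp : ∀ k, F^[k + 1 + n] t ≤ Real.exp (F^[k + n] t) := fun k => by
    rw [add_right_comm, Function.iterate_succ_apply']; unfold F; linarith
  have := StripData.dominate D (X := fun k => F^[k + n] t) (y := (E a b)^[n] z) (fun k => hF0 _)
    (fun k => ?_) (fun k => ?_) (by simpa only [zero_add] using hn) k
  · rwa [← Function.iterate_add_apply] at this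
  · exact (hFexp k).trans (le_mul_of_one_le_left (Real.exp_pos _).le (by linarith))
  · rw [← Function.iterate_add_apply]
    have h5 := h.abs_im_le (hs (k + 1 + n) (by omega))
    have h6 : 7 * F^[k + 1 + n] t ≤ D.M * Real.exp (F^[k + n] t) :=
      mul_le_mul hM (hFexp k) (hF0 _) (by linarith)
    linarith

theorem FarOrbit.exists_onRay (h : D.FarOrbit s z) (hfast : ¬ D.SlowOrbit s z) :
    ∃ n t, OnRay D.start D.ray (CosineFamily.shift n s) t ((E a b)^[n] z) := by
  have hs := h.orbit.expBounded
  obtain ⟨t₁, ht₁, hfreq⟩ : ∃ t > minPot s, ∃ᶠ n in atTop, F^[n] t < |((E a b)^[n] z).re| := by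
    by_contra! hno
    refine hfast ⟨h, fun t ht => ?_⟩
    have := hno t ht
    simpa [Filter.Frequently] using this
  -- `t₂` bounds the address eventually, while the orbit exceeds `F^[n] t₁` infinitely often; at a
  -- late such time the difference between the two is at least `gap`, and the domination starts.
  set t₂ := (minPot s + t₁) / 2 with ht₂
  have h0 : 0 ≤ minPot s := minPot_nonneg s
  have h1 : minPot s < t₂ := by linarith
  have h2 : t₂ < t₁ := by linarith
  have h3 := tendsto_F_iterate_sub (h0.trans h1.le) h2
  obtain ⟨N, hN⟩ := (eventually_abs_le hs h1).exists_forall_of_atTop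
  obtain ⟨n, hn1, hn2, hn3⟩ := (hfreq.and_eventually ((h3.eventually_ge_atTop D.gap).and
    (eventually_ge_atTop N))).exists
  have hM := D.M_ge
  have hpi := Real.pi_lt_d2
  have hC := D.C_pos
  have hg := D.gap_pos
  have hCg := D.C_le_gap
  obtain ⟨hr, -, hfar⟩ := D.far_sub_slack
  have hsl := D.loss_pos.trans_le D.loss_le_slack
  have hT := D.threshold_pos
  have him : ∀ k, |((E a b)^[k + n] z).im| ≤ 7 * F^[k + n] t₂ + D.C := fun k =>
    h.orbit.abs_im_le (hN (k + n) (by omega))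
  have hdom := h.orbit.dominate (h0.trans h1.le) (n := n) (fun k hk => hN k (by omega))
    (by linarith)
  have hgap := D.gap_spec (x := D.gap) le_rfl
  -- `9M` is the constant comparing `exp |Re|` with the next real part; the additional factor `2`
  -- absorbs the subtraction of `gap` in the shadowing condition.
  have hgap18 : 18 * D.M ≤ Real.exp D.gap := by
    nlinarith [mul_pos (by linarith : 0 < D.M) hC, mul_pos (by linarith : 0 < D.M) hg]
  have hgapM : D.M + D.gap + 1 ≤ Real.exp D.gap := by
    nlinarith [mul_pos (by linarith : 0 < D.M) hC]
  have hshadow := exists_shadow (x := fun k => |((E a b)^[k + n] z).re|) (c := D.gap) hg.le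
    (fun k => by linarith [h.far (k + n)]) (fun k => ?_) (fun k => ?_)
  · obtain ⟨t, ht⟩ := hshadow
    have hsn := hs.shift n
    have htF : F^[n] t₂ ≤ t := by
      have h4 := (ht 0).1
      have h5 := hdom 0
      simp only [zero_add, Function.iterate_zero, id] at h4 h5
      linarith
    have hmin : minPot (CosineFamily.shift n s) < t := by
      rw [minPot_shift hs]; exact (F_iterate_strictMono n h1).trans_le htF
    have htT : D.threshold < t := by
      have h4 := (ht 0).1
      have h5 := h.far n
      simp only [zero_add, Function.iterate_zero, id] at h4
      linarith
    have hstart : D.start (CosineFamily.shift n s) < t :=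
      (start_le (le_max_left _ _) (D.isCurve_tail hsn (le_max_right _ _) (le_max_left _ _))).trans_lt
        (max_lt hmin htT)
    refine ⟨n, t, hmin, hstart, ?_⟩
    rw [(isCurve_ray hsn).eq_tail hstart htT.le]
    obtain ⟨h6, -, B, h7⟩ := D.tail_spec hsn htT.le hmin
    refine D.eq_of_model (B := D.gap + D.C) (h.orbit.shift n) h6 (fun k => ?_) h7
    refine (Complex.norm_le_abs_re_add_abs_im _).trans ?_
    have h8 := (h.orbit.shift n) k
    have h9 := D.im_bound _ _ h8.1
    have h10 := D.sign_mul_re h8.1 h8.2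
    have h11 := ht k
    rw [Complex.sub_re, Complex.sub_im, model_re, model_im]
    rw [← Function.iterate_add_apply] at h9 h10 ⊢
    have h12 : |((E a b)^[k + n] z).re - (CosineFamily.shift n s k).2.sign * F^[k] t| ≤ D.gap := by
      obtain ⟨h13, h14⟩ := h11
      rw [← h10] at h13 h14
      rcases (CosineFamily.shift n s k).2.sign_cases with h | h <;> rw [h] at h13 h14 ⊢ <;>
        rw [abs_le] <;> constructor <;> linarith
    linarith
  · have h4 := (Complex.abs_re_le_norm _).trans (D.norm_succ_le z (k + n))
    rw [add_right_comm] at h4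
    set x := |((E a b)^[k + n] z).re|
    have h5 : 1 ≤ Real.exp x := Real.one_le_exp (abs_nonneg _)
    unfold F
    rw [Real.exp_add]
    nlinarith
  · have h4 := D.exp_le_norm_succ (z := z) (n := k + n) (by linarith [h.far (k + n)])
    rw [add_right_comm] at h4
    have h5 := Complex.norm_le_abs_re_add_abs_im ((E a b)^[k + 1 + n] z)
    have h6 := him (k + 1)
    have h7 := hdom (k + 1)
    have h8 := h.far (k + 1 + n)
    set x := |((E a b)^[k + n] z).re|
    set x' := |((E a b)^[k + 1 + n] z).re|
    -- Domination bounds the imaginary part by a multiple of the real part, so the modulus is at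
    -- most `9 x'`.
    have h9 : Real.exp x ≤ 9 * D.M * x' := by
      refine h4.trans ?_
      rw [mul_comm 9 D.M, mul_assoc]
      exact mul_le_mul_of_nonneg_left (by linarith) (by linarith)
    have h10 : Real.exp x = Real.exp (x - D.gap) * Real.exp D.gap := by
      rw [← Real.exp_add]; congr 1; ring
    have h11 : Real.exp (x - D.gap) * (18 * D.M) ≤ 9 * D.M * x' := by
      refine le_trans ?_ h9
      rw [h10]
      exact mul_le_mul_of_nonneg_left hgap18 (Real.exp_pos _).le
    have h12 : 2 * Real.exp (x - D.gap) ≤ x' := by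
      refine le_of_mul_le_mul_left ?_ (by linarith : 0 < 9 * D.M)
      linarith
    unfold F
    linarith

variable (D) in
/-- Every escaping orbit eventually reaches a ray or the landing point of a ray. -/
theorem exists_iterate_onClosedRay {w : ℂ} (hw : IsEscaping a b w) :
    ∃ n s t, ExpBounded s ∧ OnClosedRay a b D.start D.ray s t ((E a b)^[n] w) := by
  obtain ⟨n, s, h⟩ := D.exists_farOrbit hw
  by_cases hslow : D.SlowOrbit s ((E a b)^[n] w)
  · exact ⟨n, s, minPot s, h.orbit.expBounded, Or.inr ⟨rfl, hslow.landsUniformly (hw.iterate n)⟩⟩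
  · obtain ⟨m, t, h1⟩ := h.exists_onRay hslow
    rw [← Function.iterate_add_apply] at h1
    exact ⟨m + n, _, t, h.orbit.expBounded.shift m, Or.inl h1⟩

end StripData

end

/-! ### Uniqueness, pull-back to the given point, exceptional points -/

section

theorem exists_injOn_iterate {a b : ℂ} (ha : a ≠ 0) (hb : b ≠ 0) (n : ℕ) {z : ℂ}
    (h : ∀ m, 1 ≤ m → (E a b)^[m] z ≠ v₁ a b ∧ (E a b)^[m] z ≠ v₂ a b) :
    ∃ U ∈ 𝓝 z, InjOn (E a b)^[n] U := by
  induction n generalizing z with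
  | zero => exact ⟨univ, univ_mem, injOn_id _⟩
  | succ n ih =>
    obtain ⟨V, hV, h1⟩ := ih (z := E a b z) fun m _ => by
      rw [← Function.iterate_succ_apply]; exact h (m + 1) (by omega)
    obtain ⟨U, hU, hz, h2⟩ := exists_open_injOn ha hb (h 1 le_rfl).1 (h 1 le_rfl).2
    refine ⟨U ∩ E a b ⁻¹' V, inter_mem (hU.mem_nhds hz)
      ((continuous_E a b).continuousAt.preimage_mem_nhds hV), ?_⟩
    rw [Function.iterate_succ]
    exact h1.comp (h2.mono inter_subset_left) fun x hx => hx.2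

namespace StripData

variable {a b : ℂ} {R : Symb → Set ℂ} {D : StripData a b R} {s s' : Address} {t t' : ℝ} {w : ℂ}
include D

/-- Once the shifted addresses agree, both rays lift the same curve. As they meet, they agree on
their common domain, hence on tails, which determine the address. -/
theorem eq_of_shift_eq_of_ray_eq (n : ℕ) (hs : ExpBounded s) (hs' : ExpBounded s')
    (ht : D.start s < t) (ht' : D.start s' < t) (h : D.ray s t = D.ray s' t)
    (hn : shift n s = shift n s') : s = s' := by
  induction n generalizing s s' t with
  | zero => exact hn
  | succ n ih =>
    obtain ⟨h1, h2⟩ := ray_functional hs ht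
    obtain ⟨h1', h2'⟩ := ray_functional hs' ht'
    have h3 : shift 1 s = shift 1 s' := ih (hs.shift 1) (hs'.shift 1) h1 h1'
      (by rw [← h2, ← h2', h]) (by rw [← shift_succ, ← shift_succ, hn])
    have hc := (isCurve_ray (D := D) hs).mono (le_max_left _ (D.start s'))
    have hc' := (isCurve_ray (D := D) hs').mono (le_max_right (D.start s) _)
    have hmax : max (D.start s) (D.start s') < t := max_lt ht ht'
    have h4 : EqOn (D.ray s) (D.ray s') (Ioi (max (D.start s) (D.start s'))) := by
      refine lift_unique D.ha D.hb isPreconnected_Ioi hc.cont hc'.cont (fun u hu => ?_)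
        (fun u hu => hc.noncrit_one hu) hmax h
      have hu' : max (D.start s) (D.start s') < u := hu
      rw [(ray_functional hs ((le_max_left _ _).trans_lt hu')).2,
        (ray_functional hs' ((le_max_right _ _).trans_lt hu')).2, h3]
    have h5 : t < max t D.threshold + 1 := by linarith [le_max_left t D.threshold]
    have h6 : D.threshold ≤ max t D.threshold + 1 := by linarith [le_max_right t D.threshold]
    have h7 := h4 (hmax.trans h5)
    rw [hc.eq_tail (hmax.trans h5) h6, hc'.eq_tail (hmax.trans h5) h6] at h7
    exact (D.tail_injective hs hs' h6 h6 ((minPot_le_start hs).trans_lt (ht.trans h5))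
      ((minPot_le_start hs').trans_lt (ht'.trans h5)) h7).1

/-- Different rays are disjoint. -/
theorem ray_injective (hs : ExpBounded s) (hs' : ExpBounded s') (ht : D.start s < t)
    (ht' : D.start s' < t') (h : D.ray s t = D.ray s' t') : s = s' ∧ t = t' := by
  obtain ⟨n, hn, rfl⟩ := ray_eq_ray hs hs' ht ht' h
  exact ⟨eq_of_shift_eq_of_ray_eq n hs hs' ht ht' h hn, rfl⟩

theorem landsUniformly_shift_one (hs : ExpBounded s)
    (h : LandsUniformly a b D.start D.ray s w) :
    LandsUniformly a b D.start D.ray (shift 1 s) (E a b w) := by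
  obtain ⟨h1, h2, h3, h4⟩ := h
  have hmin := minPot_shift_one hs
  have h0 := minPot_nonneg s
  have hF : ∀ u > F (minPot s), F (Finv u) = u := fun u hu =>
    F_Finv (by linarith [le_F (minPot s)])
  have hray : ∀ u > F (minPot s), D.ray (shift 1 s) u = E a b (D.ray s (Finv u)) := fun u hu => by
    rw [(ray_functional hs (by rw [h1]; exact Finv_gt h0 hu)).2, hF u hu]
  refine ⟨le_antisymm ?_ (minPot_le_start (hs.shift 1)), h2.iterate 1, ?_, fun r => ?_⟩
  · rw [hmin]
    refine start_le hmin.le ((isCurve_ray (D := D) hs).push (start_nonneg hs) |>.mono ?_)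
    rw [h1]
  · rw [hmin]
    have h5 : Tendsto Finv (𝓝[>] F (minPot s)) (𝓝[>] minPot s) := by
      refine tendsto_nhdsWithin_iff.2 ⟨?_, ?_⟩
      · have h6 := continuousOn_Finv.continuousAt (x := F (minPot s))
          (Ioi_mem_nhds (by linarith [le_F (minPot s)]))
        have h7 := h6.tendsto
        rw [Finv_F] at h7
        exact h7.mono_left nhdsWithin_le_nhds
      · filter_upwards [self_mem_nhdsWithin] with u hu using Finv_gt h0 hu
    refine (((continuous_E a b).tendsto w).comp (h3.comp h5)).congr' ?_
    filter_upwards [self_mem_nhdsWithin] with u hu using (hray u hu).symm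
  · obtain ⟨N, hN⟩ := h4 r
    refine ⟨N, fun n hn => ⟨?_, fun u hu => ?_⟩⟩
    · rw [← Function.iterate_succ_apply]; exact (hN (n + 1) (by omega)).1
    · rw [hmin] at hu
      rw [hray u hu, ← Function.iterate_succ_apply]
      exact (hN (n + 1) (by omega)).2 _ (Finv_gt h0 hu)

theorem landsUniformly_shift (n : ℕ) (hs : ExpBounded s)
    (h : LandsUniformly a b D.start D.ray s w) :
    LandsUniformly a b D.start D.ray (shift n s) ((E a b)^[n] w) := by
  induction n generalizing s w with
  | zero => exact h
  | succ n ih =>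
    rw [shift_succ]
    exact ih (hs.shift 1) (landsUniformly_shift_one hs h)

/-- By uniform escape the late images of the connected ray avoid the slit, so each lies in a single
strip, that of its tail. The landing point belongs to it as well, since its next image is off the
slit. -/
theorem exists_farOrbit_of_lands (hs : ExpBounded s)
    (h : LandsUniformly a b D.start D.ray s w) :
    ∃ N, D.FarOrbit (shift N s) ((E a b)^[N] w) ∧
      ∀ t > minPot s, D.Orbit (shift N s) ((E a b)^[N] (D.ray s t)) := by
  obtain ⟨h1, h2, h3, h4⟩ := h
  obtain ⟨N, hN⟩ := h4 (max D.far D.r)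
  have hr := le_max_right D.far D.r
  have hcont : ContinuousOn (D.ray s) (Ioi (minPot s)) := by
    rw [← h1]; exact (isCurve_ray hs).cont
  have hray : ∀ n ≥ N, ∀ t > minPot s, (E a b)^[n] (D.ray s t) ∈ R (s n) := by
    intro n hn t ht
    set u := max (minPot s) D.threshold + 1
    have hu : minPot s < u := by linarith [le_max_left (minPot s) D.threshold]
    have hu' : D.threshold ≤ u := by linarith [le_max_right (minPot s) D.threshold]
    refine D.subset_of_isPreconnected (T := (fun t => (E a b)^[n] (D.ray s t)) '' Ioi (minPot s))
      (isPreconnected_Ioi.image _ (((continuous_E a b).iterate n).comp_continuousOn hcont)) ?_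
      (z := (E a b)^[n] (D.ray s u)) ⟨u, hu, rfl⟩ ?_ ⟨t, ht, rfl⟩
    · rintro _ ⟨x, hx, rfl⟩
      rw [← Function.iterate_succ_apply' (E a b)]
      exact D.not_mem_slit (hr.trans ((hN (n + 1) (by omega)).2 x hx).le)
    · rw [(isCurve_ray hs).eq_tail (by rwa [h1]) hu']
      exact ((D.tail_spec hs hu' hu).1 n).1
  refine ⟨N, ⟨fun k => ?_, fun k => ?_⟩, fun t ht k => ?_⟩
  · rw [← Function.iterate_add_apply]
    refine ⟨D.mem_of_tendsto (l := 𝓝[>] minPot s)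
      ((((continuous_E a b).iterate (k + N)).tendsto w).comp h3) ?_ ?_,
      hr.trans (hN (k + N) (by omega)).1.le⟩
    · filter_upwards [self_mem_nhdsWithin] with t ht using hray (k + N) (by omega) t ht
    · rw [← Function.iterate_succ_apply' (E a b)]
      exact D.not_mem_slit (hr.trans (hN _ (by omega)).1.le)
  · rw [← Function.iterate_add_apply]
    exact (le_max_left _ _).trans (hN (k + N) (by omega)).1.le
  · rw [← Function.iterate_add_apply]
    exact ⟨hray (k + N) (by omega) t ht, hr.trans ((hN (k + N) (by omega)).2 t ht).le⟩

/-- Landing points escape more slowly than all points on their rays. -/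
theorem exists_slowOrbit_of_lands (hs : ExpBounded s)
    (h : LandsUniformly a b D.start D.ray s w) :
    ∃ N, D.SlowOrbit (shift N s) ((E a b)^[N] w) := by
  obtain ⟨N, hfar, horb⟩ := exists_farOrbit_of_lands hs h
  refine ⟨N, hfar, fun t₁ ht₁ => ?_⟩
  have hsN := hs.shift N
  obtain ⟨h1, -, h3, -⟩ := landsUniformly_shift N hs h
  by_contra hno
  rw [not_eventually] at hno
  set t₂ := (minPot (shift N s) + t₁) / 2 with ht₂
  have h0 : 0 ≤ minPot (shift N s) := minPot_nonneg _
  have h4 : minPot (shift N s) < t₂ := by linarith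
  have h5 : t₂ < t₁ := by linarith
  have hg := D.gap_pos
  obtain ⟨K, hK⟩ := (eventually_abs_le hsN h4).exists_forall_of_atTop
  obtain ⟨n, hn1, hn2, hn3⟩ := (hno.and_eventually (((tendsto_F_iterate_sub (h0.trans h4.le)
    h5).eventually_ge_atTop D.gap).and (eventually_ge_atTop K))).exists
  have h6 : F^[n] t₂ + D.gap < |((E a b)^[n] ((E a b)^[N] w)).re| := by linarith
  have h7 : ContinuousAt (fun x => |((E a b)^[n] x).re|) ((E a b)^[N] w) := by
    have := ((continuous_E a b).iterate n)
    fun_prop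
  -- Exceeding `F^[n] t₂ + gap` is an open condition: it passes from the landing point to ray points
  -- of potential below `t₂`, where persistent domination contradicts the asymptotics.
  have h8 := (h7.tendsto.comp h3).eventually (lt_mem_nhds h6)
  obtain ⟨t, h9, ht1, ht2⟩ := (h8.and (Ioo_mem_nhdsGT h4)).exists
  simp only [Function.comp_apply] at h9
  have hor : D.Orbit (shift N s) (D.ray (shift N s) t) := by
    rw [minPot_shift hs] at ht1
    obtain ⟨x, rfl⟩ := exists_F_iterate_eq N
      ((F_iterate_nonneg N (minPot_nonneg s)).trans ht1.le)
    have hx := (F_iterate_strictMono N).lt_iff_lt.1 ht1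
    rw [← (ray_functional_iterate hs (by rwa [h.1]) N).2]
    exact horb x hx
  refine not_dominated hsN (by rwa [h1]) (F_iterate_strictMono n ht2) fun k => ?_
  have := hor.dominate (h0.trans h4.le) (n := n) (fun k hk => hK k (by omega)) h9.le k
  rw [← Function.iterate_add_apply, ← Function.iterate_add_apply]
  linarith

/-- A ray point follows its potential `t'` up to a bounded error. The addresses agree from some time
on, hence so do the minimal potentials, and a slow orbit falls below every potential between these
and `t'`. -/
theorem SlowOrbit.ne_ray {z : ℂ} (h : D.SlowOrbit s z) (hs' : ExpBounded s')
    (ht' : D.start s' < t') : z ≠ D.ray s' t' := by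
  rintro rfl
  obtain ⟨B, N, h1⟩ := ray_model hs' ht'
  have hs := h.orbit.expBounded
  have hss : CosineFamily.shift N s = CosineFamily.shift N s' := funext fun k =>
    D.label_unique (h.orbit (k + N)).1 (h1 (k + N) (by omega)).2
  have hmin : minPot s = minPot s' := by
    have := minPot_shift hs N
    rw [hss, minPot_shift hs'] at this
    exact ((F_iterate_strictMono N).injective this).symm
  have h2 : minPot s < t' := by rw [hmin]; exact (minPot_le_start hs').trans_lt ht'
  have h3 : minPot s < (minPot s + t') / 2 := by linarith
  have h4 : (minPot s + t') / 2 < t' := by linarith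
  obtain ⟨B', N', h5⟩ := ray_abs_re hs' ht'
  obtain ⟨n, hn1, hn2, hn3⟩ := ((h.slow _ h3).and (((tendsto_F_iterate_sub
    ((minPot_nonneg s).trans h3.le) h4).eventually_gt_atTop B').and
    (eventually_ge_atTop N'))).exists
  have := (abs_le.1 (h5 n hn3)).1
  linarith

/-- Landing points are not on rays. -/
theorem iterate_ne_ray_of_lands (hs : ExpBounded s)
    (h : LandsUniformly a b D.start D.ray s w) (n : ℕ) (hs' : ExpBounded s')
    (ht' : D.start s' < t') : (E a b)^[n] w ≠ D.ray s' t' := by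
  intro heq
  obtain ⟨N, hN⟩ := exists_slowOrbit_of_lands (hs.shift n) (landsUniformly_shift n hs h)
  refine hN.ne_ray (hs'.shift N) (ray_functional_iterate hs' ht' N).1 ?_
  rw [heq]
  exact (ray_functional_iterate hs' ht' N).2

/-- The late entries of both addresses are those of `w`, so a high iterate maps the two rays to one.
That iterate is injective near `w`, where both rays end, so they meet. -/
theorem eq_of_lands (hs : ExpBounded s) (hs' : ExpBounded s')
    (h : LandsUniformly a b D.start D.ray s w) (h' : LandsUniformly a b D.start D.ray s' w)
    (hw : ∀ m, 1 ≤ m → (E a b)^[m] w ≠ v₁ a b ∧ (E a b)^[m] w ≠ v₂ a b) : s = s' := by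
  obtain ⟨N, h1, -⟩ := exists_farOrbit_of_lands hs h
  obtain ⟨N', h1', -⟩ := exists_farOrbit_of_lands hs' h'
  have hss : shift (N' + N) s = shift (N' + N) s' := funext fun k => by
    have h2 := (h1.orbit (k + N')).1
    have h3 := (h1'.orbit (k + N)).1
    rw [← Function.iterate_add_apply, shift_apply] at h2 h3
    rw [shift_apply, shift_apply]
    rw [add_right_comm] at h3
    rw [← add_assoc]
    exact (D.label_unique h2 (by rwa [add_right_comm] at h3 ⊢))
  have hmin : minPot s = minPot s' := by
    have := minPot_shift hs (N' + N)
    rw [hss, minPot_shift hs'] at this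
    exact ((F_iterate_strictMono _).injective this).symm
  obtain ⟨U, hU, hinj⟩ := exists_injOn_iterate D.ha D.hb (N' + N) hw
  have h4' := h'.2.2.1
  rw [← hmin] at h4'
  obtain ⟨t, ⟨h5, h6⟩, ht⟩ := (((h.2.2.1.eventually_mem hU).and (h4'.eventually_mem hU)).and
    self_mem_nhdsWithin).exists
  have ht1 : D.start s < t := by rw [h.1]; exact ht
  have ht2 : D.start s' < t := by rw [h'.1, ← hmin]; exact ht
  refine (ray_injective hs hs' ht1 ht2 (hinj h5 h6 ?_)).1
  rw [(ray_functional_iterate hs ht1 _).2, (ray_functional_iterate hs' ht2 _).2, hss]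

theorem ray_noncrit (hs : ExpBounded s) (ht : D.start s < t) {n : ℕ} (hn : 1 ≤ n) :
    (E a b)^[n] (D.ray s t) ≠ v₁ a b ∧ (E a b)^[n] (D.ray s t) ≠ v₂ a b := by
  obtain ⟨m, rfl⟩ : ∃ m, n = m + 1 := ⟨n - 1, by omega⟩
  exact (isCurve_ray hs).noncrit t ht m

/-- Rays and their landing points can be pulled back along branches of `E⁻¹` unless the ray
passes through a critical value. -/
theorem exists_prepend_tendsto (hs : ExpBounded s) (hst : minPot s ≤ F t) (hstart : D.start s ≤ F t)
    {z : ℂ} (h : Tendsto (D.ray s) (𝓝[>] F t) (𝓝 (E a b z)))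
    (hz : E a b z ≠ v₁ a b ∧ E a b z ≠ v₂ a b)
    (hcrit : ∀ u > F t, D.ray s u ≠ v₁ a b ∧ D.ray s u ≠ v₂ a b) :
    ∃ j, minPot (prepend j s) ≤ t ∧ D.start (prepend j s) ≤ t ∧
      Tendsto (D.ray (prepend j s)) (𝓝[>] t) (𝓝 z) := by
  classical
  have hc := (isCurve_ray (D := D) hs).mono hstart
  have h1 : ContinuousOn (Function.update (D.ray s) (F t) (E a b z)) (Ici (F t)) := by
    rw [continuousOn_update_iff, Ici_sdiff_left]
    exact ⟨hc.cont, fun _ => h⟩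
  -- Up to the potential `t` the curve is continued by the constant `E z`, so that it can be lifted
  -- across its end point with the value `z` at `t`.
  set Γ : ℝ → ℂ := fun u => Function.update (D.ray s) (F t) (E a b z) (max (F u) (F t))
  have hΓc : Continuous Γ := by
    have h2 : Continuous fun u => max (F u) (F t) := continuous_F.max continuous_const
    exact h1.comp_continuous h2 fun u => mem_Ici.2 (le_max_right _ _)
  have hΓ1 : ∀ u > t, Γ u = D.ray s (F u) := fun u hu => by
    have h2 : F t < F u := F_strictMono hu
    simp only [Γ]
    rw [max_eq_left h2.le, Function.update_of_ne h2.ne']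
  have hΓ2 : ∀ u ≤ t, Γ u = E a b z := fun u hu => by
    simp only [Γ]
    rw [max_eq_right (F_strictMono.monotone hu), Function.update_self]
  obtain ⟨δ, hδ1, hδ2, hδ3⟩ := exists_lift D.ha D.hb (τ := t - 1) hΓc.continuousOn
    (fun u _ => by
      rcases le_or_gt u t with hu | hu
      · rw [hΓ2 u hu]; exact hz
      · rw [hΓ1 u hu]; exact hcrit _ (F_strictMono hu)) (sub_one_lt t) (hΓ2 t le_rfl).symm
  obtain ⟨j, hj⟩ := exists_isCurve_prepend hs hst hc hcrit
    (hδ1.mono (Ioi_subset_Ioi (by linarith))) fun u hu => by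
      rw [hδ2 u (by linarith), hΓ1 u hu]
  have hmin : minPot (prepend j s) ≤ t := by
    have := minPot_shift_one (expBounded_prepend j hs)
    rw [shift_prepend] at this
    rw [this] at hst
    exact F_strictMono.le_iff_le.1 hst
  refine ⟨j, hmin, start_le hmin hj, ?_⟩
  have h3 := (hδ1.continuousAt (Ioi_mem_nhds (sub_one_lt t))).tendsto
  rw [hδ3] at h3
  refine (h3.mono_left nhdsWithin_le_nhds).congr' ?_
  filter_upwards [self_mem_nhdsWithin] with u hu using (ray_eq hmin hj hu).symm

theorem exists_prepend_onClosedRay (hs : ExpBounded s) {z : ℂ}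
    (h : OnClosedRay a b D.start D.ray s t (E a b z))
    (hcrit : ∀ u ≥ t, ∀ v, v = v₁ a b ∨ v = v₂ a b → ¬ OnClosedRay a b D.start D.ray s u v) :
    ∃ s' t', ExpBounded s' ∧ OnClosedRay a b D.start D.ray s' t' z := by
  have ht0 : 0 ≤ t := by
    rcases h with h | h
    · exact (minPot_nonneg s).trans h.1.le
    · rw [h.1]; exact minPot_nonneg s
  obtain ⟨x, rfl⟩ : ∃ x, F x = t := ⟨Finv t, F_Finv (by linarith)⟩
  have hstart : D.start s ≤ F x := by
    rcases h with h | h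
    · exact h.2.1.le
    · rw [h.1, h.2.1]
  have hray : ∀ u > F x, D.ray s u ≠ v₁ a b ∧ D.ray s u ≠ v₂ a b := fun u hu => by
    have h1 : OnClosedRay a b D.start D.ray s u (D.ray s u) :=
      Or.inl ⟨(minPot_le_start hs).trans_lt (hstart.trans_lt hu), hstart.trans_lt hu, rfl⟩
    exact ⟨fun h2 => hcrit u hu.le _ (Or.inl h2) h1, fun h2 => hcrit u hu.le _ (Or.inr h2) h1⟩
  have hz : E a b z ≠ v₁ a b ∧ E a b z ≠ v₂ a b :=
    ⟨fun h2 => hcrit _ le_rfl _ (Or.inl h2) h, fun h2 => hcrit _ le_rfl _ (Or.inr h2) h⟩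
  have htend : Tendsto (D.ray s) (𝓝[>] F x) (𝓝 (E a b z)) := by
    rcases h with h | h
    · rw [h.2.2]
      exact (((isCurve_ray hs).cont.continuousAt (Ioi_mem_nhds h.2.1)).tendsto).mono_left
        nhdsWithin_le_nhds
    · rw [h.1]; exact h.2.2.2.1
  obtain ⟨j, h1, h2, h3⟩ := exists_prepend_tendsto hs ((minPot_le_start hs).trans hstart) hstart
    htend hz hray
  have hsj := expBounded_prepend j hs
  have hmin := minPot_shift_one hsj
  rw [shift_prepend] at hmin
  refine ⟨prepend j s, x, hsj, ?_⟩
  rcases h with h | h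
  · have h4 : minPot (prepend j s) < x := by
      have := h.1
      rw [hmin] at this
      exact F_strictMono.lt_iff_lt.1 this
    have h5 : D.start (prepend j s) < x := by
      refine exists_isCurve_below hsj h4 (by rw [shift_prepend]; exact h.2.1) fun u hu => ?_
      rw [shift_prepend]
      rcases eq_or_lt_of_le hu with h6 | h6
      · rw [← h6, ← h.2.2]; exact hz
      · exact hray u h6
    refine Or.inl ⟨h4, h5, tendsto_nhds_unique h3 ?_⟩
    exact (((isCurve_ray hsj).cont.continuousAt (Ioi_mem_nhds h5)).tendsto).mono_left
        nhdsWithin_le_nhds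
  · obtain ⟨h4, h5, h6, -, h7⟩ := h
    have h8 : x = minPot (prepend j s) := F_strictMono.injective (by rw [h4, hmin])
    rw [h8] at h2 h3
    have h9 := le_antisymm h2 (minPot_le_start hsj)
    refine Or.inr ⟨h8, h9, IsEscaping.of_iterate (n := 1) h6, h3, fun r => ?_⟩
    obtain ⟨N, hN⟩ := h7 r
    refine ⟨N + 1, fun n hn => ?_⟩
    obtain ⟨m, rfl⟩ : ∃ m, n = m + 1 := ⟨n - 1, by omega⟩
    obtain ⟨h10, h11⟩ := hN m (by omega)
    refine ⟨h10, fun u hu => ?_⟩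
    rw [Function.iterate_succ_apply, (ray_functional hsj (by rwa [h9])).2, shift_prepend]
    exact h11 _ (by rw [hmin]; exact F_strictMono hu)

theorem exists_onClosedRay (hw : IsEscaping a b w)
    (hne : ¬ IsExceptional a b D.start D.ray w) :
    ∃ s t, ExpBounded s ∧ OnClosedRay a b D.start D.ray s t w := by
  obtain ⟨n, s, t, hs, h⟩ := D.exists_iterate_onClosedRay hw
  clear hw
  induction n generalizing w s t with
  | zero => exact ⟨s, t, hs, h⟩
  | succ n ih =>
    obtain ⟨s', t', hs', h'⟩ := ih (w := E a b w) (fun ⟨s, t, t', v, m, h1, h2, h3, _, h5, h6⟩ =>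
      hne ⟨s, t, t', v, m + 1, h1, h2, h3, by omega, h5, h6⟩) s t hs h
    -- A critical value at or above the potential of `E w` would make `w` exceptional with `n = 1`.
    exact exists_prepend_onClosedRay hs' h' fun u hu v hv huv =>
      hne ⟨s', u, t', v, 1, hs', hv, huv, le_rfl, h', hu⟩

theorem noncrit_of_lands (hs : ExpBounded s) (h : LandsUniformly a b D.start D.ray s w)
    (hne : ¬ IsExceptional a b D.start D.ray w) (m : ℕ) (hm : 1 ≤ m) :
    (E a b)^[m] w ≠ v₁ a b ∧ (E a b)^[m] w ≠ v₂ a b := by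
  rw [← not_or]
  intro hv
  have h1 : OnClosedRay a b D.start D.ray (shift m s) (minPot (shift m s)) ((E a b)^[m] w) :=
    Or.inr ⟨rfl, landsUniformly_shift m hs h⟩
  exact hne ⟨shift m s, _, _, _, m, hs.shift m, hv, h1, hm, h1, le_rfl⟩

theorem onClosedRay_unique (hs : ExpBounded s) (hs' : ExpBounded s')
    (hne : ¬ IsExceptional a b D.start D.ray w) (h : OnClosedRay a b D.start D.ray s t w)
    (h' : OnClosedRay a b D.start D.ray s' t' w) : s = s' ∧ t = t' := by
  rcases h with h | h <;> rcases h' with h' | h'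
  · exact ray_injective hs hs' h.2.1 h'.2.1 (h.2.2.symm.trans h'.2.2)
  · exact (iterate_ne_ray_of_lands hs' h'.2 0 hs h.2.1 h.2.2).elim
  · exact (iterate_ne_ray_of_lands hs h.2 0 hs' h'.2.1 h'.2.2).elim
  · obtain rfl := eq_of_lands hs hs' h.2 h'.2 (noncrit_of_lands hs h.2 hne)
    exact ⟨rfl, h.1.trans h'.1.symm⟩

/-- On a ray through `w`, the potential `x` with `F^[n] x` equal to that of the critical value is at
least the potential of `w`. So the ray would contain a preimage of a critical value under `E^[n]`.
-/
theorem not_onRay_of_isExceptional (hw : IsExceptional a b D.start D.ray w) (hs : ExpBounded s) :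
    ¬ OnRay D.start D.ray s t w := by
  rintro ⟨-, ht, rfl⟩
  obtain ⟨s', u, u', v, n, hs', hv, hu, hn, hu', hle⟩ := hw
  obtain ⟨h1, h2⟩ := ray_functional_iterate hs ht n
  rcases hu' with hu' | hu'
  · obtain ⟨rfl, rfl⟩ := ray_injective (hs.shift n) hs' h1 hu'.2.1 (h2.symm.trans hu'.2.2)
    rcases hu with hu | hu
    · obtain ⟨x, rfl⟩ := exists_F_iterate_eq n ((start_nonneg hs').trans hu.2.1.le)
      have hx : D.start s < x := ht.trans_le ((F_iterate_strictMono n).le_iff_le.1 hle)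
      have h3 := ray_noncrit (D := D) hs hx hn
      rw [(ray_functional_iterate hs hx n).2, ← hu.2.2] at h3
      exact hv.elim h3.1 h3.2
    · exact absurd (hu.1 ▸ hle) (not_le.2 hu'.1)
  · exact iterate_ne_ray_of_lands hs' hu'.2 0 (hs.shift n) h1 h2

/-- As for points on rays, with `eq_of_lands` in place of `ray_injective`. That lemma needs a
forward orbit without critical values, which explains the exception. -/
theorem exists_iterate_critical_of_lands (hw : IsExceptional a b D.start D.ray w)
    (hs : ExpBounded s) (h : LandsUniformly a b D.start D.ray s w) :
    ∃ m : ℕ, 1 ≤ m ∧ ((E a b)^[m] w = v₁ a b ∨ (E a b)^[m] w = v₂ a b) := by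
  by_contra! hno
  obtain ⟨s', u, u', v, n, hs', hv, hu, hn, hu', hle⟩ := hw
  rcases hu' with hu' | hu'
  · exact iterate_ne_ray_of_lands hs h n hs' hu'.2.1 hu'.2.2
  · have h1 := landsUniformly_shift n hs h
    have h2 : shift n s = s' := eq_of_lands (hs.shift n) hs' h1 hu'.2 fun m hm => by
      rw [← Function.iterate_add_apply]; exact hno _ (by omega)
    subst h2
    rcases hu with hu | hu
    · obtain ⟨x, rfl⟩ := exists_F_iterate_eq n ((start_nonneg hs').trans hu.2.1.le)
      have hx : D.start s < x := by
        rw [h.1, ← (F_iterate_strictMono n).lt_iff_lt, ← minPot_shift hs]; exact hu.1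
      have h3 := ray_noncrit (D := D) hs hx hn
      rw [(ray_functional_iterate hs hx n).2, ← hu.2.2] at h3
      exact hv.elim h3.1 h3.2
    · have h3 : (E a b)^[n] w = v := tendsto_nhds_unique h1.2.2.1 hu.2.2.2.1
      rw [← h3] at hv
      exact hv.elim (hno n hn).1 (hno n hn).2

end StripData

end

end CosineFamily

end

theorem theorem6p3 (a b : ℂ) (ha : a ≠ 0) (hb : b ≠ 0) :
    (∃ R : Symb → Set ℂ, IsStripLabelling a b R) ∧
    ∀ R : Symb → Set ℂ, IsStripLabelling a b R →
      ∃ (τ : Address → ℝ) (g : Address → ℝ → ℂ), IsDynamicRays a b R τ g ∧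
        ∀ w : ℂ, IsEscaping a b w →
          (¬ IsExceptional a b τ g w →
            ∃! p : Address × ℝ, ExpBounded p.1 ∧ minPot p.1 ≤ p.2 ∧
              Xor (OnRay τ g p.1 p.2 w)
                (p.2 = minPot p.1 ∧ LandsUniformly a b τ g p.1 w)) ∧
          (IsExceptional a b τ g w →
            (∀ (s : Address) (t : ℝ), ExpBounded s → ¬ OnRay τ g s t w) ∧
            ((∃ s : Address, ExpBounded s ∧ LandsUniformly a b τ g s w) →
              ∃ m : ℕ, 1 ≤ m ∧ ((E a b)^[m] w = v₁ a b ∨ (E a b)^[m] w = v₂ a b))) := by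
  refine ⟨exists_isStripLabelling ha hb, fun R hR => ?_⟩
  obtain ⟨D⟩ := exists_stripData ha hb hR
  refine ⟨D.start, D.ray, StripData.isDynamicRays, fun w hw => ⟨fun hne => ?_, fun hex =>
    ⟨fun s t hs => StripData.not_onRay_of_isExceptional hex hs, fun ⟨s, hs, h⟩ =>
      StripData.exists_iterate_critical_of_lands hex hs h⟩⟩⟩
  -- The alternatives exclude each other since a potential on the ray is strictly greater than
  -- `t_s`.
  have key : ∀ s t, Xor (OnRay D.start D.ray s t w)
      (t = minPot s ∧ LandsUniformly a b D.start D.ray s w) ↔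
      OnClosedRay a b D.start D.ray s t w := fun s t => by
    refine ⟨fun h => h.or, fun h => ?_⟩
    rcases h with h | h
    · exact Or.inl ⟨h, fun h' => h.1.ne' h'.1⟩
    · exact Or.inr ⟨h, fun h' => h'.1.ne' h.1⟩
  obtain ⟨s, t, hs, h⟩ := StripData.exists_onClosedRay hw hne
  refine ⟨(s, t), ⟨hs, ?_, (key s t).2 h⟩, ?_⟩
  · rcases h with h | h
    · exact h.1.le
    · exact h.1.ge
  · rintro ⟨s', t'⟩ ⟨hs', -, h'⟩
    obtain ⟨rfl, rfl⟩ := StripData.onClosedRay_unique hs hs' hne h ((key s' t').1 h')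
    rfl
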